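/- **Theorem (strict quasi-regularity, $0<\alpha\le 1$).** Let $S$ be one of the following spaces of real sequences $\mathbf x=(x_i)_{i\in\mathbb N}$: - $l^p_{(\beta_i)}$, with $1\le p<\infty$ and $\beta_i>0$: the sequences with $\|\mathbf x\|=(\sum_i\beta_i|x_i|^p)^{1/p}<\infty$; - $l^\infty_{(\beta_i)}$, with $\beta_i>0$: the sequences with $\|\mathbf x\|=\sup_i\beta_i|x_i|<\infty$; - $\mathbb R^{\mathbb N}$ with the product topology. Let $\mu$ be a Borel probability measure on $S$, let $X_i(\mathbf x)=x_i$, and let $\mu(\cdot\,|\,\sigma_{i^c})$ be the regular conditional distribution of $X_i$ given the $\sigma$-field $\sigma_{i^c}$ generated by the coordinates $X_j$, $j\ne i$. Let $\mathcal FC_0^\infty$ be the linear span of the functions $\mathbf x\mapsto f(x_1,\dots,x_n)$ with $n\ge 1$ and $f\in C_0^\infty(\mathbb R^n)$. For $0<\alpha\le1$ and $u,v\in\mathcal FC^\infty_0$ put $$\mathcal E_{(\alpha)}(u,v)=\sum_{i}\int_S\int_{\mathbb R}1_{\{y\ne x_i\}}\frac{\big(u(\mathbf x^{i,y})-u(\mathbf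 x)\big)\big(v(\mathbf x^{i,y})-v(\mathbf x)\big)}{|y-x_i|^{\alpha+1}}\,\mu(dy\,|\,\sigma_{i^c})(\mathbf x)\,\mu(d\mathbf x),$$ where $\mathbf x^{i,y}$ is $\mathbf x$ with its $i$-th coordinate replaced by $y$. Then, for $0<\alpha\le 1$, the form $\mathcal E_{(\alpha)}$ on $\mathcal FC_0^\infty$ is closable in $L^2(S;\mu)$, and its closure is a strictly quasi-regular (in particular, quasi-regular) symmetric Dirichlet form in the sense of Ma–Röckner, in each of the following cases. (i) $S=l^p_{(\beta_i)}$, $1\le p<\infty$, and there are a positive sequence $(\gamma_i)$ with $(\gamma_i^{-1})\in l^p$ and an $M_0<\infty$ such that $$\sum_{i}\beta_i^{2/p}\gamma_i^2\,\mu\big(|X_i|>M_0\,\beta_i^{-1/p}\gamma_i^{-1}\big)<\infty,\qquad \mu\Big(\bigcup_{M\in\mathbb N}\{|X_i|\le M\beta_i^{-1/p}\gamma_i^{-1/p}\ \forall i\}\Big)=1.$$ (ii) $S=l^\infty_{(\beta_i)}$, and there are a sequence $0<\gamma_1\le\gamma_2\le\cdots\to\infty$ and an $M_0<\infty$ such that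 $$\sum_{i}\beta_i^{2}\gamma_i^2\,\mu\big(|X_i|>M_0\,\beta_i^{-1}\gamma_i^{-1}\big)<\infty,\qquad \mu\Big(\bigcup_{M\in\mathbb N}\{|X_i|\le M\beta_i^{-1}\gamma_i^{-1}\ \forall i\}\Big)=1.$$ (iii) $S=\mathbb R^{\mathbb N}$, with no further condition. -/

import Mathlib

open MeasureTheory ProbabilityTheory Filter Topology
open scoped ENNReal ContDiff

/-! ### Weighted sequence spaces -/

/-- The real sequences `x` for which `(w i * x i)` belongs to `ℓ^p`, `1 ≤ p ≤ ∞`. -/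
def WeightedLp (w : ℕ → ℝ) (p : ℝ≥0∞) : Type :=
  {x : ℕ → ℝ // Memℓp (fun i => w i * x i) p}

namespace WeightedLp

variable {w : ℕ → ℝ} {p : ℝ≥0∞}

/-- The `i`-th coordinate of a sequence. -/
def coord (x : WeightedLp w p) (i : ℕ) : ℝ := x.1 i

/-- The weighted sequence `(w i * x i)` as an element of Mathlib's `ℓ^p`. -/
noncomputable def toLp (x : WeightedLp w p) : lp (fun _ : ℕ => ℝ) p := ⟨fun i => w i * x.1 i, x.2⟩

/-- The distance is the `ℓ^p`-norm of the weighted difference. It is a genuine metric as soon as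
all the weights are non-zero. -/
noncomputable instance [Fact (1 ≤ p)] : PseudoMetricSpace (WeightedLp w p) :=
  PseudoMetricSpace.induced toLp inferInstance

noncomputable instance [Fact (1 ≤ p)] : MeasurableSpace (WeightedLp w p) := borel _

instance [Fact (1 ≤ p)] : BorelSpace (WeightedLp w p) := ⟨rfl⟩

end WeightedLp

/-- `l^p_(β)` for `p < ∞`: the sequences with `∑ β_i |x_i|^p < ∞`, with the norm
`(∑ β_i |x_i|^p)^(1/p)`. -/
abbrev WeightedLpFinite (β : ℕ → ℝ) (p : ℝ≥0∞) : Type :=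
  WeightedLp (fun i => β i ^ (1 / p.toReal)) p

/-- `l^∞_(β)`: the sequences with `sup β_i |x_i| < ∞`, with the norm `sup β_i |x_i|`. -/
abbrev WeightedLpTop (β : ℕ → ℝ) : Type := WeightedLp β ∞

theorem weight_abs_rpow {b t q : ℝ} (hb : 0 ≤ b) (hq : 0 < q) :
    ‖b ^ (1 / q) * t‖ ^ q = b * |t| ^ q := by
  rw [norm_mul, Real.mul_rpow (norm_nonneg _) (norm_nonneg _), Real.norm_eq_abs,
    Real.norm_eq_abs, abs_of_nonneg (Real.rpow_nonneg hb _), ← Real.rpow_mul hb,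
    one_div_mul_cancel hq.ne', Real.rpow_one]

/-- Membership in `l^p_(β)` is `∑ β_i |x_i|^p < ∞`. -/
theorem memWeightedLpFinite_iff {β : ℕ → ℝ} {p : ℝ≥0∞} (hβ : ∀ i, 0 ≤ β i)
    (hp : 0 < p.toReal) (x : ℕ → ℝ) :
    Memℓp (fun i => β i ^ (1 / p.toReal) * x i) p ↔
      Summable (fun i => β i * |x i| ^ p.toReal) := by
  rw [memℓp_gen_iff hp]
  exact summable_congr fun i => weight_abs_rpow (hβ i) hp

/-- The metric of `l^p_(β)` is the one of the norm `(∑ β_i |x_i|^p)^(1/p)`. -/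
theorem dist_weightedLpFinite {β : ℕ → ℝ} {p : ℝ≥0∞} [Fact (1 ≤ p)] (hβ : ∀ i, 0 ≤ β i)
    (hp : 0 < p.toReal) (x y : WeightedLpFinite β p) :
    dist x y = (∑' i, β i * |x.coord i - y.coord i| ^ p.toReal) ^ (1 / p.toReal) := by
  change dist x.toLp y.toLp = _
  rw [dist_eq_norm, lp.norm_eq_tsum_rpow hp]
  congr 1
  refine tsum_congr fun i => ?_
  rw [← weight_abs_rpow (hβ i) hp, mul_sub]
  rfl

/-- The metric of `l^∞_(β)` is the one of the norm `sup β_i |x_i|`. -/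
theorem dist_weightedLpTop {β : ℕ → ℝ} (hβ : ∀ i, 0 ≤ β i) (x y : WeightedLpTop β) :
    dist x y = ⨆ i, β i * |x.coord i - y.coord i| := by
  change dist x.toLp y.toLp = _
  rw [dist_eq_norm, lp.norm_eq_ciSup]
  congr 1
  ext i
  have h : β i * |x.coord i - y.coord i| = |β i * x.coord i - β i * y.coord i| := by
    rw [← mul_sub, abs_mul, abs_of_nonneg (hβ i)]
  rw [h]
  rfl

/-! ### The non-local form on smooth cylinder functions

In this part `X : S → ℕ → ℝ` is the inclusion of the state space `S` into the space of all real
sequences, so that `X x i` is the `i`-th coordinate of `x`. -/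

/-- Smooth cylinder functions, as functions on the space of all real sequences: the linear span of
the functions `x ↦ f (x_1, …, x_n)` with `n ≥ 1` and `f` smooth with compact support on `ℝ^n`. -/
def cylinderCore : Submodule ℝ ((ℕ → ℝ) → ℝ) :=
  Submodule.span ℝ {F | ∃ n : ℕ, 0 < n ∧ ∃ f : (Fin n → ℝ) → ℝ,
    ContDiff ℝ ∞ f ∧ HasCompactSupport f ∧ F = fun x => f (fun j => x j)}

section Form

variable {S : Type*} [MeasurableSpace S]

/-- The conditional distribution of the coordinate `x_i` given the σ-field generated by all the
other coordinates, at the point `x`. -/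
noncomputable def condLaw (μ : Measure S) [IsFiniteMeasure μ] (X : S → ℕ → ℝ) (i : ℕ) (x : S) :
    Measure ℝ :=
  condDistrib (fun z => X z i) (fun z (j : {j : ℕ // j ≠ i}) => X z j) μ (fun j => X x j)

/-- `Φ_α(u, v; y, y', x \ x_i)`, with the kernel `|y - y'|^(-(α+1))`. -/
noncomputable def jumpDensity (α : ℝ) (u v : (ℕ → ℝ) → ℝ) (i : ℕ) (y y' : ℝ) (x : ℕ → ℝ) : ℝ :=
  1 / |y - y'| ^ (α + 1) *
    (u (Function.update x i y) - u (Function.update x i y')) *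
    (v (Function.update x i y) - v (Function.update x i y'))

/-- The part of the form that belongs to the `i`-th coordinate. -/
noncomputable def coordForm (μ : Measure S) [IsFiniteMeasure μ] (X : S → ℕ → ℝ) (α : ℝ) (i : ℕ)
    (u v : (ℕ → ℝ) → ℝ) : ℝ :=
  ∫ x, ∫ y, Set.indicator {y : ℝ | y ≠ X x i}
    (fun y => jumpDensity α u v i y (X x i) (X x)) y ∂(condLaw μ X i x) ∂μ

/-- The form `E_(α)`; on cylinder functions only finitely many terms of the sum are non-zero. -/
noncomputable def preForm (μ : Measure S) [IsFiniteMeasure μ] (X : S → ℕ → ℝ) (α : ℝ)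
    (u v : (ℕ → ℝ) → ℝ) : ℝ :=
  ∑' i, coordForm μ X α i u v

/-- The sequence `F` of cylinder functions is Cauchy for the form `E_(α)` and converges to `u` in
`L²(S; μ)`. -/
def IsApproxSeq (μ : Measure S) [IsFiniteMeasure μ] (X : S → ℕ → ℝ) (α : ℝ)
    (F : ℕ → (ℕ → ℝ) → ℝ) (u : Lp ℝ 2 μ) : Prop :=
  (∀ n, F n ∈ cylinderCore) ∧
  Tendsto (fun n => eLpNorm (fun x => F n (X x) - u x) 2 μ) atTop (𝓝 0) ∧
  ∀ ε > 0, ∃ N, ∀ n ≥ N, ∀ m ≥ N, preForm μ X α (F n - F m) (F n - F m) < ε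

end Form

/-! ### Symmetric Dirichlet forms -/

/-- Symmetric Dirichlet forms on `L²(S; μ)`: densely defined, closed, non-negative symmetric
bilinear forms on which the unit contraction `u ↦ min (max u 0) 1` operates. -/
structure DirichletForm {S : Type*} [MeasurableSpace S] (μ : Measure S) where
  /-- The domain of the form. -/
  domain : Submodule ℝ (Lp ℝ 2 μ)
  /-- The form itself. -/
  form : domain →ₗ[ℝ] domain →ₗ[ℝ] ℝ
  dense : Dense (domain : Set (Lp ℝ 2 μ))
  symm : ∀ u v, form u v = form v u
  nonneg : ∀ u, 0 ≤ form u u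
  /-- The domain is complete for the norm `(E(u,u) + ‖u‖²)^(1/2)`. -/
  closed : ∀ u : ℕ → domain,
    (∀ ε > 0, ∃ N, ∀ n ≥ N, ∀ m ≥ N,
      form (u n - u m) (u n - u m) + ‖(u n - u m : domain)‖ ^ 2 < ε) →
    ∃ v : domain,
      Tendsto (fun n => form (u n - v) (u n - v) + ‖(u n - v : domain)‖ ^ 2) atTop (𝓝 0)
  markov : ∀ u : domain, ∃ v : domain,
    (∀ᵐ x ∂μ, (v : Lp ℝ 2 μ) x = min (max ((u : Lp ℝ 2 μ) x) 0) 1) ∧ form v v ≤ form u u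

namespace DirichletForm

section Basic

variable {S : Type*} [MeasurableSpace S] {μ : Measure S} (E : DirichletForm μ)

/-- `E_1(u, v) = E(u, v) + (u, v)_{L²}`. -/
noncomputable def form₁ (u v : E.domain) : ℝ :=
  E.form u v + inner ℝ (u : Lp ℝ 2 μ) (v : Lp ℝ 2 μ)

/-- `E` is the closure of `E_(α)` defined on the smooth cylinder functions: its domain consists
of the `L²`-limits of `E_(α)`-Cauchy sequences of cylinder functions, and along any such sequences
the values of `E_(α)` converge to the values of `E`. In particular, the existence of such an `E`
entails that `E_(α)` depends only on `μ`-classes and is closable. -/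
def IsClosureOf [IsFiniteMeasure μ] (X : S → ℕ → ℝ) (α : ℝ) : Prop :=
  (∀ u : Lp ℝ 2 μ, u ∈ E.domain ↔ ∃ F, IsApproxSeq μ X α F u) ∧
  ∀ (u v : E.domain) (F G : ℕ → (ℕ → ℝ) → ℝ),
    IsApproxSeq μ X α F u → IsApproxSeq μ X α G v →
    Tendsto (fun n => preForm μ X α (F n) (G n)) atTop (𝓝 (E.form u v))

/-- `h` is 1-excessive (for `h` in the domain). -/
def IsOneExcessive (h : E.domain) : Prop :=
  ∀ v : E.domain, (∀ᵐ x ∂μ, 0 ≤ (v : Lp ℝ 2 μ) x) → 0 ≤ E.form₁ h v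

/-- `w` is the reduced function `h_U` of `h` on `U`: the element of least `E_1`-energy among those
that dominate `h` almost everywhere on `U`. -/
def IsReduced (h : E.domain) (U : Set S) (w : E.domain) : Prop :=
  (∀ᵐ x ∂μ, x ∈ U → (h : Lp ℝ 2 μ) x ≤ (w : Lp ℝ 2 μ) x) ∧
  ∀ w' : E.domain, (∀ᵐ x ∂μ, x ∈ U → (h : Lp ℝ 2 μ) x ≤ (w' : Lp ℝ 2 μ) x) →
    E.form₁ w w ≤ E.form₁ w' w'

/-- The capacity `Cap_{1, G_1 φ}` of an open set `U`: the supremum of `E_1(h_U, G_1 φ)`, which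
equals `∫ h_U φ dμ`, over the 1-excessive functions `h ≤ 1` in the domain. -/
noncomputable def strictCap (φ : Lp ℝ 2 μ) (U : Set S) : ℝ≥0∞ :=
  ⨆ (h : E.domain) (w : E.domain)
    (_ : E.IsOneExcessive h ∧ (∀ᵐ x ∂μ, (h : Lp ℝ 2 μ) x ≤ 1) ∧ E.IsReduced h U w),
    ENNReal.ofReal (∫ x, (w : Lp ℝ 2 μ) x * φ x ∂μ)

end Basic

section Regular

variable {S : Type*} [TopologicalSpace S] [MeasurableSpace S] {μ : Measure S}
  (E : DirichletForm μ)

/-- An `E`-nest: an increasing sequence of closed sets `F k` such that the elements of the domain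
that vanish almost everywhere outside some `F k` are `E_1`-dense in the domain. -/
def IsNest (F : ℕ → Set S) : Prop :=
  (∀ k, IsClosed (F k)) ∧ Monotone F ∧
  ∀ (u : E.domain), ∀ ε > 0, ∃ (k : ℕ) (v : E.domain),
    (∀ᵐ x ∂μ, x ∉ F k → (v : Lp ℝ 2 μ) x = 0) ∧ E.form₁ (u - v) (u - v) < ε

/-- A strict `E`-nest: an increasing sequence of closed sets `F k` such that the capacity
`Cap_{1, G_1 φ}` of the complements tends to zero, for the functions `0 < φ ≤ 1` in `L²`. -/
def IsStrictNest (F : ℕ → Set S) : Prop :=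
  (∀ k, IsClosed (F k)) ∧ Monotone F ∧
  ∀ φ : Lp ℝ 2 μ, (∀ᵐ x ∂μ, 0 < φ x ∧ φ x ≤ 1) →
    Tendsto (fun k => E.strictCap φ (F k)ᶜ) atTop (𝓝 0)

/-- `f` is quasi-continuous with respect to the given class of nests. -/
def IsQuasiContinuous (Nest : (ℕ → Set S) → Prop) (f : S → ℝ) : Prop :=
  ∃ F, Nest F ∧ ∀ k, ContinuousOn f (F k)

/-- `N` is exceptional with respect to the given class of nests. -/
def IsExceptional (Nest : (ℕ → Set S) → Prop) (N : Set S) : Prop :=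
  ∃ F, Nest F ∧ N ⊆ ⋂ k, (F k)ᶜ

/-- `f` is a quasi-continuous version of `u`. -/
def IsQuasiContinuousVersion (Nest : (ℕ → Set S) → Prop) (u : E.domain) (f : S → ℝ) : Prop :=
  IsQuasiContinuous Nest f ∧ f =ᵐ[μ] (u : Lp ℝ 2 μ)

/-- Some set of elements with quasi-continuous versions is `E_1`-dense in the domain. -/
def HasDenseQuasiContinuous (Nest : (ℕ → Set S) → Prop) : Prop :=
  ∃ A : Set E.domain, (∀ u ∈ A, ∃ f, E.IsQuasiContinuousVersion Nest u f) ∧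
    ∀ (u : E.domain), ∀ ε > 0, ∃ v ∈ A, E.form₁ (u - v) (u - v) < ε

/-- Quasi-regularity. -/
def IsQuasiRegular : Prop :=
  (∃ F, E.IsNest F ∧ ∀ k, IsCompact (F k)) ∧
  E.HasDenseQuasiContinuous E.IsNest ∧
  ∃ (u : ℕ → E.domain) (f : ℕ → S → ℝ) (N : Set S),
    (∀ n, E.IsQuasiContinuousVersion E.IsNest (u n) (f n)) ∧
    IsExceptional E.IsNest N ∧
    ∀ x ∉ N, ∀ y ∉ N, x ≠ y → ∃ n, f n x ≠ f n y

/-- Strict quasi-regularity, for a state space `S` that is not locally compact. The cemetery `∆`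
is then an isolated point of `S ∪ {∆}` at which all functions are zero. So compactness of
`F k ∪ {∆}` and continuity on `F k ∪ {∆}` mean the same on `F k`, and separating the points of
`(S ∪ {∆}) \ N` means separating the points of `S \ N` without a common zero there. -/
def IsStrictlyQuasiRegular : Prop :=
  (∃ F, E.IsStrictNest F ∧ ∀ k, IsCompact (F k)) ∧
  E.HasDenseQuasiContinuous E.IsStrictNest ∧
  ∃ (u : ℕ → E.domain) (f : ℕ → S → ℝ) (N : Set S),
    (∀ n, E.IsQuasiContinuousVersion E.IsStrictNest (u n) (f n)) ∧
    IsExceptional E.IsStrictNest N ∧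
    (∀ x ∉ N, ∀ y ∉ N, x ≠ y → ∃ n, f n x ≠ f n y) ∧
    ∀ x ∉ N, ∃ n, f n x ≠ 0

end Regular

end DirichletForm

/-! Take the law of a sequence before and after its `i`-th coordinate is resampled, weight it by `|y
- x_i|^(-(α+1))` off the diagonal, and sum over `i`. The result is a measure `J` on pairs with
`E_(α)(u, v) = ∫ Δu Δv dJ`, where `Δ` is the increment along a jump (`preForm_eq_integral`).
Resampling preserves the law of the sequence (`map_snd_pairLaw`), so both marginals of `J` are
absolutely continuous with respect to it. Almost everywhere convergence of functions therefore
passes to increments, and `Δ` is closable from `L²(μ)` to `L²(J)` (`snd_eq_zero_of_mem_graph`). The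
Dirichlet form is the squared norm of the closed operator.

Membership in the domain is always proved in the same way: an `L²`-limit of domain elements of
bounded energy is in the domain, because suitable convex combinations converge in graph norm
(`exists_mem_closure_convexHull_of_bounded`). With `α ≤ 1`, a bounded Lipschitz function of finitely
many coordinates has finite energy, and mollification puts it into the domain
(`IsLipCylinder.inClosure`); this gives the Markov property.

Quasi-regularity reduces to functions `W_M` that are one outside compact sets `K_M` and whose
`E_1`-energy tends to zero. Dominating reduced functions by `W_M` gives a strict nest, and
approximating `F` by `F - F W_M` gives a nest (`HasCutoffs.isStrictNest`, `HasCutoffs.isNest`). The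
`W_M` are built from increasing potentials `N_k` with compact joint level sets: `W_M` is the limit
in `k` of a cutoff of `N_k` at level `M + 1`, and it reacts only to relative changes of `N_k`. If
`N_k` ignores coordinate `i` below a scale `s_i ≤ 1`, and the shares `ρ_i` of the coordinates in a
relative change sum to at most one, then the energy of the cutoff is at most a constant times `θ(N >
M + 1)`, where `θ` is `μ` plus the measures `s_i^(-2) μ(· ∩ {|X_i| > s_i})` over the `i` with `s_i <
1`. The summability assumption makes `θ` finite, and `θ ≪ μ`, so these energies vanish as soon as
the potentials are almost surely bounded.

It remains to choose the potentials. A weighted supremum of truncated coordinates serves `ℝ^ℕ` (with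
`s_i = 1`) and `l^∞`. For `l^p` one takes `∑ c_j β_j max(|x_j|, s_j)^p` with `c_j → ∞` so slowly
that the sum is almost surely finite; the growth of `c_j` makes the tails uniformly small on level
sets, hence the level sets compact. -/

/-! ### Convex combinations of a bounded sequence -/

/-- If the first components of a sequence in a product converge and the second components are
bounded in a Hilbert space, some pair with the limit as first component lies in the closed convex
hull of the sequence. -/
theorem exists_mem_closure_convexHull_of_bounded {V H : Type*} [NormedAddCommGroup V]
    [NormedSpace ℝ V] [NormedAddCommGroup H] [InnerProductSpace ℝ H] [CompleteSpace H]
    (z : ℕ → V × H) (u : V) (hu : Tendsto (fun n => (z n).1) atTop (𝓝 u)) (B : ℝ)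
    (hB : ∀ n, ‖(z n).2‖ ≤ B) :
    ∃ g : H, ‖g‖ ≤ B ∧ (u, g) ∈ closure (convexHull ℝ (Set.range z)) := by
  -- The points of least norm in the closed convex hulls of the tails converge strongly, so no weak
  -- compactness is needed.
  set C : ℕ → Set H := fun n => closure (convexHull ℝ ((fun m => (z m).2) '' Set.Ici n)) with hC
  have hCconv : ∀ n, Convex ℝ (C n) := fun n => (convex_convexHull ℝ _).closure
  have hCmem : ∀ n, (z n).2 ∈ C n := fun n =>
    subset_closure (subset_convexHull ℝ _ ⟨n, Set.mem_Ici.2 le_rfl, rfl⟩)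
  have hCanti : ∀ n m, n ≤ m → C m ⊆ C n := fun n m h =>
    closure_mono (convexHull_mono (Set.image_mono (Set.Ici_subset_Ici.2 h)))
  have hmin : ∀ n, ∃ p ∈ C n, ∀ q ∈ C n, ‖p‖ ≤ ‖q‖ := by
    intro n
    obtain ⟨p, hp, hpe⟩ := exists_norm_eq_iInf_of_complete_convex ⟨_, hCmem n⟩
      (isClosed_closure.isComplete : IsComplete (C n)) (hCconv n) 0
    refine ⟨p, hp, fun q hq => ?_⟩
    have h1 : ‖(0 : H) - p‖ ≤ ‖(0 : H) - q‖ := by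
      rw [hpe]
      exact ciInf_le ⟨0, Set.forall_mem_range.2 fun _ => norm_nonneg _⟩ (⟨q, hq⟩ : C n)
    simpa using h1
  choose p hpC hpmin using hmin
  have hpB : ∀ n, ‖p n‖ ≤ B := fun n => (hpmin n _ (hCmem n)).trans (hB n)
  have hmono : Monotone (fun n => ‖p n‖ ^ 2) := fun n m h => by
    have := hpmin n _ (hCanti n m h (hpC m))
    dsimp only
    gcongr
  have hbdd : BddAbove (Set.range fun n => ‖p n‖ ^ 2) :=
    ⟨B ^ 2, by rintro _ ⟨n, rfl⟩; dsimp only; gcongr; exact hpB n⟩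
  have hlim := tendsto_atTop_ciSup hmono hbdd
  set d := ⨆ n, ‖p n‖ ^ 2
  have hdle : ∀ n, ‖p n‖ ^ 2 ≤ d := fun n => le_ciSup hbdd n
  -- The midpoint of `p n` and `p m` lies in `C n`, so its norm is at least `‖p n‖`; the
  -- parallelogram law does the rest.
  have hpar : ∀ n m, n ≤ m → ‖p m - p n‖ ^ 2 ≤ 2 * (d - ‖p n‖ ^ 2) := by
    intro n m h
    have h1 : (1 / 2 : ℝ) • p n + (1 / 2 : ℝ) • p m ∈ C n :=
      hCconv n (hpC n) (hCanti n m h (hpC m)) (by norm_num) (by norm_num) (by norm_num)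
    have h2 := hpmin n _ h1
    rw [← smul_add, norm_smul, Real.norm_of_nonneg (by norm_num)] at h2
    have h3 := parallelogram_law_with_norm ℝ (p m) (p n)
    have h4 := hdle m
    rw [add_comm (p n)] at h2
    nlinarith [norm_nonneg (p n), norm_nonneg (p m + p n)]
  have hcauchy : CauchySeq p := by
    rw [Metric.cauchySeq_iff']
    intro ε hε
    have h1 : ∀ᶠ n in atTop, d - ε ^ 2 / 2 < ‖p n‖ ^ 2 :=
      hlim.eventually (lt_mem_nhds (by have := sq_pos_of_pos hε; linarith))
    obtain ⟨N, hN⟩ := h1.exists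
    refine ⟨N, fun n hn => ?_⟩
    rw [dist_eq_norm]
    have := hpar N n hn
    exact lt_of_pow_lt_pow_left₀ 2 hε.le (by linarith)
  obtain ⟨g, hg⟩ := cauchySeq_tendsto_of_complete hcauchy
  refine ⟨g, le_of_tendsto hg.norm (Eventually.of_forall hpB), ?_⟩
  rw [Metric.mem_closure_iff]
  intro ε hε
  obtain ⟨n, hn1, hn2⟩ : ∃ n, (∀ m ≥ n, dist (z m).1 u < ε / 2) ∧ dist (p n) g < ε / 2 := by
    obtain ⟨N1, h1⟩ := (Metric.tendsto_atTop.1 hu) (ε / 2) (by positivity)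
    obtain ⟨N2, h2⟩ := (Metric.tendsto_atTop.1 hg) (ε / 2) (by positivity)
    exact ⟨max N1 N2, fun m hm => h1 m ((le_max_left _ _).trans hm), h2 _ (le_max_right _ _)⟩
  obtain ⟨q, hq, hqp⟩ := Metric.mem_closure_iff.1 (hpC n) (ε / 2) (by positivity)
  -- A convex combination of second components lifts to one of pairs from the same tail; its first
  -- component stays near `u` because balls are convex.
  have himg : (fun m => (z m).2) '' Set.Ici n = LinearMap.snd ℝ V H '' (z '' Set.Ici n) := by
    rw [Set.image_image]; rfl
  rw [himg, ← LinearMap.image_convexHull] at hq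
  obtain ⟨w, hw, rfl⟩ := hq
  refine ⟨w, convexHull_mono (Set.image_subset_range _ _) hw, ?_⟩
  have hw1 : w.1 ∈ Metric.ball u (ε / 2) := by
    have h1 : LinearMap.fst ℝ V H w ∈ convexHull ℝ (LinearMap.fst ℝ V H '' (z '' Set.Ici n)) := by
      rw [← LinearMap.image_convexHull]; exact ⟨w, hw, rfl⟩
    refine convexHull_min ?_ (convex_ball u (ε / 2)) h1
    rintro _ ⟨_, ⟨m, hm, rfl⟩, rfl⟩
    exact hn1 m hm
  rw [Prod.dist_eq]
  refine max_lt ?_ ?_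
  · rw [dist_comm]; exact (Metric.mem_ball.1 hw1).trans (by linarith)
  · calc dist g w.2 ≤ dist g (p n) + dist (p n) w.2 := dist_triangle _ _ _
      _ < ε / 2 + ε / 2 := add_lt_add (by rwa [dist_comm]) hqp
      _ = ε := by ring

/-! ### Forms given by a jump measure -/

/-- The increment of `F` along a jump from `z.1` to `z.2`. -/
def increment {T : Type*} (F : T → ℝ) (z : T × T) : ℝ := F z.2 - F z.1

theorem Measurable.increment {T : Type*} [MeasurableSpace T] {F : T → ℝ} (hF : Measurable F) :
    Measurable (increment F) :=
  (hF.comp measurable_snd).sub (hF.comp measurable_fst)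

/-- A space `C` of functions of finite energy for the jump measure `J`, on a state space `S`
mapped by `X` into the space `T` on which `J` lives. -/
structure IsJumpCore {S T : Type*} [MeasurableSpace S] [MeasurableSpace T] (μ : Measure S)
    (X : S → T) (J : Measure (T × T)) (C : Submodule ℝ (T → ℝ)) : Prop where
  measurable_incl : Measurable X
  quasi_fst : Measure.QuasiMeasurePreserving Prod.fst J (μ.map X)
  quasi_snd : Measure.QuasiMeasurePreserving Prod.snd J (μ.map X)
  measurable : ∀ F ∈ C, Measurable F
  memLp : ∀ F ∈ C, MemLp (fun x => F (X x)) 2 μ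
  memLp_increment : ∀ F ∈ C, MemLp (increment F) 2 J

namespace IsJumpCore

variable {S T : Type*} [MeasurableSpace S] [MeasurableSpace T] {μ : Measure S} {X : S → T}
  {J : Measure (T × T)} {C : Submodule ℝ (T → ℝ)} (h : IsJumpCore μ X J C)
include h

/-- The map sending a function of the core to its class and the class of its increments. -/
noncomputable def coreMap : C →ₗ[ℝ] Lp ℝ 2 μ × Lp ℝ 2 J where
  toFun F := ((h.memLp F F.2).toLp _, (h.memLp_increment F F.2).toLp _)
  map_add' F G := by
    refine Prod.ext ?_ ?_
    · exact MemLp.toLp_add (h.memLp F F.2) (h.memLp G G.2)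
    · refine Eq.trans ?_ (MemLp.toLp_add (h.memLp_increment F F.2) (h.memLp_increment G G.2))
      refine MemLp.toLp_congr (h.memLp_increment _ (F + G).2)
        ((h.memLp_increment F F.2).add (h.memLp_increment G G.2))
        (Eventually.of_forall fun z => ?_)
      simp only [increment, Submodule.coe_add, Pi.add_apply]
      ring
  map_smul' c F := by
    refine Prod.ext ?_ ?_
    · exact MemLp.toLp_const_smul c (h.memLp F F.2)
    · refine Eq.trans ?_ (MemLp.toLp_const_smul c (h.memLp_increment F F.2))
      refine MemLp.toLp_congr (h.memLp_increment _ (c • F).2)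
        ((h.memLp_increment F F.2).const_smul c) (Eventually.of_forall fun z => ?_)
      simp only [increment, Submodule.coe_smul, Pi.smul_apply, smul_eq_mul]
      ring

/-- The closed graph of the increment operator. -/
noncomputable def graph : Submodule ℝ (Lp ℝ 2 μ × Lp ℝ 2 J) :=
  (LinearMap.range h.coreMap).topologicalClosure

theorem isClosed_graph : IsClosed (h.graph : Set (Lp ℝ 2 μ × Lp ℝ 2 J)) :=
  Submodule.isClosed_topologicalClosure _

theorem coreMap_mem_graph (F : C) : h.coreMap F ∈ h.graph :=
  Submodule.le_topologicalClosure _ ⟨F, rfl⟩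

theorem exists_tendsto_coreMap {z : Lp ℝ 2 μ × Lp ℝ 2 J} (hz : z ∈ h.graph) :
    ∃ F : ℕ → C, Tendsto (fun n => h.coreMap (F n)) atTop (𝓝 z) := by
  have hz' : z ∈ closure (LinearMap.range h.coreMap : Set (Lp ℝ 2 μ × Lp ℝ 2 J)) := hz
  obtain ⟨w, hw, hwz⟩ := mem_closure_iff_seq_limit.1 hz'
  choose F hF using hw
  exact ⟨F, by simpa only [hF] using hwz⟩

/-- Elements of the closed graph come from functions on `T` and their increments. -/
theorem exists_representative {z : Lp ℝ 2 μ × Lp ℝ 2 J} (hz : z ∈ h.graph) :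
    ∃ F : T → ℝ, Measurable F ∧ (∀ᵐ x ∂μ, F (X x) = z.1 x) ∧ ∀ᵐ q ∂J, z.2 q = increment F q := by
  obtain ⟨F, hF⟩ := h.exists_tendsto_coreMap hz
  have hF1 : Tendsto (fun n => (h.coreMap (F n)).1) atTop (𝓝 z.1) :=
    (continuous_fst.tendsto z).comp hF
  have hF2 : Tendsto (fun n => (h.coreMap (F n)).2) atTop (𝓝 z.2) :=
    (continuous_snd.tendsto z).comp hF
  obtain ⟨a, ha, hae⟩ := (tendstoInMeasure_of_tendsto_Lp hF1).exists_seq_tendsto_ae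
  obtain ⟨b, hb, hbe⟩ := (tendstoInMeasure_of_tendsto_Lp
    (hF2.comp ha.tendsto_atTop)).exists_seq_tendsto_ae
  have h1 : ∀ᵐ x ∂μ, ∀ n, (h.coreMap (F n)).1 x = (F n : T → ℝ) (X x) :=
    ae_all_iff.2 fun n => (h.memLp _ (F n).2).coeFn_toLp
  have h2 : ∀ᵐ q ∂J, ∀ n, (h.coreMap (F n)).2 q = increment (F n : T → ℝ) q :=
    ae_all_iff.2 fun n => (h.memLp_increment _ (F n).2).coeFn_toLp
  set f : ℕ → T → ℝ := fun n => F (a (b n)) with hf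
  have hfm : ∀ n, Measurable (f n) := fun n => h.measurable _ (F (a (b n))).2
  have h3 : ∀ᵐ x ∂μ, Tendsto (fun n => f n (X x)) atTop (𝓝 (z.1 x)) := by
    filter_upwards [hae, h1] with x hx hx1
    have := hx.comp hb.tendsto_atTop
    simpa only [Function.comp_def, hx1] using this
  -- Convergence has to hold for the law on `T`, since it is this law that controls the two ends of
  -- a jump.
  have h4 : ∀ᵐ t ∂(μ.map X), ∃ l, Tendsto (fun n => f n t) atTop (𝓝 l) := by
    rw [ae_map_iff h.measurable_incl.aemeasurable (measurableSet_exists_tendsto hfm)]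
    filter_upwards [h3] with x hx using ⟨_, hx⟩
  obtain ⟨G, hG, hGlim⟩ := measurable_limit_of_tendsto_metrizable_ae
    (fun n => (hfm n).aemeasurable) h4
  refine ⟨G, hG, ?_, ?_⟩
  · filter_upwards [h3, ae_of_ae_map h.measurable_incl.aemeasurable hGlim] with x hx hx'
    exact tendsto_nhds_unique hx' hx
  · filter_upwards [hbe, h2, h.quasi_fst.ae hGlim, h.quasi_snd.ae hGlim] with q hq hq2 hq3 hq4
    refine tendsto_nhds_unique hq ?_
    simp only [Function.comp_def, hq2]
    exact hq4.sub hq3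

/-- Both marginals of `J` are absolutely continuous with respect to `μ.map X`, so almost every jump
avoids a given null set at both ends. -/
theorem increment_congr {F G : T → ℝ} (hF : Measurable F) (hG : Measurable G)
    (hFG : ∀ᵐ x ∂μ, F (X x) = G (X x)) : increment F =ᵐ[J] increment G := by
  have h1 : ∀ᵐ t ∂(μ.map X), F t = G t :=
    (ae_map_iff h.measurable_incl.aemeasurable (measurableSet_eq_fun hF hG)).2 hFG
  filter_upwards [h.quasi_fst.ae h1, h.quasi_snd.ae h1] with q hq1 hq2
  simp only [increment, hq1, hq2]

theorem graph_snd_eq {z : Lp ℝ 2 μ × Lp ℝ 2 J} (hz : z ∈ h.graph) {F : T → ℝ}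
    (hF : Measurable F) (hFz : ∀ᵐ x ∂μ, F (X x) = z.1 x) : z.2 =ᵐ[J] increment F := by
  obtain ⟨G, hG, hG1, hG2⟩ := h.exists_representative hz
  refine EventuallyEq.trans hG2 (h.increment_congr hG hF ?_)
  filter_upwards [hFz, hG1] with x h1 h2
  rw [h1, h2]

/-- This is closability: the zero function represents `z.1`, and its increments vanish. -/
theorem snd_eq_zero_of_mem_graph (z : Lp ℝ 2 μ × Lp ℝ 2 J) (hz : z ∈ h.graph) (h0 : z.1 = 0) :
    z.2 = 0 := by
  have h1 : ∀ᵐ x ∂μ, (fun _ : T => (0 : ℝ)) (X x) = z.1 x := by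
    rw [h0]
    filter_upwards [Lp.coeFn_zero ℝ 2 μ] with x hx
    exact hx.symm
  rw [Lp.eq_zero_iff_ae_eq_zero]
  filter_upwards [h.graph_snd_eq hz measurable_const h1] with q hq
  simp [hq, increment]

theorem graph_ext {z w : Lp ℝ 2 μ × Lp ℝ 2 J} (hz : z ∈ h.graph) (hw : w ∈ h.graph)
    (hzw : z.1 = w.1) : z.2 = w.2 := by
  have := h.snd_eq_zero_of_mem_graph (z - w) (h.graph.sub_mem hz hw) (by simp [hzw])
  simpa [sub_eq_zero] using this

/-- `F` belongs to the closure of the core. -/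
structure InClosure (F : T → ℝ) : Prop where
  measurable : Measurable F
  memLp : MemLp (fun x => F (X x)) 2 μ
  memLp_increment : MemLp (increment F) 2 J
  mem_graph : (memLp.toLp _, memLp_increment.toLp _) ∈ h.graph

theorem inClosure_of_mem {F : T → ℝ} (hF : F ∈ C) : h.InClosure F :=
  ⟨h.measurable F hF, h.memLp F hF, h.memLp_increment F hF, h.coreMap_mem_graph ⟨F, hF⟩⟩

theorem inClosure_of_mem_graph {z : Lp ℝ 2 μ × Lp ℝ 2 J} (hz : z ∈ h.graph) {F : T → ℝ}
    (hF : Measurable F) (hFz : ∀ᵐ x ∂μ, F (X x) = z.1 x) : h.InClosure F := by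
  have h1 : MemLp (fun x => F (X x)) 2 μ := (Lp.memLp z.1).ae_eq (hFz.mono fun _ hx => hx.symm)
  have h2 : MemLp (increment F) 2 J := (Lp.memLp z.2).ae_eq (h.graph_snd_eq hz hF hFz)
  refine ⟨hF, h1, h2, ?_⟩
  have e1 : h1.toLp _ = z.1 := Lp.ext (h1.coeFn_toLp.trans hFz)
  have e2 : h2.toLp _ = z.2 := Lp.ext (h2.coeFn_toLp.trans (h.graph_snd_eq hz hF hFz).symm)
  rw [e1, e2]
  exact hz

/-- An `L²`-limit of elements of the closed graph with bounded energy is in the domain. -/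
theorem exists_mem_graph_of_bounded {z : ℕ → Lp ℝ 2 μ × Lp ℝ 2 J} (hz : ∀ n, z n ∈ h.graph)
    {u : Lp ℝ 2 μ} (hu : Tendsto (fun n => (z n).1) atTop (𝓝 u)) {B : ℝ}
    (hB : ∀ n, ‖(z n).2‖ ≤ B) :
    ∃ g, ‖g‖ ≤ B ∧ (u, g) ∈ h.graph ∧ (u, g) ∈ closure (convexHull ℝ (Set.range z)) := by
  obtain ⟨g, hg, hcl⟩ := exists_mem_closure_convexHull_of_bounded z u hu B hB
  refine ⟨g, hg, ?_, hcl⟩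
  refine closure_minimal (convexHull_min ?_ h.graph.convex) h.isClosed_graph hcl
  rintro _ ⟨n, rfl⟩
  exact hz n

/-- Lower semicontinuity of the energy. The increments of `F n` need not converge; convex
combinations of them do, and the closed graph is convex. -/
theorem inClosure_of_tendsto {F : ℕ → T → ℝ} {G : T → ℝ} (hF : ∀ n, h.InClosure (F n))
    (hG : Measurable G) (hGL : MemLp (fun x => G (X x)) 2 μ)
    (hlim : Tendsto (fun n => eLpNorm (fun x => F n (X x) - G (X x)) 2 μ) atTop (𝓝 0)) {B : ℝ}
    (hB0 : 0 ≤ B) (hB : ∀ n, eLpNorm (increment (F n)) 2 J ≤ ENNReal.ofReal B) :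
    h.InClosure G ∧ eLpNorm (increment G) 2 J ≤ ENNReal.ofReal B := by
  obtain ⟨g, hg, hmem, -⟩ := h.exists_mem_graph_of_bounded (fun n => (hF n).mem_graph)
    (u := hGL.toLp _) (B := B)
    (Lp.tendsto_Lp_iff_tendsto_eLpNorm'' _ (fun n => (hF n).memLp) _ hGL |>.2 hlim)
    (fun n => by
      rw [Lp.norm_toLp]
      exact ENNReal.toReal_le_of_le_ofReal hB0 (hB n))
  have hGc := h.inClosure_of_mem_graph hmem hG (hGL.coeFn_toLp.mono fun _ hx => hx.symm)
  refine ⟨hGc, ?_⟩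
  have := h.graph_snd_eq hmem hG (hGL.coeFn_toLp.mono fun _ hx => hx.symm)
  rw [← eLpNorm_congr_ae this]
  rw [Lp.norm_def] at hg
  exact (ENNReal.le_ofReal_iff_toReal_le (Lp.eLpNorm_ne_top g) hB0).2 hg

end IsJumpCore

/-! ### The closed Markovian form of a jump measure -/

theorem lipschitzWith_unitContraction :
    LipschitzWith 1 (fun t : ℝ => min (max t 0) 1) := by
  refine LipschitzWith.of_dist_le_mul fun s t => ?_
  simpa [Real.dist_eq] using
    (abs_min_sub_min_le_max (max s 0) 1 (max t 0) 1).trans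
      (by simpa using abs_max_sub_max_le_max s 0 t 0)

namespace IsJumpCore

section DirichletForm

variable {S T : Type*} [MeasurableSpace S] [MeasurableSpace T] {μ : Measure S} {X : S → T}
  {J : Measure (T × T)} {C : Submodule ℝ (T → ℝ)} (h : IsJumpCore μ X J C)
include h

/-- The closed operator that sends a function to its increments. -/
noncomputable def operator : Lp ℝ 2 μ →ₗ.[ℝ] Lp ℝ 2 J := h.graph.toLinearPMap

theorem mem_domain_of_mem_graph {u : Lp ℝ 2 μ} {g : Lp ℝ 2 J} (hug : (u, g) ∈ h.graph) :
    u ∈ h.operator.domain := ⟨(u, g), hug, rfl⟩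

theorem operator_mem_graph (u : h.operator.domain) :
    ((u : Lp ℝ 2 μ), h.operator u) ∈ h.graph :=
  Submodule.mem_graph_toLinearPMap (fun z hz h0 => h.snd_eq_zero_of_mem_graph z hz h0) u

theorem operator_eq (u : h.operator.domain) {g : Lp ℝ 2 J} (hug : ((u : Lp ℝ 2 μ), g) ∈ h.graph) :
    h.operator u = g :=
  h.graph_ext (h.operator_mem_graph u) hug rfl

/-- The contraction is 1-Lipschitz, so it acts continuously on `L²` and shrinks every increment.
Applied to core approximations of `z` it gives elements of the graph whose energies do not exceed
those of the approximations. -/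
theorem exists_unitContraction_mem_graph
    (hmarkov : ∀ F ∈ C, h.InClosure fun t => min (max (F t) 0) 1) {z : Lp ℝ 2 μ × Lp ℝ 2 J}
    (hz : z ∈ h.graph) :
    ∃ w ∈ h.graph, (∀ᵐ x ∂μ, w.1 x = min (max (z.1 x) 0) 1) ∧ ‖w.2‖ ≤ ‖z.2‖ := by
  obtain ⟨F, hF⟩ := h.exists_tendsto_coreMap hz
  have hF1 : Tendsto (fun n => (h.coreMap (F n)).1) atTop (𝓝 z.1) :=
    (continuous_fst.tendsto z).comp hF
  have hF2 : Tendsto (fun n => ‖(h.coreMap (F n)).2‖) atTop (𝓝 ‖z.2‖) :=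
    ((continuous_snd.tendsto z).comp hF).norm
  set c : ℝ → ℝ := fun t => min (max t 0) 1 with hc
  have hcl : LipschitzWith 1 c := lipschitzWith_unitContraction
  have hc0 : c 0 = 0 := by simp [hc]
  set G : ∀ n, h.InClosure fun t => c ((F n : T → ℝ) t) := fun n => hmarkov _ (F n).2
  set y : ℕ → Lp ℝ 2 μ × Lp ℝ 2 J :=
    fun n => ((G n).memLp.toLp _, (G n).memLp_increment.toLp _) with hy
  have hyg : ∀ n, y n ∈ h.graph := fun n => (G n).mem_graph
  have hy1 : ∀ n, (y n).1 = hcl.compLp hc0 (h.coreMap (F n)).1 := by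
    intro n
    refine Lp.ext ?_
    filter_upwards [(G n).memLp.coeFn_toLp, hcl.coeFn_compLp hc0 (h.coreMap (F n)).1,
      (h.memLp _ (F n).2).coeFn_toLp] with x h1 h2 h3
    rw [h1, h2]
    exact congrArg c h3.symm
  have hy2 : ∀ n, ‖(y n).2‖ ≤ ‖(h.coreMap (F n)).2‖ := by
    intro n
    refine Lp.norm_le_norm_of_ae_le ?_
    filter_upwards [(G n).memLp_increment.coeFn_toLp,
      (h.memLp_increment _ (F n).2).coeFn_toLp] with q h1 h2
    have e2 : (h.coreMap (F n)).2 q = increment (F n : T → ℝ) q := h2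
    rw [h1, e2]
    simpa [Real.dist_eq, increment] using hcl.dist_le_mul ((F n : T → ℝ) q.2) ((F n : T → ℝ) q.1)
  have hylim : Tendsto (fun n => (y n).1) atTop (𝓝 (hcl.compLp hc0 z.1)) := by
    simp only [hy1]
    exact ((hcl.continuous_compLp hc0).tendsto z.1).comp hF1
  -- Passing to a tail of the sequence gives the bound up to `ε`; as `g` is determined by the first
  -- component, `ε` can afterwards be sent to zero.
  have hbound : ∀ ε > 0, ∃ g, ‖g‖ ≤ ‖z.2‖ + ε ∧ (hcl.compLp hc0 z.1, g) ∈ h.graph := by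
    intro ε hε
    obtain ⟨N, hN⟩ := eventually_atTop.1 (hF2.eventually (gt_mem_nhds (lt_add_of_pos_right _ hε)))
    obtain ⟨g, hg, hgm, -⟩ := h.exists_mem_graph_of_bounded (z := fun n => y (n + N))
      (fun n => hyg _) (hylim.comp (tendsto_add_atTop_nat N)) (B := ‖z.2‖ + ε)
      (fun n => (hy2 _).trans (hN _ (Nat.le_add_left _ _)).le)
    exact ⟨g, hg, hgm⟩
  obtain ⟨g, -, hgm⟩ := hbound 1 one_pos
  refine ⟨(hcl.compLp hc0 z.1, g), hgm, hcl.coeFn_compLp hc0 z.1,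
    le_of_forall_pos_le_add fun ε hε => ?_⟩
  obtain ⟨g', hg', hgm'⟩ := hbound ε hε
  have : g = g' := h.graph_ext hgm hgm' rfl
  exact this ▸ hg'

/-- The closed form `E(u, v) = ∫ (u(x') - u(x)) (v(x') - v(x)) dJ(x, x')`. -/
noncomputable def dirichletForm (hdense : Dense (h.operator.domain : Set (Lp ℝ 2 μ)))
    (hmarkov : ∀ F ∈ C, h.InClosure fun t => min (max (F t) 0) 1) : DirichletForm μ where
  domain := h.operator.domain
  form := LinearMap.mk₂ ℝ (fun u v => inner ℝ (h.operator u) (h.operator v))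
    (fun u v w => by rw [LinearPMap.map_add, inner_add_left])
    (fun c u v => by rw [LinearPMap.map_smul, real_inner_smul_left, smul_eq_mul])
    (fun u v w => by rw [LinearPMap.map_add, inner_add_right])
    (fun c u v => by rw [LinearPMap.map_smul, real_inner_smul_right, smul_eq_mul])
  dense := hdense
  symm u v := by
    simp only [LinearMap.mk₂_apply]
    exact real_inner_comm _ _
  nonneg u := by
    rw [LinearMap.mk₂_apply]
    exact real_inner_self_nonneg
  closed u hu := by
    simp only [LinearMap.mk₂_apply, real_inner_self_eq_norm_sq, LinearPMap.map_sub] at hu ⊢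
    have hc1 : CauchySeq fun n => h.operator (u n) := by
      refine Metric.cauchySeq_iff.2 fun ε hε => ?_
      obtain ⟨N, hN⟩ := hu (ε ^ 2) (by positivity)
      refine ⟨N, fun n hn m hm => ?_⟩
      rw [dist_eq_norm]
      exact lt_of_pow_lt_pow_left₀ 2 hε.le
        (lt_of_le_of_lt (le_add_of_nonneg_right (sq_nonneg _)) (hN n hn m hm))
    have hc2 : CauchySeq fun n => (u n : Lp ℝ 2 μ) := by
      refine Metric.cauchySeq_iff.2 fun ε hε => ?_
      obtain ⟨N, hN⟩ := hu (ε ^ 2) (by positivity)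
      refine ⟨N, fun n hn m hm => ?_⟩
      rw [dist_eq_norm]
      exact lt_of_pow_lt_pow_left₀ 2 hε.le
        (lt_of_le_of_lt (le_add_of_nonneg_left (sq_nonneg _)) (hN n hn m hm))
    obtain ⟨g, hg⟩ := cauchySeq_tendsto_of_complete hc1
    obtain ⟨v, hv⟩ := cauchySeq_tendsto_of_complete hc2
    have hvg : (v, g) ∈ h.graph :=
      h.isClosed_graph.mem_of_tendsto (hv.prodMk_nhds hg)
        (Eventually.of_forall fun n => h.operator_mem_graph (u n))
    refine ⟨⟨v, h.mem_domain_of_mem_graph hvg⟩, ?_⟩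
    rw [h.operator_eq ⟨v, h.mem_domain_of_mem_graph hvg⟩ hvg]
    have e1 : Tendsto (fun n => ‖h.operator (u n) - g‖ ^ 2) atTop (𝓝 0) := by
      simpa using ((hg.sub_const g).norm.pow 2)
    have e2 : Tendsto (fun n => ‖(u n : Lp ℝ 2 μ) - v‖ ^ 2) atTop (𝓝 0) := by
      simpa using ((hv.sub_const v).norm.pow 2)
    simpa using e1.add e2
  markov u := by
    obtain ⟨w, hw, hw1, hw2⟩ := h.exists_unitContraction_mem_graph hmarkov (h.operator_mem_graph u)
    refine ⟨⟨w.1, h.mem_domain_of_mem_graph hw⟩, hw1, ?_⟩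
    simp only [LinearMap.mk₂_apply, real_inner_self_eq_norm_sq]
    rw [h.operator_eq ⟨w.1, h.mem_domain_of_mem_graph hw⟩ hw]
    gcongr

end DirichletForm

/-! ### Identification with the closure of the form on cylinder functions -/

section Closure

variable {S : Type*} [MeasurableSpace S] {μ : Measure S} {X : S → ℕ → ℝ}
  {J : Measure ((ℕ → ℝ) × (ℕ → ℝ))} (h : IsJumpCore μ X J cylinderCore)
include h

theorem integral_increment_mul (F G : cylinderCore) :
    ∫ q, increment (F : (ℕ → ℝ) → ℝ) q * increment (G : (ℕ → ℝ) → ℝ) q ∂J =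
      inner ℝ (h.coreMap F).2 (h.coreMap G).2 := by
  rw [L2.inner_def]
  refine integral_congr_ae ?_
  filter_upwards [(h.memLp_increment _ F.2).coeFn_toLp,
    (h.memLp_increment _ G.2).coeFn_toLp] with q h1 h2
  have e1 : (h.coreMap F).2 q = increment (F : (ℕ → ℝ) → ℝ) q := h1
  have e2 : (h.coreMap G).2 q = increment (G : (ℕ → ℝ) → ℝ) q := h2
  rw [e1, e2, mul_comm]
  rfl

/-- By `hpre`, the energy of `F n - F m` is the squared distance of the two increments in `L²(J)`,
so being Cauchy for the form means being Cauchy in a Hilbert space. -/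
theorem isApproxSeq_iff [IsFiniteMeasure μ] {α : ℝ}
    (hpre : ∀ F ∈ cylinderCore, ∀ G ∈ cylinderCore,
      preForm μ X α F G = ∫ q, increment F q * increment G q ∂J) (F : ℕ → (ℕ → ℝ) → ℝ)
    (u : Lp ℝ 2 μ) :
    IsApproxSeq μ X α F u ↔ ∃ F' : ℕ → cylinderCore, (∀ n, (F' n : (ℕ → ℝ) → ℝ) = F n) ∧
      Tendsto (fun n => (h.coreMap (F' n)).1) atTop (𝓝 u) ∧
      CauchySeq fun n => (h.coreMap (F' n)).2 := by
  have key : ∀ F' : ℕ → cylinderCore, (∀ n, (F' n : (ℕ → ℝ) → ℝ) = F n) →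
      ((Tendsto (fun n => (h.coreMap (F' n)).1) atTop (𝓝 u) ↔
        Tendsto (fun n => eLpNorm (fun x => F n (X x) - u x) 2 μ) atTop (𝓝 0)) ∧
      ∀ n m, preForm μ X α (F n - F m) (F n - F m) =
        ‖(h.coreMap (F' n)).2 - (h.coreMap (F' m)).2‖ ^ 2) := by
    intro F' hF'
    constructor
    · rw [Lp.tendsto_Lp_iff_tendsto_eLpNorm']
      refine tendsto_congr fun n => eLpNorm_congr_ae ?_
      filter_upwards [(h.memLp _ (F' n).2).coeFn_toLp] with x hx
      have e : (h.coreMap (F' n)).1 x = (F' n : (ℕ → ℝ) → ℝ) (X x) := hx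
      simp only [Pi.sub_apply, e, hF']
    · intro n m
      have e : F n - F m = ((F' n - F' m : cylinderCore) : (ℕ → ℝ) → ℝ) := by
        rw [Submodule.coe_sub, hF', hF']
      rw [e, hpre _ (F' n - F' m).2 _ (F' n - F' m).2, h.integral_increment_mul,
        real_inner_self_eq_norm_sq, map_sub, Prod.snd_sub]
  constructor
  · rintro ⟨hF, hlim, hE⟩
    refine ⟨fun n => ⟨F n, hF n⟩, fun n => rfl, ?_, ?_⟩
    · exact (key _ fun n => rfl).1.2 hlim
    · refine Metric.cauchySeq_iff.2 fun ε hε => ?_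
      obtain ⟨N, hN⟩ := hE (ε ^ 2) (by positivity)
      refine ⟨N, fun n hn m hm => ?_⟩
      rw [dist_eq_norm]
      refine lt_of_pow_lt_pow_left₀ 2 hε.le ?_
      rw [← (key (fun n => ⟨F n, hF n⟩) fun n => rfl).2 n m]
      exact hN n hn m hm
  · rintro ⟨F', hF', hlim, hE⟩
    refine ⟨fun n => hF' n ▸ (F' n).2, (key F' hF').1.1 hlim, fun ε hε => ?_⟩
    obtain ⟨N, hN⟩ := Metric.cauchySeq_iff.1 hE (Real.sqrt ε) (Real.sqrt_pos.2 hε)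
    refine ⟨N, fun n hn m hm => ?_⟩
    rw [(key F' hF').2 n m, ← Real.sq_sqrt hε.le]
    have := hN n hn m hm
    rw [dist_eq_norm] at this
    gcongr

theorem isClosureOf_dirichletForm [IsFiniteMeasure μ]
    (hdense : Dense (h.operator.domain : Set (Lp ℝ 2 μ)))
    (hmarkov : ∀ F ∈ cylinderCore, h.InClosure fun t => min (max (F t) 0) 1) {α : ℝ}
    (hpre : ∀ F ∈ cylinderCore, ∀ G ∈ cylinderCore,
      preForm μ X α F G = ∫ q, increment F q * increment G q ∂J) :
    (h.dirichletForm hdense hmarkov).IsClosureOf X α := by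
  have hlim : ∀ {F' : ℕ → cylinderCore} {u : Lp ℝ 2 μ},
      Tendsto (fun n => (h.coreMap (F' n)).1) atTop (𝓝 u) →
      CauchySeq (fun n => (h.coreMap (F' n)).2) →
      ∃ g, (u, g) ∈ h.graph ∧ Tendsto (fun n => (h.coreMap (F' n)).2) atTop (𝓝 g) := by
    intro F' u h1 h2
    obtain ⟨g, hg⟩ := cauchySeq_tendsto_of_complete h2
    exact ⟨g, h.isClosed_graph.mem_of_tendsto (h1.prodMk_nhds hg)
      (Eventually.of_forall fun n => h.coreMap_mem_graph (F' n)), hg⟩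
  refine ⟨fun u => ⟨fun hu => ?_, ?_⟩, fun u v F G hF hG => ?_⟩
  · obtain ⟨F', hF'⟩ := h.exists_tendsto_coreMap (h.operator_mem_graph ⟨u, hu⟩)
    refine ⟨fun n => F' n, (h.isApproxSeq_iff hpre _ _).2 ⟨F', fun n => rfl, ?_, ?_⟩⟩
    · exact (continuous_fst.tendsto _).comp hF'
    · exact ((continuous_snd.tendsto _).comp hF').cauchySeq
  · rintro ⟨F, hF⟩
    obtain ⟨F', -, h1, h2⟩ := (h.isApproxSeq_iff hpre _ _).1 hF
    obtain ⟨g, hg, -⟩ := hlim h1 h2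
    exact h.mem_domain_of_mem_graph hg
  · obtain ⟨F', hF', h1, h2⟩ := (h.isApproxSeq_iff hpre _ _).1 hF
    obtain ⟨G', hG', h3, h4⟩ := (h.isApproxSeq_iff hpre _ _).1 hG
    obtain ⟨f, hf, hfl⟩ := hlim h1 h2
    obtain ⟨g, hg, hgl⟩ := hlim h3 h4
    have e : ∀ n, preForm μ X α (F n) (G n) =
        inner ℝ (h.coreMap (F' n)).2 (h.coreMap (G' n)).2 := fun n => by
      rw [← hF', ← hG', hpre _ (F' n).2 _ (G' n).2, h.integral_increment_mul]
    simp only [e]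
    have e2 : (h.dirichletForm hdense hmarkov).form u v = inner ℝ f g := by
      rw [← h.operator_eq u hf, ← h.operator_eq v hg]
      rfl
    rw [e2]
    exact hfl.inner hgl

end Closure

end IsJumpCore

/-! ### The jump measure of the coordinate-wise resampling -/

section JumpMeasure

variable {S : Type*} [MeasurableSpace S] (μ : Measure S) [IsProbabilityMeasure μ] {X : S → ℕ → ℝ}
  (hX : Measurable X) (α : ℝ) (i : ℕ)

include hX in
theorem measurable_otherCoords :
    Measurable (fun z (j : {j : ℕ // j ≠ i}) => X z j) :=
  measurable_pi_lambda _ fun _ => (measurable_pi_apply _).comp hX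

/-- The conditional laws of the `i`-th coordinate, as a kernel. -/
noncomputable def coordKernel : Kernel S ℝ :=
  (condDistrib (fun z => X z i) (fun z (j : {j : ℕ // j ≠ i}) => X z j) μ).comap _
    (measurable_otherCoords hX i)

instance : IsMarkovKernel (coordKernel μ hX i) := by
  unfold coordKernel; infer_instance

/-- The sequence before and after its `i`-th coordinate is replaced. -/
def resample (X : S → ℕ → ℝ) (i : ℕ) (p : S × ℝ) : (ℕ → ℝ) × (ℕ → ℝ) :=
  (X p.1, Function.update (X p.1) i p.2)

include hX in
theorem measurable_resample : Measurable (resample X i) :=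
  (hX.comp measurable_fst).prodMk
    (measurable_update'.comp ((hX.comp measurable_fst).prodMk measurable_snd))

/-- The law of a sequence before and after its `i`-th coordinate is resampled. -/
noncomputable def pairLaw : Measure ((ℕ → ℝ) × (ℕ → ℝ)) :=
  (μ ⊗ₘ coordKernel μ hX i).map (resample X i)

/-- The jump kernel. -/
noncomputable def jumpWeight (q : (ℕ → ℝ) × (ℕ → ℝ)) : ℝ≥0∞ :=
  ENNReal.ofReal (if q.2 i = q.1 i then 0 else 1 / |q.2 i - q.1 i| ^ (α + 1))

theorem measurable_jumpWeight : Measurable (jumpWeight α i) := by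
  refine ENNReal.measurable_ofReal.comp (Measurable.ite ?_ measurable_const ?_)
  · exact measurableSet_eq_fun (by fun_prop) (by fun_prop)
  · fun_prop

/-- The jump measure of the form `E_(α)`. -/
noncomputable def jumpMeasure : Measure ((ℕ → ℝ) × (ℕ → ℝ)) :=
  Measure.sum fun i => (pairLaw μ hX i).withDensity (jumpWeight α i)

theorem map_fst_pairLaw : (pairLaw μ hX i).map Prod.fst = μ.map X := by
  rw [pairLaw, Measure.map_map measurable_fst (measurable_resample hX i)]
  have : Prod.fst ∘ resample X i = X ∘ Prod.fst := rfl
  rw [this, ← Measure.map_map hX measurable_fst]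
  congr 1
  exact Measure.fst_compProd μ _

/-- Drawing a coordinate from its conditional law given the others restores the joint law: this is
the disintegration of the law of `(Y, X_i)`, transported by the map `G` that glues the `i`-th
coordinate to the others. -/
theorem map_snd_pairLaw : (pairLaw μ hX i).map Prod.snd = μ.map X := by
  set Y := fun z (j : {j : ℕ // j ≠ i}) => X z j with hY
  have hYm : Measurable Y := measurable_otherCoords hX i
  have hXi : Measurable fun z => X z i := (measurable_pi_apply i).comp hX
  set G : ({j : ℕ // j ≠ i} → ℝ) × ℝ → ℕ → ℝ :=
    fun b j => if hj : j ≠ i then b.1 ⟨j, hj⟩ else b.2 with hG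
  have hGm : Measurable G := by
    refine measurable_pi_lambda _ fun j => ?_
    by_cases hj : j ≠ i
    · simp only [hG, hj, dite_true, ne_eq, not_false_eq_true]
      exact (measurable_pi_apply _).comp measurable_fst
    · simp only [hG, hj, dite_false]
      exact measurable_snd
  have h1 : Prod.snd ∘ resample X i = G ∘ Prod.map Y id := by
    funext p
    funext j
    by_cases hj : j = i
    · subst hj; simp [resample, hG]
    · simp [resample, hG, hj, hY]
  have h2 : X = G ∘ fun z => (Y z, X z i) := by
    funext z
    funext j
    by_cases hj : j = i
    · subst hj; simp [hG]
    · simp [hG, hj, hY]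
  have h3 : (μ ⊗ₘ coordKernel μ hX i).map (Prod.map Y id) = μ.map fun z => (Y z, X z i) := by
    rw [← compProd_map_condDistrib hXi.aemeasurable]
    refine Measure.ext_of_lintegral _ fun f hf => ?_
    rw [lintegral_map hf (hYm.prodMap measurable_id),
      Measure.lintegral_compProd
        (f := fun p => f (Prod.map Y id p)) (hf.comp (hYm.prodMap measurable_id)),
      Measure.lintegral_compProd hf, lintegral_map hf.lintegral_kernel_prod_right' hYm]
    rfl
  rw [pairLaw, Measure.map_map measurable_snd (measurable_resample hX i), h1,
    ← Measure.map_map hGm (hYm.prodMap measurable_id), h3,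
    Measure.map_map hGm (hYm.prodMk hXi), ← h2]

theorem quasiMeasurePreserving_jumpMeasure {f : (ℕ → ℝ) × (ℕ → ℝ) → ℕ → ℝ} (hf : Measurable f)
    (hmap : ∀ i, (pairLaw μ hX i).map f = μ.map X) :
    Measure.QuasiMeasurePreserving f (jumpMeasure μ hX α) (μ.map X) := by
  refine ⟨hf, Measure.AbsolutelyContinuous.mk fun s hs h0 => ?_⟩
  rw [Measure.map_apply hf hs, jumpMeasure, Measure.sum_apply _ (hf hs)]
  simp only [ENNReal.tsum_eq_zero]
  intro i
  refine withDensity_absolutelyContinuous _ _ ?_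
  rw [← Measure.map_apply hf hs, hmap i, h0]

/-- Integration against the jump measure. -/
theorem lintegral_jumpMeasure {f : (ℕ → ℝ) × (ℕ → ℝ) → ℝ≥0∞} (hf : Measurable f) :
    ∫⁻ q, f q ∂(jumpMeasure μ hX α) =
      ∑' i, ∫⁻ q, jumpWeight α i q * f q ∂(pairLaw μ hX i) := by
  rw [jumpMeasure, lintegral_sum_measure]
  exact tsum_congr fun i =>
    lintegral_withDensity_eq_lintegral_mul _ (measurable_jumpWeight α i) hf

/-- Under the law of `i`-th resampling, the second sequence is an update of the first. -/
theorem ae_pairLaw {P : (ℕ → ℝ) × (ℕ → ℝ) → Prop} (hP : MeasurableSet {q | P q})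
    (h : ∀ x y, P (x, Function.update x i y)) : ∀ᵐ q ∂(pairLaw μ hX i), P q := by
  rw [pairLaw, ae_map_iff (measurable_resample hX i).aemeasurable hP]
  exact Eventually.of_forall fun p => h _ _

/-- Fubini for the resampling kernel. The weight is zero on the diagonal, which plays the role of
the indicator in `coordForm`. -/
theorem coordForm_eq_integral {F G : (ℕ → ℝ) → ℝ} (hF : Measurable F) (hG : Measurable G)
    (hint : Integrable (fun q => increment F q * increment G q) (jumpMeasure μ hX α)) :
    coordForm μ X α i F G =
      ∫ q, increment F q * increment G q ∂((pairLaw μ hX i).withDensity (jumpWeight α i)) := by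
  have hlt : ∀ᵐ q ∂(pairLaw μ hX i), jumpWeight α i q < ⊤ :=
    Eventually.of_forall fun q => ENNReal.ofReal_lt_top
  have hi1 : Integrable (fun q => increment F q * increment G q)
      ((pairLaw μ hX i).withDensity (jumpWeight α i)) :=
    hint.mono_measure (Measure.le_sum _ i)
  have hi2 := (integrable_withDensity_iff_integrable_smul' (measurable_jumpWeight α i) hlt).1 hi1
  rw [integral_withDensity_eq_integral_toReal_smul (measurable_jumpWeight α i) hlt]
  rw [pairLaw] at hi2 ⊢
  have hmeas : Measurable fun q => (jumpWeight α i q).toReal • (increment F q * increment G q) :=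
    (measurable_jumpWeight α i).ennreal_toReal.smul (hF.increment.mul hG.increment)
  rw [integral_map (measurable_resample hX i).aemeasurable hmeas.aestronglyMeasurable]
  rw [integrable_map_measure hmeas.aestronglyMeasurable (measurable_resample hX i).aemeasurable]
    at hi2
  simp only [Function.comp_def] at hi2
  rw [Measure.integral_compProd hi2]
  unfold coordForm
  refine integral_congr_ae (Eventually.of_forall fun x => ?_)
  refine integral_congr_ae (Eventually.of_forall fun y => ?_)
  simp only [Set.indicator, Set.mem_ofPred_eq, jumpDensity, Function.update_eq_self, resample,
    jumpWeight, increment, Function.update_self, smul_eq_mul]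
  rw [ENNReal.toReal_ofReal (by split_ifs <;> positivity)]
  by_cases hy : y = X x i
  · simp [hy]
  · simp [hy, mul_assoc]

/-- The product of two square integrable increments is integrable, so its integral over the sum
measure is the sum of the integrals. -/
theorem preForm_eq_integral {F G : (ℕ → ℝ) → ℝ} (hF : Measurable F) (hG : Measurable G)
    (hF2 : MemLp (increment F) 2 (jumpMeasure μ hX α))
    (hG2 : MemLp (increment G) 2 (jumpMeasure μ hX α)) :
    preForm μ X α F G = ∫ q, increment F q * increment G q ∂(jumpMeasure μ hX α) := by
  have hint : Integrable (fun q => increment F q * increment G q) (jumpMeasure μ hX α) :=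
    hF2.integrable_mul hG2
  unfold preForm
  rw [jumpMeasure, integral_sum_measure hint]
  exact tsum_congr fun i => coordForm_eq_integral μ hX α i hF hG hint

end JumpMeasure

/-! ### Elementary `L²` estimates -/

section LpTools

variable {Ω : Type*} [MeasurableSpace Ω] {μ : Measure Ω}

theorem eLpNorm_two_sq (f : Ω → ℝ) : eLpNorm f 2 μ ^ 2 = ∫⁻ x, ‖f x‖ₑ ^ 2 ∂μ := by
  have h := eLpNorm_nnreal_pow_eq_lintegral (μ := μ) (f := f) (p := 2) two_ne_zero
  simpa using h

theorem eLpNorm_two_le_of_lintegral_le {f : Ω → ℝ} {B : ℝ} (hB : 0 ≤ B)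
    (h : ∫⁻ x, ‖f x‖ₑ ^ 2 ∂μ ≤ ENNReal.ofReal B) :
    eLpNorm f 2 μ ≤ ENNReal.ofReal (Real.sqrt B) := by
  rw [← eLpNorm_two_sq] at h
  refine (ENNReal.pow_le_pow_left_iff two_ne_zero).1 (h.trans ?_)
  rw [← ENNReal.ofReal_pow (Real.sqrt_nonneg _), Real.sq_sqrt hB]

/-- Bounded convergence in `L²`. -/
theorem tendsto_eLpNorm_two_of_bounded [IsFiniteMeasure μ] {f : ℕ → Ω → ℝ}
    (hf : ∀ n, AEStronglyMeasurable (f n) μ) {C : ℝ} (hC : ∀ n, ∀ᵐ x ∂μ, |f n x| ≤ C)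
    (hlim : ∀ᵐ x ∂μ, Tendsto (fun n => f n x) atTop (𝓝 0)) :
    Tendsto (fun n => eLpNorm (f n) 2 μ) atTop (𝓝 0) := by
  have h1 : Tendsto (fun n => ∫⁻ x, ‖f n x‖ₑ ^ 2 ∂μ) atTop (𝓝 (∫⁻ _, 0 ∂μ)) := by
    refine tendsto_lintegral_of_dominated_convergence' (fun _ => ENNReal.ofReal C ^ 2)
      (fun n => (hf n).enorm.pow_const 2) (fun n => ?_) ?_ ?_
    · filter_upwards [hC n] with x hx
      gcongr
      rw [Real.enorm_eq_ofReal_abs]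
      exact ENNReal.ofReal_le_ofReal hx
    · rw [lintegral_const]
      exact ENNReal.mul_ne_top (by finiteness) (by finiteness)
    · filter_upwards [hlim] with x hx
      have := ((continuous_enorm.tendsto (0 : ℝ)).comp hx)
      have h2 := ((ENNReal.continuous_pow 2).tendsto ‖(0 : ℝ)‖ₑ).comp this
      simpa [Function.comp_def] using h2
  rw [lintegral_zero] at h1
  rw [ENNReal.tendsto_nhds_zero] at h1 ⊢
  intro ε hε
  filter_upwards [h1 (ε ^ 2) (by positivity)] with n hn
  rw [← eLpNorm_two_sq] at hn
  exact (ENNReal.pow_le_pow_left_iff two_ne_zero).1 hn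

end LpTools

/-! ### Bounded coordinate-wise Lipschitz functions of finitely many coordinates -/

/-- `F` depends on the first `n` coordinates only, is bounded by `B`, and Lipschitz with constant
`L` in each coordinate. -/
structure IsLipCylinder (n : ℕ) (L B : ℝ) (F : (ℕ → ℝ) → ℝ) : Prop where
  depends : ∀ x x' : ℕ → ℝ, (∀ j < n, x j = x' j) → F x = F x'
  bounded : ∀ x, |F x| ≤ B
  lip : ∀ x i y, |F (Function.update x i y) - F x| ≤ L * |y - x i|

namespace IsLipCylinder

variable {n m : ℕ} {L B L' B' : ℝ} {F G : (ℕ → ℝ) → ℝ}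

theorem bound_nonneg (h : IsLipCylinder n L B F) : 0 ≤ B :=
  (abs_nonneg _).trans (h.bounded 0)

theorem lip_nonneg (h : IsLipCylinder n L B F) : 0 ≤ L := by
  have := (abs_nonneg _).trans (h.lip 0 0 1)
  simpa using this

theorem mono (h : IsLipCylinder n L B F) (hn : n ≤ m) (hL : L ≤ L') (hB : B ≤ B') :
    IsLipCylinder m L' B' F :=
  ⟨fun x x' hx => h.depends x x' fun j hj => hx j (hj.trans_le hn),
    fun x => (h.bounded x).trans hB,
    fun x i y => (h.lip x i y).trans (mul_le_mul_of_nonneg_right hL (abs_nonneg _))⟩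

theorem update_eq (h : IsLipCylinder n L B F) {i : ℕ} (hi : n ≤ i) (x : ℕ → ℝ) (y : ℝ) :
    F (Function.update x i y) = F x :=
  h.depends _ _ fun j hj => Function.update_of_ne (by omega) _ _

/-- Change the first `n` coordinates one at a time and telescope. -/
theorem abs_sub_le (h : IsLipCylinder n L B F) (x x' : ℕ → ℝ) :
    |F x' - F x| ≤ L * ∑ j ∈ Finset.range n, |x' j - x j| := by
  have key : ∀ m : ℕ, |F (fun j => if j < m then x' j else x j) - F x| ≤
      L * ∑ j ∈ Finset.range m, |x' j - x j| := by
    intro m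
    induction m with
    | zero => simp
    | succ m ih =>
      have e : (fun j => if j < m + 1 then x' j else x j) =
          Function.update (fun j => if j < m then x' j else x j) m (x' m) := by
        funext j
        rcases lt_trichotomy j m with hj | hj | hj
        · rw [Function.update_of_ne hj.ne]; simp [hj, hj.trans (Nat.lt_succ_self m)]
        · subst hj; simp
        · rw [Function.update_of_ne hj.ne']
          simp [hj.not_gt, show ¬ j < m + 1 by omega]
      have h1 := h.lip (fun j => if j < m then x' j else x j) m (x' m)
      rw [← e] at h1
      simp only [lt_irrefl, if_false] at h1
      rw [Finset.sum_range_succ, mul_add]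
      calc _ = |(F (fun j => if j < m + 1 then x' j else x j) -
              F (fun j => if j < m then x' j else x j)) +
              (F (fun j => if j < m then x' j else x j) - F x)| := by ring_nf
        _ ≤ _ := abs_add_le _ _
        _ ≤ _ := by linarith
  have e : F x' = F (fun j => if j < n then x' j else x j) :=
    h.depends _ _ fun j hj => by simp [hj]
  rw [e]
  exact key n

theorem continuous (h : IsLipCylinder n L B F) : Continuous F := by
  refine continuous_iff_continuousAt.2 fun x => ?_
  rw [ContinuousAt, tendsto_iff_dist_tendsto_zero]
  have h1 : Tendsto (fun x' : ℕ → ℝ => L * ∑ j ∈ Finset.range n, |x' j - x j|) (𝓝 x) (𝓝 0) := by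
    have hc : Continuous fun x' : ℕ → ℝ => L * ∑ j ∈ Finset.range n, |x' j - x j| := by fun_prop
    simpa using hc.tendsto x
  exact squeeze_zero (fun _ => dist_nonneg) (fun x' => h.abs_sub_le x x') h1

theorem measurable (h : IsLipCylinder n L B F) : Measurable F := h.continuous.measurable

theorem add (h : IsLipCylinder n L B F) (h' : IsLipCylinder m L' B' G) :
    IsLipCylinder (max n m) (L + L') (B + B') (F + G) := by
  refine ⟨fun x x' hx => ?_, fun x => ?_, fun x i y => ?_⟩
  · exact congrArg₂ (· + ·) (h.depends x x' fun j hj => hx j (lt_max_of_lt_left hj))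
      (h'.depends x x' fun j hj => hx j (lt_max_of_lt_right hj))
  · exact (abs_add_le _ _).trans (add_le_add (h.bounded x) (h'.bounded x))
  · have e : (F + G) (Function.update x i y) - (F + G) x =
        (F (Function.update x i y) - F x) + (G (Function.update x i y) - G x) := by
      simp only [Pi.add_apply]; ring
    rw [e, add_mul]
    exact (abs_add_le _ _).trans (add_le_add (h.lip x i y) (h'.lip x i y))

theorem smul (c : ℝ) (h : IsLipCylinder n L B F) :
    IsLipCylinder n (|c| * L) (|c| * B) (c • F) := by
  refine ⟨fun x x' hx => ?_, fun x => ?_, fun x i y => ?_⟩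
  · simp only [Pi.smul_apply, h.depends x x' hx]
  · rw [Pi.smul_apply, smul_eq_mul, abs_mul]
    exact mul_le_mul_of_nonneg_left (h.bounded x) (abs_nonneg c)
  · simp only [Pi.smul_apply, smul_eq_mul]
    rw [← mul_sub, abs_mul, mul_assoc]
    exact mul_le_mul_of_nonneg_left (h.lip x i y) (abs_nonneg c)

theorem mul (h : IsLipCylinder n L B F) (h' : IsLipCylinder m L' B' G) :
    IsLipCylinder (max n m) (L * B' + B * L') (B * B') (fun x => F x * G x) := by
  refine ⟨fun x x' hx => ?_, fun x => ?_, fun x i y => ?_⟩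
  · exact congrArg₂ (· * ·) (h.depends x x' fun j hj => hx j (lt_max_of_lt_left hj))
      (h'.depends x x' fun j hj => hx j (lt_max_of_lt_right hj))
  · rw [abs_mul]
    exact mul_le_mul (h.bounded x) (h'.bounded x) (abs_nonneg _) h.bound_nonneg
  · have e : F (Function.update x i y) * G (Function.update x i y) - F x * G x =
        (F (Function.update x i y) - F x) * G (Function.update x i y) +
          F x * (G (Function.update x i y) - G x) := by ring
    rw [e]
    refine (abs_add_le _ _).trans ?_
    rw [abs_mul, abs_mul]
    have h1 := mul_le_mul (h.lip x i y) (h'.bounded (Function.update x i y)) (abs_nonneg _)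
      (mul_nonneg h.lip_nonneg (abs_nonneg _))
    have h2 := mul_le_mul (h.bounded x) (h'.lip x i y) (abs_nonneg _) h.bound_nonneg
    linarith

theorem unitContraction (h : IsLipCylinder n L B F) :
    IsLipCylinder n L 1 (fun x => min (max (F x) 0) 1) := by
  refine ⟨fun x x' hx => by rw [h.depends x x' hx], fun x => ?_, fun x i y => ?_⟩
  · rw [abs_of_nonneg (le_min (le_max_right _ _) zero_le_one)]
    exact min_le_right _ _
  · refine le_trans ?_ (h.lip x i y)
    simpa [Real.dist_eq] using
      lipschitzWith_unitContraction.dist_le_mul (F (Function.update x i y)) (F x)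

/-- A smooth function of compact support is bounded and Lipschitz for the sup norm, and updating one
coordinate moves the argument by `|y - x i|` at most. Both properties survive linear combinations.
-/
theorem exists_of_mem_cylinderCore (hF : F ∈ cylinderCore) :
    ∃ n L B, 0 < n ∧ IsLipCylinder n L B F := by
  refine Submodule.span_induction ?_ ?_ ?_ ?_ hF
  · rintro _ ⟨n, hn, f, hf, hfc, rfl⟩
    obtain ⟨K, hK⟩ := hf.lipschitzWith_of_hasCompactSupport hfc (by simp)
    obtain ⟨B, hB⟩ := hf.continuous.bounded_above_of_compact_support hfc
    refine ⟨n, K, B, hn, fun x x' hx => ?_, fun x => hB _, fun x i y => ?_⟩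
    · exact congrArg f (funext fun j => hx j j.2)
    · have h1 := hK.dist_le_mul (fun j : Fin n => Function.update x i y j) (fun j => x j)
      rw [Real.dist_eq] at h1
      refine h1.trans (mul_le_mul_of_nonneg_left ?_ K.2)
      refine (dist_pi_le_iff (abs_nonneg _)).2 fun j => ?_
      by_cases hj : (j : ℕ) = i
      · rw [hj, Function.update_self, Real.dist_eq]
      · rw [Function.update_of_ne hj, dist_self]
        exact abs_nonneg _
  · exact ⟨1, 0, 0, one_pos, fun _ _ _ => rfl, fun _ => by simp, fun _ _ _ => by simp⟩
  · rintro F G - - ⟨n, L, B, hn, h⟩ ⟨m, L', B', -, h'⟩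
    exact ⟨_, _, _, lt_max_of_lt_left hn, h.add h'⟩
  · rintro c F - ⟨n, L, B, hn, h⟩
    exact ⟨_, _, _, hn, h.smul c⟩

end IsLipCylinder

/-! ### Energy estimates for a general bound and for Lipschitz cylinder functions -/

section Energy

variable {S : Type*} [MeasurableSpace S] (μ : Measure S) [IsProbabilityMeasure μ] {X : S → ℕ → ℝ}
  (hX : Measurable X) {α : ℝ} {n : ℕ} {L B : ℝ} {F : (ℕ → ℝ) → ℝ}

/-- Both marginals of `pairLaw` are the law of `X`, so the two ends of a jump contribute the same
integral of `R i`. Charging a jump to either end makes symmetry of the jump measure unnecessary. -/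
theorem lintegral_sq_increment_le (hF : Measurable F) {R : ℕ → (ℕ → ℝ) → ℝ≥0∞}
    (hR : ∀ i, Measurable (R i))
    (h : ∀ i x y, jumpWeight α i (x, Function.update x i y) *
      ‖increment F (x, Function.update x i y)‖ₑ ^ 2 ≤ R i x + R i (Function.update x i y)) :
    ∫⁻ q, ‖increment F q‖ₑ ^ 2 ∂(jumpMeasure μ hX α) ≤ 2 * ∑' i, ∫⁻ x, R i (X x) ∂μ := by
  rw [lintegral_jumpMeasure μ hX α (hF.increment.enorm.pow_const 2), ← ENNReal.tsum_mul_left]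
  refine ENNReal.tsum_le_tsum fun i => ?_
  calc ∫⁻ q, jumpWeight α i q * ‖increment F q‖ₑ ^ 2 ∂(pairLaw μ hX i)
      ≤ ∫⁻ q, (R i q.1 + R i q.2) ∂(pairLaw μ hX i) := by
        refine lintegral_mono_ae (ae_pairLaw μ hX i ?_ (h i))
        exact measurableSet_le
          ((measurable_jumpWeight α i).mul (hF.increment.enorm.pow_const 2))
          (((hR i).comp measurable_fst).add ((hR i).comp measurable_snd))
    _ = ∫⁻ x, R i x ∂((pairLaw μ hX i).map Prod.fst) +
          ∫⁻ x, R i x ∂((pairLaw μ hX i).map Prod.snd) := by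
        rw [lintegral_map (hR i) measurable_fst, lintegral_map (hR i) measurable_snd]
        exact lintegral_add_left ((hR i).comp measurable_fst) _
    _ = 2 * ∫⁻ x, R i (X x) ∂μ := by
        rw [map_fst_pairLaw, map_snd_pairLaw, lintegral_map (hR i) hX, two_mul]

theorem jumpWeight_mul_le {i : ℕ} {q : (ℕ → ℝ) × (ℕ → ℝ)} {c : ℝ}
    (h : increment F q ^ 2 ≤ c * |q.2 i - q.1 i| ^ (α + 1)) :
    jumpWeight α i q * ‖increment F q‖ₑ ^ 2 ≤ ENNReal.ofReal c := by
  unfold jumpWeight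
  split_ifs with hq
  · simp
  · have hd : 0 < |q.2 i - q.1 i| ^ (α + 1) :=
      Real.rpow_pos_of_pos (abs_pos.2 (sub_ne_zero.2 hq)) _
    rw [Real.enorm_eq_ofReal_abs, ← ENNReal.ofReal_pow (abs_nonneg _), sq_abs,
      ← ENNReal.ofReal_mul (by positivity)]
    refine ENNReal.ofReal_le_ofReal ?_
    rw [one_div, inv_mul_le_iff₀ hd, mul_comm]
    exact h

/-- Here `α ≤ 1` enters: for short jumps `d ^ 2 ≤ d ^ (α + 1)`, so the Lipschitz bound absorbs the
singularity of the kernel; for long jumps `1 ≤ d ^ (α + 1)` and boundedness is enough. -/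
theorem sq_le_mul_rpow_of_le (hα₀ : 0 < α) (hα₁ : α ≤ 1) {D d : ℝ} (hd : 0 ≤ d)
    (h1 : |D| ≤ L * d) (h2 : |D| ≤ B) : D ^ 2 ≤ (L ^ 2 + B ^ 2) * d ^ (α + 1) := by
  rw [← sq_abs D]
  rcases le_total d 1 with h | h
  · have h3 : d ^ 2 ≤ d ^ (α + 1) := by
      rcases hd.eq_or_lt with rfl | hd'
      · rw [Real.zero_rpow (by linarith)]; norm_num
      · rw [← Real.rpow_natCast]
        exact Real.rpow_le_rpow_of_exponent_ge hd' h (by push_cast; linarith)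
    calc |D| ^ 2 ≤ (L * d) ^ 2 := by gcongr
      _ = L ^ 2 * d ^ 2 := by ring
      _ ≤ L ^ 2 * d ^ (α + 1) := by gcongr
      _ ≤ _ := by
        have := Real.rpow_nonneg hd (α + 1)
        nlinarith [sq_nonneg B]
  · have h3 : 1 ≤ d ^ (α + 1) := Real.one_le_rpow h (by linarith)
    calc |D| ^ 2 ≤ B ^ 2 := by gcongr
      _ ≤ _ := by nlinarith [sq_nonneg L, sq_nonneg B]

theorem IsLipCylinder.lintegral_sq_increment_le (hα₀ : 0 < α) (hα₁ : α ≤ 1)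
    (h : IsLipCylinder n L B F) :
    ∫⁻ q, ‖increment F q‖ₑ ^ 2 ∂(jumpMeasure μ hX α) ≤
      ENNReal.ofReal (2 * (n * (L ^ 2 + (2 * B) ^ 2))) := by
  set c := L ^ 2 + (2 * B) ^ 2 with hc
  refine (_root_.lintegral_sq_increment_le μ hX h.measurable
    (R := fun i _ => if i < n then ENNReal.ofReal c else 0) (fun i => measurable_const)
    (fun i x y => ?_)).trans ?_
  · by_cases hi : i < n
    · simp only [hi, if_true]
      refine le_trans (jumpWeight_mul_le ?_) le_self_add
      simp only [increment, Function.update_self]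
      refine sq_le_mul_rpow_of_le hα₀ hα₁ (abs_nonneg _) (h.lip x i y) ?_
      refine (abs_sub _ _).trans ?_
      linarith [h.bounded x, h.bounded (Function.update x i y)]
    · simp [increment, h.update_eq (not_lt.1 hi)]
  · rw [ENNReal.ofReal_mul zero_le_two, ENNReal.ofReal_ofNat]
    gcongr
    simp only [lintegral_const, measure_univ, mul_one]
    rw [tsum_eq_sum (s := Finset.range n) fun i hi => if_neg (by simpa using hi)]
    rw [Finset.sum_congr rfl fun i hi => if_pos (Finset.mem_range.1 hi), Finset.sum_const,
      Finset.card_range, ENNReal.ofReal_mul (by positivity), ENNReal.ofReal_natCast, nsmul_eq_mul]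

theorem IsLipCylinder.memLp_increment (hα₀ : 0 < α) (hα₁ : α ≤ 1) (h : IsLipCylinder n L B F) :
    MemLp (increment F) 2 (jumpMeasure μ hX α) :=
  ⟨h.measurable.increment.aestronglyMeasurable,
    (eLpNorm_two_le_of_lintegral_le (by positivity)
      (h.lintegral_sq_increment_le μ hX hα₀ hα₁)).trans_lt ENNReal.ofReal_lt_top⟩

include hX in
theorem IsLipCylinder.memLp (h : IsLipCylinder n L B F) : MemLp (fun x => F (X x)) 2 μ :=
  MemLp.of_bound (h.measurable.comp hX).aestronglyMeasurable B
    (Eventually.of_forall fun x => h.bounded (X x))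

theorem isJumpCore_cylinderCore (hα₀ : 0 < α) (hα₁ : α ≤ 1) :
    IsJumpCore μ X (jumpMeasure μ hX α) cylinderCore where
  measurable_incl := hX
  quasi_fst := quasiMeasurePreserving_jumpMeasure μ hX α measurable_fst (map_fst_pairLaw μ hX)
  quasi_snd := quasiMeasurePreserving_jumpMeasure μ hX α measurable_snd (map_snd_pairLaw μ hX)
  measurable F hF := by
    obtain ⟨n, L, B, -, h⟩ := IsLipCylinder.exists_of_mem_cylinderCore hF
    exact h.measurable
  memLp F hF := by
    obtain ⟨n, L, B, -, h⟩ := IsLipCylinder.exists_of_mem_cylinderCore hF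
    exact h.memLp μ hX
  memLp_increment F hF := by
    obtain ⟨n, L, B, -, h⟩ := IsLipCylinder.exists_of_mem_cylinderCore hF
    exact h.memLp_increment μ hX hα₀ hα₁

end Energy

/-! ### Smooth approximation of bounded coordinate-wise Lipschitz functions -/

section Mollify

open ContinuousLinearMap in
-- Convolution with a probability density averages differences of translates, so it preserves any
-- uniform bound on them, in particular coordinate-wise Lipschitz constants.
theorem ContDiffBump.abs_convolution_sub_le {n : ℕ} (φ : ContDiffBump (0 : Fin n → ℝ))
    {g : (Fin n → ℝ) → ℝ} (hg : Continuous g) {v v' : Fin n → ℝ} {M : ℝ}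
    (hM : ∀ t, |g (v' - t) - g (v - t)| ≤ M) :
    |(convolution (φ.normed volume) g (lsmul ℝ ℝ) volume) v' -
      (convolution (φ.normed volume) g (lsmul ℝ ℝ) volume) v| ≤ M := by
  have hex : ∀ w : Fin n → ℝ,
      Integrable (fun t => (lsmul ℝ ℝ) (φ.normed volume t) (g (w - t))) volume := fun w =>
    φ.hasCompactSupport_normed.convolutionExists_left (lsmul ℝ ℝ) φ.continuous_normed
      hg.locallyIntegrable w
  unfold convolution
  rw [← integral_sub (hex v') (hex v)]
  rw [← Real.norm_eq_abs]
  refine le_trans (norm_integral_le_of_norm_le (g := fun t => φ.normed volume t * M)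
    (φ.integrable_normed.mul_const M) (Eventually.of_forall fun t => ?_)) ?_
  · rw [lsmul_apply, lsmul_apply, smul_eq_mul, smul_eq_mul]
    rw [← mul_sub, norm_mul, Real.norm_of_nonneg (φ.nonneg_normed t)]
    exact mul_le_mul_of_nonneg_left (hM t) (φ.nonneg_normed t)
  · rw [integral_mul_const, φ.integral_normed, one_mul]

open ContinuousLinearMap in
theorem ContDiffBump.abs_convolution_le {n : ℕ} (φ : ContDiffBump (0 : Fin n → ℝ))
    {g : (Fin n → ℝ) → ℝ} {v : Fin n → ℝ} {M : ℝ} (hM : ∀ t, |g t| ≤ M) :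
    |(convolution (φ.normed volume) g (lsmul ℝ ℝ) volume) v| ≤ M := by
  unfold convolution
  rw [← Real.norm_eq_abs]
  refine le_trans (norm_integral_le_of_norm_le (g := fun t => φ.normed volume t * M)
    (φ.integrable_normed.mul_const M) (Eventually.of_forall fun t => ?_)) ?_
  · simp only [lsmul_apply, smul_eq_mul]
    rw [norm_mul, Real.norm_of_nonneg (φ.nonneg_normed t)]
    exact mul_le_mul_of_nonneg_left (hM _) (φ.nonneg_normed t)
  · rw [integral_mul_const, φ.integral_normed, one_mul]

theorem norm_update_sub_le {n : ℕ} (v : Fin n → ℝ) (i : Fin n) (y : ℝ) :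
    ‖Function.update v i y - v‖ ≤ |y - v i| := by
  refine (pi_norm_le_iff_of_nonneg (abs_nonneg _)).2 fun j => ?_
  by_cases hj : j = i
  · subst hj; simp
  · simp [Function.update_of_ne hj]

/-- A Lipschitz cutoff function. -/
noncomputable def ballCutoff (n k : ℕ) (v : Fin n → ℝ) : ℝ := max 0 (min 1 (k + 2 - ‖v‖))

theorem ballCutoff_nonneg (n k : ℕ) (v : Fin n → ℝ) : 0 ≤ ballCutoff n k v := le_max_left _ _

theorem ballCutoff_le_one (n k : ℕ) (v : Fin n → ℝ) : ballCutoff n k v ≤ 1 :=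
  max_le zero_le_one (min_le_left _ _)

theorem continuous_ballCutoff (n k : ℕ) : Continuous (ballCutoff n k) := by
  unfold ballCutoff; fun_prop

theorem abs_ballCutoff_sub_le (n k : ℕ) (v w : Fin n → ℝ) :
    |ballCutoff n k w - ballCutoff n k v| ≤ ‖w - v‖ := by
  unfold ballCutoff
  refine (abs_max_sub_max_le_max _ _ _ _).trans ?_
  rw [sub_self, abs_zero, max_eq_right (abs_nonneg _)]
  refine (abs_min_sub_min_le_max _ _ _ _).trans ?_
  rw [sub_self, abs_zero, max_eq_right (abs_nonneg _)]
  have : (k + 2 - ‖w‖ : ℝ) - (k + 2 - ‖v‖) = ‖v‖ - ‖w‖ := by ring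
  rw [this, norm_sub_rev]
  exact abs_norm_sub_norm_le v w

theorem hasCompactSupport_ballCutoff (n k : ℕ) : HasCompactSupport (ballCutoff n k) := by
  refine HasCompactSupport.intro (isCompact_closedBall 0 ((k : ℝ) + 2)) fun v hv => ?_
  rw [Metric.mem_closedBall, dist_zero_right, not_le] at hv
  unfold ballCutoff
  exact max_eq_left ((min_le_right _ _).trans (by linarith))

theorem ballCutoff_eq_one {n k : ℕ} {v : Fin n → ℝ} (hv : ‖v‖ ≤ k + 1) :
    ballCutoff n k v = 1 := by
  unfold ballCutoff
  rw [min_eq_left (by linarith), max_eq_right zero_le_one]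

/-- Bump functions that shrink to the origin. -/
noncomputable def shrinkingBump (n k : ℕ) : ContDiffBump (0 : Fin n → ℝ) where
  rIn := 1 / (2 * (k + 1))
  rOut := 1 / (k + 1)
  rIn_pos := by positivity
  rIn_lt_rOut := by
    rw [div_lt_div_iff₀ (by positivity) (by positivity)]
    have : (0 : ℝ) ≤ k := k.cast_nonneg
    linarith

open ContinuousLinearMap in
-- Multiply by a cutoff, then mollify. The cutoff is 1-Lipschitz with values in `[0, 1]`, which
-- raises the Lipschitz constant by `B`; mollifying costs nothing. What matters is that the
-- constants do not depend on `k`, which bounds the energies uniformly.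
theorem exists_smooth_approximation {n : ℕ} {f : (Fin n → ℝ) → ℝ} (hf : Continuous f) {L B : ℝ}
    (hB : ∀ v, |f v| ≤ B)
    (hL : ∀ v i y, |f (Function.update v i y) - f v| ≤ L * |y - v i|) :
    ∃ F : ℕ → (Fin n → ℝ) → ℝ, (∀ k, ContDiff ℝ ∞ (F k)) ∧ (∀ k, HasCompactSupport (F k)) ∧
      (∀ k v, |F k v| ≤ B) ∧
      (∀ k v i y, |F k (Function.update v i y) - F k v| ≤ (L + B) * |y - v i|) ∧
      ∀ v, Tendsto (fun k => F k v) atTop (𝓝 (f v)) := by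
  set g : ℕ → (Fin n → ℝ) → ℝ := fun k v => ballCutoff n k v * f v with hg
  have hgc : ∀ k, Continuous (g k) := fun k => (continuous_ballCutoff n k).mul hf
  have hgs : ∀ k, HasCompactSupport (g k) := fun k => (hasCompactSupport_ballCutoff n k).mul_right
  have hB0 : 0 ≤ B := (abs_nonneg _).trans (hB 0)
  have hgB : ∀ k v, |g k v| ≤ B := fun k v => by
    rw [hg, abs_mul, abs_of_nonneg (ballCutoff_nonneg n k v)]
    exact (mul_le_of_le_one_left (abs_nonneg _) (ballCutoff_le_one n k v)).trans (hB v)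
  have hgL : ∀ k v i y, |g k (Function.update v i y) - g k v| ≤ (L + B) * |y - v i| := by
    intro k v i y
    have e : g k (Function.update v i y) - g k v =
        ballCutoff n k (Function.update v i y) * (f (Function.update v i y) - f v) +
          (ballCutoff n k (Function.update v i y) - ballCutoff n k v) * f v := by
      simp only [hg]; ring
    rw [e, add_mul]
    refine (abs_add_le _ _).trans (add_le_add ?_ ?_)
    · rw [abs_mul, abs_of_nonneg (ballCutoff_nonneg _ _ _)]
      exact (mul_le_of_le_one_left (abs_nonneg _) (ballCutoff_le_one _ _ _)).trans (hL v i y)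
    · rw [abs_mul, mul_comm]
      exact mul_le_mul (hB v) ((abs_ballCutoff_sub_le _ _ _ _).trans (norm_update_sub_le v i y))
        (abs_nonneg _) hB0
  refine ⟨fun k => convolution ((shrinkingBump n k).normed volume) (g k) (lsmul ℝ ℝ) volume,
    fun k => ?_, fun k => ?_, fun k v => ?_, fun k v i y => ?_, fun v => ?_⟩
  · exact (shrinkingBump n k).hasCompactSupport_normed.contDiff_convolution_left (n := ⊤) _
      (shrinkingBump n k).contDiff_normed (hgc k).locallyIntegrable
  · exact (shrinkingBump n k).hasCompactSupport_normed.convolution _ (hgs k)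
  · exact ContDiffBump.abs_convolution_le _ (hgB k)
  · refine ContDiffBump.abs_convolution_sub_le _ (hgc k) fun t => ?_
    -- Translation by `t` turns one coordinate update into another with the same displacement `y - v
    -- i`.
    have e : Function.update v i y - t = Function.update (v - t) i (y - t i) := by
      funext j
      by_cases hj : j = i
      · subst hj; simp
      · simp [Function.update_of_ne hj]
    rw [e]
    refine (hgL k (v - t) i (y - t i)).trans (le_of_eq ?_)
    simp
  · refine ContDiffBump.convolution_tendsto_right (φ := shrinkingBump n) (k := fun _ => v)
      tendsto_one_div_add_atTop_nhds_zero_nat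
      (Eventually.of_forall fun k => (hgc k).aestronglyMeasurable) ?_ tendsto_const_nhds
    -- Near `v` the cutoff is eventually one, so there `g k` may be replaced by `f`.
    have h1 : Tendsto (fun p : ℕ × (Fin n → ℝ) => f p.2) (atTop ×ˢ 𝓝 v) (𝓝 (f v)) :=
      (hf.tendsto v).comp tendsto_snd
    refine h1.congr' ?_
    obtain ⟨N, hN⟩ := exists_nat_gt ‖v‖
    have h2 : ∀ᶠ w in 𝓝 v, ‖w‖ < N := continuous_norm.tendsto v |>.eventually (gt_mem_nhds hN)
    have h3 := (eventually_ge_atTop N).prod_mk h2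
    filter_upwards [h3] with p hp
    have h4 : (N : ℝ) ≤ p.1 := by exact_mod_cast hp.1
    simp only [Function.uncurry, hg]
    rw [ballCutoff_eq_one (by linarith [hp.2]), one_mul]

end Mollify

/-! ### Passage between cylinder functions and functions of finitely many variables -/

section Restriction

/-- Extension of a finite sequence by zero. -/
def extendByZero (n : ℕ) (v : Fin n → ℝ) (j : ℕ) : ℝ := if h : j < n then v ⟨j, h⟩ else 0

theorem continuous_extendByZero (n : ℕ) : Continuous (extendByZero n) := by
  refine continuous_pi fun j => ?_
  unfold extendByZero
  by_cases h : j < n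
  · simp only [h, dite_true]; fun_prop
  · simp only [h, dite_false]; fun_prop

theorem extendByZero_update (n : ℕ) (v : Fin n → ℝ) (i : Fin n) (y : ℝ) :
    extendByZero n (Function.update v i y) = Function.update (extendByZero n v) i y := by
  funext j
  unfold extendByZero
  by_cases hj : j = i
  · subst hj; simp
  · rw [Function.update_of_ne hj]
    by_cases h : j < n
    · simp only [h, dite_true]
      exact Function.update_of_ne (fun e => hj (by rw [← e])) _ _
    · simp only [h, dite_false]

theorem IsLipCylinder.apply_extendByZero {n : ℕ} {L B : ℝ} {F : (ℕ → ℝ) → ℝ}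
    (h : IsLipCylinder n L B F) (x : ℕ → ℝ) : F (extendByZero n fun j => x j) = F x :=
  h.depends _ _ fun j hj => by simp [extendByZero, hj]

theorem isLipCylinder_comp {n : ℕ} {L B : ℝ} {f : (Fin n → ℝ) → ℝ} (hB : ∀ v, |f v| ≤ B)
    (hL0 : 0 ≤ L) (hL : ∀ v i y, |f (Function.update v i y) - f v| ≤ L * |y - v i|) :
    IsLipCylinder n L B (fun x => f fun j => x j) := by
  refine ⟨fun x x' hx => congrArg f (funext fun j => hx j j.2), fun x => hB _, fun x i y => ?_⟩
  by_cases hi : i < n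
  · have e : (fun j : Fin n => Function.update x i y j) =
        Function.update (fun j : Fin n => x j) ⟨i, hi⟩ y := by
      funext j
      by_cases hj : (j : ℕ) = i
      · have : j = ⟨i, hi⟩ := Fin.ext hj
        subst this; simp
      · rw [Function.update_of_ne hj, Function.update_of_ne fun e => hj (by rw [e])]
    rw [e]
    exact hL _ _ _
  · have e : (fun j : Fin n => Function.update x i y j) = fun j : Fin n => x j := by
      funext j
      exact Function.update_of_ne (fun e : (j : ℕ) = i => hi (e ▸ j.2)) _ _
    rw [e, sub_self, abs_zero]
    positivity

end Restriction

/-! ### Lipschitz cylinder functions lie in the domain -/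

section Domain

variable {S : Type*} [MeasurableSpace S] {μ : Measure S} [IsProbabilityMeasure μ] {X : S → ℕ → ℝ}
  {hX : Measurable X} {α : ℝ} {n : ℕ} {L B : ℝ} {F : (ℕ → ℝ) → ℝ}

/-- The smooth approximations have a common bound and a common Lipschitz constant. They converge
boundedly, hence in `L²(μ)`, with bounded energies. -/
theorem IsLipCylinder.inClosure (hα₀ : 0 < α) (hα₁ : α ≤ 1) (hF : IsLipCylinder n L B F) :
    (isJumpCore_cylinderCore μ hX hα₀ hα₁).InClosure F := by
  -- One additional variable keeps their number positive when `n = 0`, as `cylinderCore` requires.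
  have hF1 := hF.mono (Nat.le_succ n) le_rfl le_rfl
  obtain ⟨f, hf1, hf2, hf3, hf4, hf5⟩ := exists_smooth_approximation
    (f := fun v => F (extendByZero (n + 1) v))
    (hF.continuous.comp (continuous_extendByZero _)) (L := L) (B := B) (fun v => hF.bounded _)
    (fun v i y => by
      rw [extendByZero_update]
      refine (hF.lip _ _ _).trans (le_of_eq ?_)
      have hi := Nat.lt_succ_iff.1 i.2
      simp [extendByZero, hi])
  have hf6 : ∀ k, IsLipCylinder (n + 1) (L + B) B (fun x => f k fun j => x j) := fun k =>
    isLipCylinder_comp (hf3 k) (add_nonneg hF.lip_nonneg hF.bound_nonneg) (hf4 k)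
  refine ((isJumpCore_cylinderCore μ hX hα₀ hα₁).inClosure_of_tendsto
    (F := fun k x => f k fun j => x j) (G := F) (fun k => ?_) hF.measurable (hF.memLp μ hX) ?_
    (Real.sqrt_nonneg _) (fun k => eLpNorm_two_le_of_lintegral_le (by positivity)
      ((hf6 k).lintegral_sq_increment_le μ hX hα₀ hα₁))).1
  · exact IsJumpCore.inClosure_of_mem _
      (Submodule.subset_span ⟨n + 1, n.succ_pos, f k, hf1 k, hf2 k, rfl⟩)
  · refine tendsto_eLpNorm_two_of_bounded (C := B + B) (fun k => ?_) (fun k => ?_) ?_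
    · exact (((hf6 k).measurable.comp hX).sub (hF.measurable.comp hX)).aestronglyMeasurable
    · exact Eventually.of_forall fun x =>
        (abs_sub _ _).trans (add_le_add (hf3 k _) (hF.bounded _))
    · refine Eventually.of_forall fun x => ?_
      have := (hf5 fun j => X x j).sub_const (F (X x))
      rw [hF1.apply_extendByZero, sub_self] at this
      exact this

theorem inClosure_unitContraction (hα₀ : 0 < α) (hα₁ : α ≤ 1) (hF : F ∈ cylinderCore) :
    (isJumpCore_cylinderCore μ hX hα₀ hα₁).InClosure fun t => min (max (F t) 0) 1 := by
  obtain ⟨n, L, B, -, h⟩ := IsLipCylinder.exists_of_mem_cylinderCore hF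
  exact h.unitContraction.inClosure hα₀ hα₁

end Domain

/-! ### Density of the smooth cylinder functions -/

/-- If `μ` is carried by countably many compact sets, then every Borel set is, up to a null set,
the preimage of a Borel set under a continuous injection. -/
theorem exists_preimage_ae_eq {S : Type*} [TopologicalSpace S] [MeasurableSpace S] [BorelSpace S]
    {μ : Measure S} {X : S → ℕ → ℝ} (hXc : Continuous X) (hXi : Function.Injective X)
    {K : ℕ → Set S} (hK : ∀ k, IsCompact (K k)) (hKμ : ∀ᵐ x ∂μ, ∃ k, x ∈ K k) (B : Set S)
    (hB : MeasurableSet B) :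
    ∃ A : Set (ℕ → ℝ), MeasurableSet A ∧ ∀ᵐ x ∂μ, x ∈ B ↔ X x ∈ A := by
  rw [BorelSpace.measurable_eq (α := S), borel_eq_generateFrom_isClosed] at hB
  induction B, hB using MeasurableSpace.generateFrom_induction with
  | hC F hF _ =>
    -- Images of compact sets are compact, hence Borel, and injectivity of `X` recovers `F` inside
    -- the union of the `K k`.
    refine ⟨⋃ k, X '' (F ∩ K k), MeasurableSet.iUnion fun k =>
      (((hK k).inter_left hF).image hXc).isClosed.measurableSet, ?_⟩
    filter_upwards [hKμ] with x ⟨k, hk⟩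
    constructor
    · intro hx
      exact Set.mem_iUnion.2 ⟨k, x, ⟨hx, hk⟩, rfl⟩
    · intro hx
      obtain ⟨j, y, hy, hyx⟩ := Set.mem_iUnion.1 hx
      exact hXi hyx ▸ hy.1
  | empty => exact ⟨∅, MeasurableSet.empty, Eventually.of_forall fun x => Iff.rfl⟩
  | compl B _ ih =>
    obtain ⟨A, hA, hAB⟩ := ih
    refine ⟨Aᶜ, hA.compl, ?_⟩
    filter_upwards [hAB] with x hx
    exact not_congr hx
  | iUnion B _ ih =>
    choose A hA hAB using ih
    refine ⟨⋃ n, A n, MeasurableSet.iUnion hA, ?_⟩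
    filter_upwards [ae_all_iff.2 hAB] with x hx
    simp only [Set.mem_iUnion]
    exact exists_congr hx

section Density

variable {S : Type*} [MeasurableSpace S] {μ : Measure S} [IsProbabilityMeasure μ] {X : S → ℕ → ℝ}
  {α : ℝ}

/-- A function that is orthogonal to the smooth cylinder functions integrates to zero over the
sets given by finitely many coordinates. -/
theorem setIntegral_eq_zero_of_orthogonal (hX : Measurable X) (f : Lp ℝ 2 μ)
    (hf : ∀ F ∈ cylinderCore, ∀ hF : MemLp (fun x => F (X x)) 2 μ, inner ℝ (hF.toLp _) f = 0)
    {n : ℕ} {U : Set (Fin (n + 1) → ℝ)} (hU : MeasurableSet U) :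
    ∫ x in {x | (fun j : Fin (n + 1) => X x j) ∈ U}, f x ∂μ = 0 := by
  set r : S → Fin (n + 1) → ℝ := fun x j => X x j with hr
  have hrm : Measurable r := measurable_pi_lambda _ fun j => (measurable_pi_apply _).comp hX
  have hA : MeasurableSet {x | r x ∈ U} := hrm hU
  have : IsProbabilityMeasure (μ.map r) := Measure.isProbabilityMeasure_map hrm.aemeasurable
  rw [← L2.inner_indicatorConstLp_one (𝕜 := ℝ) hA (measure_ne_top μ _) f]
  have key : ∀ ε > 0, |inner ℝ (indicatorConstLp 2 hA (measure_ne_top μ _) (1 : ℝ)) f| ≤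
      ε * ‖f‖ := by
    intro ε hε
    have hmem : MemLp (U.indicator fun _ => (1 : ℝ)) 2 (μ.map r) :=
      memLp_indicator_const 2 hU 1 (Or.inr (measure_ne_top _ _))
    -- The indicator of `U` is approximated in `L²` of the law of the first `n + 1` coordinates by a
    -- test function, to which `f` is orthogonal.
    obtain ⟨g, hgs, hgc, hg⟩ := hmem.exist_eLpNorm_sub_le (by norm_num) (by norm_num) hε
    have hgm : MemLp (fun x => g (fun j : Fin (n + 1) => X x j)) 2 μ := by
      obtain ⟨C, hC⟩ := hgc.continuous.bounded_above_of_compact_support hgs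
      exact MemLp.of_bound (hgc.continuous.measurable.comp hrm).aestronglyMeasurable C
        (Eventually.of_forall fun x => hC _)
    have h0 := hf (fun x => g fun j => x j)
      (Submodule.subset_span ⟨n + 1, n.succ_pos, g, hgc, hgs, rfl⟩) hgm
    have h1 : ‖indicatorConstLp 2 hA (measure_ne_top μ _) (1 : ℝ) - hgm.toLp _‖ ≤ ε := by
      rw [eLpNorm_map_measure (hmem.aestronglyMeasurable.sub
        hgc.continuous.aestronglyMeasurable) hrm.aemeasurable] at hg
      rw [Lp.norm_def]
      refine ENNReal.toReal_le_of_le_ofReal hε.le (le_trans (le_of_eq (eLpNorm_congr_ae ?_)) hg)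
      filter_upwards [Lp.coeFn_sub (indicatorConstLp 2 hA (measure_ne_top μ _) (1 : ℝ))
        (hgm.toLp _), indicatorConstLp_coeFn (p := 2) (hs := hA) (hμs := measure_ne_top μ _)
        (c := (1 : ℝ)), hgm.coeFn_toLp] with x e1 e2 e3
      rw [e1, Pi.sub_apply, e2, e3]
      rfl
    have h2 : inner ℝ (indicatorConstLp 2 hA (measure_ne_top μ _) (1 : ℝ)) f =
        inner ℝ (indicatorConstLp 2 hA (measure_ne_top μ _) (1 : ℝ) - hgm.toLp _) f := by
      rw [inner_sub_left, h0, sub_zero]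
    rw [h2]
    exact (abs_real_inner_le_norm _ _).trans
      (mul_le_mul_of_nonneg_right h1 (norm_nonneg _))
  have hlim : Tendsto (fun ε : ℝ => ε * ‖f‖) (𝓝[>] 0) (𝓝 0) := by
    have hc : Continuous fun ε : ℝ => ε * ‖f‖ := by fun_prop
    simpa using (hc.tendsto 0).mono_left nhdsWithin_le_nhds
  have := ge_of_tendsto hlim (eventually_nhdsWithin_of_forall key)
  exact abs_eq_zero.1 (le_antisymm this (abs_nonneg _))

/-- A function orthogonal to the domain integrates to zero over preimages of cylinder sets, hence by
the π-λ theorem over preimages of all Borel sets. By `hS` these are, up to null sets, all measurable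
sets. -/
theorem dense_domain {hX : Measurable X} (hα₀ : 0 < α) (hα₁ : α ≤ 1)
    (hS : ∀ B : Set S, MeasurableSet B →
      ∃ A : Set (ℕ → ℝ), MeasurableSet A ∧ ∀ᵐ x ∂μ, x ∈ B ↔ X x ∈ A) :
    Dense ((isJumpCore_cylinderCore μ hX hα₀ hα₁).operator.domain : Set (Lp ℝ 2 μ)) := by
  set h := isJumpCore_cylinderCore μ hX hα₀ hα₁
  rw [Submodule.dense_iff_topologicalClosure_eq_top, Submodule.topologicalClosure_eq_top_iff,
    Submodule.eq_bot_iff]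
  intro f hf
  have hfi : Integrable f μ := (Lp.memLp f).integrable (by norm_num)
  have h0 : ∀ F ∈ cylinderCore, ∀ hF : MemLp (fun x => F (X x)) 2 μ,
      inner ℝ (hF.toLp _) f = 0 := fun F hF hFm =>
    (Submodule.mem_orthogonal _ _).1 hf _
      (h.mem_domain_of_mem_graph (h.inClosure_of_mem hF).mem_graph)
  have hbase : ∀ A ∈ measurableCylinders (fun _ : ℕ => ℝ), ∫ x in X ⁻¹' A, f x ∂μ = 0 := by
    intro A hA
    have hAm := MeasurableSet.of_mem_measurableCylinders hA
    obtain ⟨s, U, hU, rfl⟩ := (mem_measurableCylinders _).1 hA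
    have e : X ⁻¹' (cylinder s U) = {x | (fun j : Fin (s.sup id + 1) => X x j) ∈
        extendByZero (s.sup id + 1) ⁻¹' (cylinder s U)} := by
      ext x
      simp only [Set.mem_preimage, mem_cylinder, Set.mem_ofPred_eq]
      have : s.restrict (X x) =
          s.restrict (extendByZero (s.sup id + 1) fun j => X x j) := by
        funext j
        have hj : (j : ℕ) < s.sup id + 1 := Nat.lt_succ_iff.2 (Finset.le_sup (f := id) j.2)
        simp only [Finset.restrict, extendByZero, hj, dite_true]
      rw [this]
    rw [e]
    exact setIntegral_eq_zero_of_orthogonal hX f h0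
      ((continuous_extendByZero _).measurable hAm)
  have hall : ∀ A : Set (ℕ → ℝ), MeasurableSet A → ∫ x in X ⁻¹' A, f x ∂μ = 0 := by
    refine MeasurableSpace.induction_on_inter generateFrom_measurableCylinders.symm
      isPiSystem_measurableCylinders ?_ hbase ?_ ?_
    · simp
    · intro A hA ih
      have huniv : ∫ x in X ⁻¹' Set.univ, f x ∂μ = 0 :=
        hbase _ (univ_mem_measurableCylinders _)
      rw [Set.preimage_univ, setIntegral_univ] at huniv
      rw [Set.preimage_compl, setIntegral_compl (hX hA) hfi, ih, huniv, sub_zero]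
    · intro A hd hA ih
      rw [Set.preimage_iUnion, integral_iUnion (fun n => hX (hA n))
        (fun i j hij => (hd hij).preimage X) hfi.integrableOn]
      simp [ih]
  refine (Lp.eq_zero_iff_ae_eq_zero).2 (hfi.ae_eq_zero_of_forall_setIntegral_eq_zero ?_)
  intro B hB _
  obtain ⟨A, hA, hAB⟩ := hS B hB
  rw [setIntegral_congr_set (t := X ⁻¹' A) (eventuallyEq_set.2 hAB)]
  exact hall A hA

end Density

/-! ### Nests and quasi-regularity -/

/-- Functions `W k` of vanishing `E_1`-energy which are one outside of `K k`. -/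
structure IsJumpCore.HasCutoffs {S : Type*} [MeasurableSpace S] {μ : Measure S} {X : S → ℕ → ℝ}
    {J : Measure ((ℕ → ℝ) × (ℕ → ℝ))} (h : IsJumpCore μ X J cylinderCore) (K : ℕ → Set S)
    (W : ℕ → (ℕ → ℝ) → ℝ) : Prop where
  inClosure : ∀ k, h.InClosure (W k)
  eq_one : ∀ k x, x ∉ K k → W k (X x) = 1
  tendsto_energy : Tendsto (fun k => eLpNorm (increment (W k)) 2 J) atTop (𝓝 0)
  tendsto_norm : Tendsto (fun k => eLpNorm (fun x => W k (X x)) 2 μ) atTop (𝓝 0)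
  mul_core : ∀ F ∈ cylinderCore, ∃ B : ℝ, 0 ≤ B ∧ ∀ k, h.InClosure (fun t => F t * W k t) ∧
    eLpNorm (increment fun t => F t * W k t) 2 J ≤ ENNReal.ofReal B

/-- A countable family of smooth cylinder functions. -/
noncomputable def separatingFunction (n m b : ℕ) (x : ℕ → ℝ) : ℝ :=
  (⟨m + 1, m + 2, by positivity, by linarith⟩ : ContDiffBump (0 : Fin (n + 1) → ℝ))
    (fun j => x j) * (x n + b)

theorem separatingFunction_mem (n m b : ℕ) : separatingFunction n m b ∈ cylinderCore := by
  set φ : ContDiffBump (0 : Fin (n + 1) → ℝ) := ⟨m + 1, m + 2, by positivity, by linarith⟩ with hφ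
  refine Submodule.subset_span ⟨n + 1, n.succ_pos,
    fun v => φ v * (v (Fin.last n) + b), ?_, ?_, ?_⟩
  · exact φ.contDiff.mul ((contDiff_apply ℝ ℝ (Fin.last n)).add contDiff_const)
  · exact φ.hasCompactSupport.mul_right
  · rfl

/-- On this box the bump equals one. For `b = 0` the functions then read off coordinates and
separate points; `b = 1` excludes a common zero. -/
theorem separatingFunction_eq {n m b : ℕ} {x : ℕ → ℝ} (hx : ∀ j ≤ n, |x j| ≤ m) :
    separatingFunction n m b x = x n + b := by
  unfold separatingFunction
  rw [ContDiffBump.one_of_mem_closedBall, one_mul]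
  rw [mem_closedBall_zero_iff]
  refine (pi_norm_le_iff_of_nonneg (by positivity)).2 fun j => ?_
  exact (hx j (Nat.lt_succ_iff.1 j.2)).trans (by simp)

namespace IsJumpCore

variable {S : Type*} [MeasurableSpace S] {μ : Measure S} {X : S → ℕ → ℝ}
  {J : Measure ((ℕ → ℝ) × (ℕ → ℝ))} {h : IsJumpCore μ X J cylinderCore}
  {hdense : Dense (h.operator.domain : Set (Lp ℝ 2 μ))}
  {hmarkov : ∀ F ∈ cylinderCore, h.InClosure fun t => min (max (F t) 0) 1}

theorem form₁_self (u : (h.dirichletForm hdense hmarkov).domain) :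
    (h.dirichletForm hdense hmarkov).form₁ u u =
      ‖h.operator u‖ ^ 2 + ‖(u : Lp ℝ 2 μ)‖ ^ 2 := by
  unfold DirichletForm.form₁
  rw [← real_inner_self_eq_norm_sq, ← real_inner_self_eq_norm_sq]
  rfl

/-- The element of the domain given by a function in the closure of the core. -/
noncomputable def InClosure.toDomain {F : (ℕ → ℝ) → ℝ} (hF : h.InClosure F) :
    (h.dirichletForm hdense hmarkov).domain :=
  ⟨hF.memLp.toLp _, h.mem_domain_of_mem_graph hF.mem_graph⟩

theorem InClosure.operator_toDomain {F : (ℕ → ℝ) → ℝ} (hF : h.InClosure F) :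
    h.operator (hF.toDomain (hdense := hdense) (hmarkov := hmarkov)) =
      hF.memLp_increment.toLp _ :=
  h.operator_eq _ hF.mem_graph

theorem InClosure.coeFn_toDomain {F : (ℕ → ℝ) → ℝ} (hF : h.InClosure F) :
    ((hF.toDomain (hdense := hdense) (hmarkov := hmarkov) : Lp ℝ 2 μ) : S → ℝ) =ᵐ[μ]
      fun x => F (X x) :=
  hF.memLp.coeFn_toLp

variable (hdense hmarkov) in
-- The product carries the maximum of the two norms while `form₁` adds their squares, hence the
-- factor 2.
theorem form₁_sub_lt_of_dist {z : Lp ℝ 2 μ × Lp ℝ 2 J} (hz : z ∈ h.graph)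
    (u : (h.dirichletForm hdense hmarkov).domain) {δ : ℝ}
    (hd : dist ((u : Lp ℝ 2 μ), h.operator u) z < δ) :
    ∃ v : (h.dirichletForm hdense hmarkov).domain, (v : Lp ℝ 2 μ) = z.1 ∧
      (h.dirichletForm hdense hmarkov).form₁ (u - v) (u - v) < 2 * δ ^ 2 := by
  let v : (h.dirichletForm hdense hmarkov).domain := ⟨z.1, h.mem_domain_of_mem_graph hz⟩
  refine ⟨v, rfl, ?_⟩
  rw [form₁_self]
  have e : h.operator (u - v) = h.operator u - z.2 := by
    refine h.operator_eq _ ?_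
    exact h.graph.sub_mem (h.operator_mem_graph u) hz
  rw [e]
  rw [Prod.dist_eq, max_lt_iff, dist_eq_norm, dist_eq_norm] at hd
  have h1 : ‖((u - v : (h.dirichletForm hdense hmarkov).domain) : Lp ℝ 2 μ)‖ = ‖(u : Lp ℝ 2 μ) - z.1‖ := rfl
  rw [h1]
  have h2 : ‖(u : Lp ℝ 2 μ) - z.1‖ ^ 2 < δ ^ 2 := by
    have := hd.1
    gcongr
  have h3 : ‖h.operator u - z.2‖ ^ 2 < δ ^ 2 := by
    have := hd.2
    gcongr
  linarith

variable [TopologicalSpace S] {K : ℕ → Set S} {W : ℕ → (ℕ → ℝ) → ℝ}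

/-- For `h ≤ 1` the function `W k` dominates `h` outside `K k`, so it competes in the minimisation
that defines the reduced function. The latter thus has `E_1`-energy at most that of `W k`, and the
Cauchy–Schwarz inequality bounds the capacity. -/
theorem HasCutoffs.isStrictNest (hW : h.HasCutoffs K W) (hKc : ∀ k, IsClosed (K k))
    (hKm : Monotone K) : (h.dirichletForm hdense hmarkov).IsStrictNest K := by
  refine ⟨hKc, hKm, fun φ _ => ?_⟩
  set e : ℕ → ℝ := fun k => ‖(hW.inClosure k).memLp_increment.toLp _‖ ^ 2 +
    ‖(hW.inClosure k).memLp.toLp _‖ ^ 2 with he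
  have hlim : Tendsto e atTop (𝓝 0) := by
    have h1 : Tendsto (fun k => ‖(hW.inClosure k).memLp_increment.toLp _‖) atTop (𝓝 0) := by
      simp only [Lp.norm_toLp]
      exact (ENNReal.tendsto_toReal ENNReal.zero_ne_top).comp hW.tendsto_energy
    have h2 : Tendsto (fun k => ‖(hW.inClosure k).memLp.toLp _‖) atTop (𝓝 0) := by
      simp only [Lp.norm_toLp]
      exact (ENNReal.tendsto_toReal ENNReal.zero_ne_top).comp hW.tendsto_norm
    have h3 := (h1.pow 2).add (h2.pow 2)
    rw [zero_pow two_ne_zero, add_zero] at h3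
    exact h3
  have hbound : ∀ k, (h.dirichletForm hdense hmarkov).strictCap φ (K k)ᶜ ≤ ENNReal.ofReal (Real.sqrt (e k) * ‖φ‖) := by
    intro k
    refine iSup_le fun g => iSup_le fun w => iSup_le fun hgw => ?_
    obtain ⟨-, hg1, hw⟩ := hgw
    refine ENNReal.ofReal_le_ofReal ?_
    have h1 : (h.dirichletForm hdense hmarkov).form₁ w w ≤ e k := by
      have := hw.2 (hW.inClosure k).toDomain (by
        filter_upwards [hg1, (hW.inClosure k).coeFn_toDomain (hdense := hdense)
          (hmarkov := hmarkov)] with x hx hx2 hxK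
        rw [hx2, hW.eq_one k x hxK]
        exact hx)
      rw [form₁_self, form₁_self, InClosure.operator_toDomain] at this
      rw [form₁_self]
      exact this
    have h2 : ‖(w : Lp ℝ 2 μ)‖ ≤ Real.sqrt (e k) := by
      refine Real.le_sqrt_of_sq_le (le_trans ?_ h1)
      rw [form₁_self]
      exact le_add_of_nonneg_left (sq_nonneg _)
    have h3 : ∫ x, (w : Lp ℝ 2 μ) x * φ x ∂μ = inner ℝ φ (w : Lp ℝ 2 μ) := by
      rw [L2.inner_def]
      rfl
    rw [h3]
    calc inner ℝ φ (w : Lp ℝ 2 μ) ≤ ‖φ‖ * ‖(w : Lp ℝ 2 μ)‖ := real_inner_le_norm _ _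
      _ ≤ Real.sqrt (e k) * ‖φ‖ := by rw [mul_comm]; gcongr
  refine tendsto_of_tendsto_of_tendsto_of_le_of_le tendsto_const_nhds ?_ (fun _ => zero_le)
    hbound
  have h4 : Tendsto (fun k => Real.sqrt (e k) * ‖φ‖) atTop (𝓝 0) := by
    have := ((Real.continuous_sqrt.tendsto 0).comp hlim).mul_const ‖φ‖
    simpa using this
  simpa using ENNReal.tendsto_ofReal h4

/-- For `F` in the core, `F - F * W k` vanishes outside `K k`, has bounded energy and tends to `F`
in `L²(μ)`; convex combinations converge in graph norm. Since `K` is increasing, they still vanish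
outside a single `K k`. -/
theorem HasCutoffs.isNest (hW : h.HasCutoffs K W) (hKc : ∀ k, IsClosed (K k))
    (hKm : Monotone K) : (h.dirichletForm hdense hmarkov).IsNest K := by
  refine ⟨hKc, hKm, fun u ε hε => ?_⟩
  let V : Submodule ℝ (Lp ℝ 2 μ × Lp ℝ 2 J) :=
    { carrier := {z | z ∈ h.graph ∧ ∃ k, ∀ᵐ x ∂μ, x ∉ K k → z.1 x = 0}
      add_mem' := by
        rintro z w ⟨hz, k, hzk⟩ ⟨hw, l, hwl⟩
        refine ⟨h.graph.add_mem hz hw, max k l, ?_⟩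
        filter_upwards [hzk, hwl, Lp.coeFn_add z.1 w.1] with x h1 h2 h3 hx
        rw [Prod.fst_add, h3, Pi.add_apply, h1 fun hk => hx (hKm (le_max_left _ _) hk),
          h2 fun hl => hx (hKm (le_max_right _ _) hl), add_zero]
      zero_mem' := by
        refine ⟨h.graph.zero_mem, 0, ?_⟩
        filter_upwards [Lp.coeFn_zero ℝ 2 μ] with x hx _
        exact hx
      smul_mem' := by
        rintro c z ⟨hz, k, hzk⟩
        refine ⟨h.graph.smul_mem c hz, k, ?_⟩
        filter_upwards [hzk, Lp.coeFn_smul c z.1] with x h1 h2 hx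
        rw [Prod.smul_fst, h2, Pi.smul_apply, h1 hx, smul_zero] }
  have hcore : ∀ F : cylinderCore, h.coreMap F ∈ closure (V : Set (Lp ℝ 2 μ × Lp ℝ 2 J)) := by
    intro F
    have hF := h.inClosure_of_mem F.2
    obtain ⟨B, hB0, hB⟩ := hW.mul_core F F.2
    set y : ℕ → Lp ℝ 2 μ × Lp ℝ 2 J := fun k =>
      h.coreMap F - ((hB k).1.memLp.toLp _, (hB k).1.memLp_increment.toLp _) with hy
    have hyV : ∀ k, y k ∈ V := by
      intro k
      refine ⟨h.graph.sub_mem (h.coreMap_mem_graph F) (hB k).1.mem_graph, k, ?_⟩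
      filter_upwards [Lp.coeFn_sub (h.coreMap F).1 ((hB k).1.memLp.toLp _),
        hF.memLp.coeFn_toLp, (hB k).1.memLp.coeFn_toLp] with x h1 h2 h3 hx
      have h2' : (h.coreMap F).1 x = (F : (ℕ → ℝ) → ℝ) (X x) := h2
      simp only [hy, Prod.fst_sub]
      rw [h1, Pi.sub_apply, h2', h3, hW.eq_one k x hx, mul_one, sub_self]
    have hy1 : Tendsto (fun k => (y k).1) atTop (𝓝 (h.coreMap F).1) := by
      obtain ⟨n, L, C, -, hLip⟩ := IsLipCylinder.exists_of_mem_cylinderCore F.2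
      have h1 : Tendsto (fun k => (hB k).1.memLp.toLp _) atTop (𝓝 (0 : Lp ℝ 2 μ)) := by
        rw [tendsto_zero_iff_norm_tendsto_zero]
        simp only [Lp.norm_toLp]
        refine (ENNReal.tendsto_toReal ENNReal.zero_ne_top).comp ?_
        have h2 : Tendsto (fun k => ENNReal.ofReal C * eLpNorm (fun x => W k (X x)) 2 μ) atTop
            (𝓝 0) := by
          simpa using ENNReal.Tendsto.const_mul hW.tendsto_norm (Or.inr ENNReal.ofReal_ne_top)
        refine tendsto_of_tendsto_of_tendsto_of_le_of_le tendsto_const_nhds h2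
          (fun _ => zero_le) fun k => ?_
        refine eLpNorm_le_mul_eLpNorm_of_ae_le_mul (Eventually.of_forall fun x => ?_) 2
        rw [norm_mul]
        exact mul_le_mul_of_nonneg_right (hLip.bounded _) (norm_nonneg _)
      simpa [hy] using (tendsto_const_nhds (x := (h.coreMap F).1)).sub h1
    have hy2 : ∀ k, ‖(y k).2‖ ≤ ‖(h.coreMap F).2‖ + B := by
      intro k
      refine (norm_sub_le _ _).trans (add_le_add le_rfl ?_)
      rw [Lp.norm_toLp]
      exact ENNReal.toReal_le_of_le_ofReal hB0 (hB k).2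
    obtain ⟨g, -, hg, hcl⟩ := h.exists_mem_graph_of_bounded (fun k => (hyV k).1) hy1 hy2
    -- The limit of the convex combinations has the right first component, and the graph determines
    -- the second.
    have e : ((h.coreMap F).1, g) = h.coreMap F :=
      Prod.ext rfl (h.graph_ext hg (h.coreMap_mem_graph F) rfl)
    rw [e] at hcl
    refine closure_mono (convexHull_min ?_ V.convex) hcl
    rintro _ ⟨k, rfl⟩
    exact hyV k
  have hall : ((u : Lp ℝ 2 μ), h.operator u) ∈ closure (V : Set (Lp ℝ 2 μ × Lp ℝ 2 J)) := by
    have h1 : ((u : Lp ℝ 2 μ), h.operator u) ∈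
        closure (LinearMap.range h.coreMap : Set (Lp ℝ 2 μ × Lp ℝ 2 J)) :=
      h.operator_mem_graph u
    refine closure_minimal ?_ isClosed_closure h1
    rintro _ ⟨F, rfl⟩
    exact hcore F
  obtain ⟨z, hz, hd⟩ := Metric.mem_closure_iff.1 hall (Real.sqrt (ε / 2))
    (Real.sqrt_pos.2 (by positivity))
  obtain ⟨v, hv, hlt⟩ := form₁_sub_lt_of_dist hdense hmarkov hz.1 u hd
  obtain ⟨k, hk⟩ := hz.2
  refine ⟨k, v, ?_, ?_⟩
  · rw [hv]; exact hk
  · rw [Real.sq_sqrt (by positivity)] at hlt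
    linarith

theorem isQuasiContinuousVersion_core (hXc : Continuous X) {Nest : (ℕ → Set S) → Prop}
    (hN : ∃ F, Nest F) {F : (ℕ → ℝ) → ℝ} (hF : F ∈ cylinderCore) :
    (h.dirichletForm hdense hmarkov).IsQuasiContinuousVersion Nest
      (h.inClosure_of_mem hF).toDomain fun x => F (X x) := by
  obtain ⟨K, hK⟩ := hN
  obtain ⟨n, L, B, -, hLip⟩ := IsLipCylinder.exists_of_mem_cylinderCore hF
  exact ⟨⟨K, hK, fun k => (hLip.continuous.comp hXc).continuousOn⟩,
    (h.inClosure_of_mem hF).coeFn_toDomain.symm⟩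

theorem hasDenseQuasiContinuous (hXc : Continuous X) {Nest : (ℕ → Set S) → Prop}
    (hN : ∃ F, Nest F) : (h.dirichletForm hdense hmarkov).HasDenseQuasiContinuous Nest := by
  refine ⟨{u | ∃ F, ∃ hF : F ∈ cylinderCore, u = (h.inClosure_of_mem hF).toDomain}, ?_, ?_⟩
  · rintro _ ⟨F, hF, rfl⟩
    exact ⟨_, isQuasiContinuousVersion_core hXc hN hF⟩
  · intro u ε hε
    have h1 : ((u : Lp ℝ 2 μ), h.operator u) ∈
        closure (LinearMap.range h.coreMap : Set (Lp ℝ 2 μ × Lp ℝ 2 J)) :=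
      h.operator_mem_graph u
    obtain ⟨_, ⟨F, rfl⟩, hd⟩ := Metric.mem_closure_iff.1 h1 (Real.sqrt (ε / 2))
      (Real.sqrt_pos.2 (by positivity))
    obtain ⟨v, hv, hlt⟩ := form₁_sub_lt_of_dist hdense hmarkov (h.coreMap_mem_graph F) u hd
    refine ⟨v, ⟨F, F.2, Subtype.ext hv⟩, ?_⟩
    rw [Real.sq_sqrt (by positivity)] at hlt
    linarith

theorem exists_separating (hXc : Continuous X) (hXi : Function.Injective X)
    {Nest : (ℕ → Set S) → Prop} (hN : ∃ F, Nest F) :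
    ∃ (u : ℕ → (h.dirichletForm hdense hmarkov).domain) (f : ℕ → S → ℝ) (N : Set S),
      (∀ n, (h.dirichletForm hdense hmarkov).IsQuasiContinuousVersion Nest (u n) (f n)) ∧
      DirichletForm.IsExceptional Nest N ∧
      (∀ x ∉ N, ∀ y ∉ N, x ≠ y → ∃ n, f n x ≠ f n y) ∧ ∀ x ∉ N, ∃ n, f n x ≠ 0 := by
  have hlarge : ∀ (x : ℕ → ℝ) (n : ℕ), ∃ m : ℕ, ∀ j ≤ n, |x j| ≤ m := by
    intro x n
    obtain ⟨m, hm⟩ := exists_nat_ge (∑ j ∈ Finset.range (n + 1), |x j|)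
    exact ⟨m, fun j hj => (Finset.single_le_sum (f := fun j => |x j|) (fun j _ => abs_nonneg _)
      (Finset.mem_range.2 (Nat.lt_succ_iff.2 hj))).trans hm⟩
  let g : ℕ → (ℕ → ℝ) → ℝ := fun k =>
    separatingFunction k.unpair.1 k.unpair.2.unpair.1 k.unpair.2.unpair.2
  have hg : ∀ n m b, g (Nat.pair n (Nat.pair m b)) = separatingFunction n m b := by
    intro n m b
    simp [g]
  have hgc : ∀ k, g k ∈ cylinderCore := fun k => separatingFunction_mem _ _ _
  refine ⟨fun k => (h.inClosure_of_mem (hgc k)).toDomain, fun k x => g k (X x), ∅,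
    fun k => isQuasiContinuousVersion_core hXc hN (hgc k), ?_, ?_, ?_⟩
  · obtain ⟨F, hF⟩ := hN
    exact ⟨F, hF, Set.empty_subset _⟩
  · intro x _ y _ hxy
    obtain ⟨n, hn⟩ := Function.ne_iff.1 (hXi.ne hxy)
    obtain ⟨m, hm⟩ := hlarge (X x) n
    obtain ⟨m', hm'⟩ := hlarge (X y) n
    refine ⟨Nat.pair n (Nat.pair (max m m') 0), ?_⟩
    simp only [hg]
    rw [separatingFunction_eq fun j hj => (hm j hj).trans (by simp),
      separatingFunction_eq fun j hj => (hm' j hj).trans (by simp)]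
    simpa using hn
  · intro x _
    obtain ⟨m, hm⟩ := hlarge (X x) 0
    by_cases h0 : X x 0 = 0
    · refine ⟨Nat.pair 0 (Nat.pair m 1), ?_⟩
      simp only [hg]
      rw [separatingFunction_eq hm, h0]
      norm_num
    · refine ⟨Nat.pair 0 (Nat.pair m 0), ?_⟩
      simp only [hg]
      rw [separatingFunction_eq hm]
      simpa using h0

theorem HasCutoffs.isQuasiRegular (hW : h.HasCutoffs K W) (hXc : Continuous X)
    (hXi : Function.Injective X) (hK : ∀ k, IsCompact (K k)) (hKc : ∀ k, IsClosed (K k))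
    (hKm : Monotone K) :
    (h.dirichletForm hdense hmarkov).IsQuasiRegular ∧
      (h.dirichletForm hdense hmarkov).IsStrictlyQuasiRegular := by
  have h1 : (h.dirichletForm hdense hmarkov).IsNest K := hW.isNest hKc hKm
  have h2 : (h.dirichletForm hdense hmarkov).IsStrictNest K := hW.isStrictNest hKc hKm
  obtain ⟨u, f, N, hu, hN, hsep, -⟩ :=
    exists_separating (h := h) (hdense := hdense) (hmarkov := hmarkov) hXc hXi ⟨K, h1⟩
  exact ⟨⟨⟨K, h1, hK⟩, hasDenseQuasiContinuous hXc ⟨K, h1⟩, u, f, N, hu, hN, hsep⟩,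
    ⟨K, h2, hK⟩, hasDenseQuasiContinuous hXc ⟨K, h2⟩, exists_separating hXc hXi ⟨K, h2⟩⟩

end IsJumpCore

/-! ### Cutoff functions built from potentials -/

/-- A continuous function of `t` that vanishes for `t ≤ M` and is one for `2 M ≤ t`. -/
noncomputable def levelCutoff (M t : ℝ) : ℝ := min 1 (2 * (1 - M / max t M))

section LevelCutoff

variable {M t t' : ℝ} (hM : 0 < M)
include hM

theorem levelCutoff_nonneg : 0 ≤ levelCutoff M t := by
  have h : M / max t M ≤ 1 := (div_le_one (lt_max_of_lt_right hM)).2 (le_max_right _ _)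
  exact le_min zero_le_one (by linarith)

omit hM in
theorem levelCutoff_le_one : levelCutoff M t ≤ 1 := min_le_left _ _

theorem levelCutoff_mono (h : t' ≤ t) : levelCutoff M t' ≤ levelCutoff M t := by
  have h1 : M / max t M ≤ M / max t' M :=
    div_le_div_of_nonneg_left hM.le (lt_max_of_lt_right hM) (max_le_max_right M h)
  exact min_le_min_left _ (by linarith)

theorem levelCutoff_eq_zero (h : t ≤ M) : levelCutoff M t = 0 := by
  unfold levelCutoff
  rw [max_eq_right h, div_self hM.ne']
  norm_num

theorem levelCutoff_eq_one (h : 2 * M ≤ t) : levelCutoff M t = 1 := by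
  have h1 : M / max t M ≤ 1 / 2 := by
    rw [max_eq_left (by linarith), div_le_div_iff₀ (by linarith) two_pos]
    linarith
  exact min_eq_left (by linarith)

/-- With `m = max t' M` one has `M / m - M / t = M (t - m) / (m t) ≤ (t - t') / t`. So the cutoff
sees only relative changes of `t`, with a constant free of `M`. -/
theorem levelCutoff_sub_le (h : t' ≤ t) (ht : M < t) :
    levelCutoff M t - levelCutoff M t' ≤ 2 * ((t - t') / t) := by
  have ht0 : 0 < t := hM.trans ht
  have hm : 0 < max t' M := lt_max_of_lt_right hM
  have h1 : M / max t' M - M / t ≤ (t - t') / t := by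
    rw [div_sub_div _ _ hm.ne' ht0.ne', div_le_div_iff₀ (mul_pos hm ht0) ht0]
    have h2 : max t' M ≤ t := max_le h ht.le
    have h3 : M * (t - max t' M) ≤ max t' M * (t - max t' M) :=
      mul_le_mul_of_nonneg_right (le_max_right _ _) (by linarith)
    have h4 : max t' M * (t - max t' M) ≤ max t' M * (t - t') :=
      mul_le_mul_of_nonneg_left (by linarith [le_max_left t' M]) hm.le
    calc (M * t - max t' M * M) * t = M * (t - max t' M) * t := by ring
      _ ≤ max t' M * (t - t') * t := mul_le_mul_of_nonneg_right (h3.trans h4) ht0.le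
      _ = (t - t') * (max t' M * t) := by ring
  have hMt : M / max t M = M / t := by rw [max_eq_left ht.le]
  have hmono := levelCutoff_mono hM h
  unfold levelCutoff at hmono ⊢
  rw [hMt] at hmono ⊢
  rcases le_total 1 (2 * (1 - M / max t' M)) with h5 | h5
  · rw [min_eq_left h5]
    have : 0 ≤ (t - t') / t := div_nonneg (by linarith) ht0.le
    linarith [min_le_left 1 (2 * (1 - M / t))]
  · rw [min_eq_right h5]
    linarith [min_le_right 1 (2 * (1 - M / t))]

end LevelCutoff

/-- A function `N` of the first `n` coordinates that only changes if a coordinate `i` larger than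
the scale `s i` changes, and whose relative decrease is then at most a fraction `ρ i` of the
relative change of that coordinate, up to the factor `P`. -/
structure IsPotential (s : ℕ → ℝ) (P : ℝ) (n : ℕ) (N : (ℕ → ℝ) → ℝ) (ρ : ℕ → (ℕ → ℝ) → ℝ) :
    Prop where
  depends : ∀ x x' : ℕ → ℝ, (∀ j < n, x j = x' j) → N x = N x'
  measurable : Measurable N
  measurable_weight : ∀ i, Measurable (ρ i)
  weight_nonneg : ∀ i x, 0 ≤ ρ i x
  sum_weight_le : ∀ x, ∑ i ∈ Finset.range n, ρ i x ≤ 1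
  decrease : ∀ x i y, N (Function.update x i y) < N x → s i < |x i| ∧
    N x - N (Function.update x i y) ≤ N x * (ρ i x * (P * min 1 (|x i - y| / |x i|)))

namespace IsPotential

variable {s : ℕ → ℝ} {P : ℝ} {n : ℕ} {N : (ℕ → ℝ) → ℝ} {ρ : ℕ → (ℕ → ℝ) → ℝ} {M : ℝ}

theorem weight_le_one (h : IsPotential s P n N ρ) {i : ℕ} (hi : i < n) (x : ℕ → ℝ) : ρ i x ≤ 1 :=
  (Finset.single_le_sum (f := fun i => ρ i x) (fun j _ => h.weight_nonneg j x)
    (Finset.mem_range.2 hi)).trans (h.sum_weight_le x)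

theorem lt_of_update_lt (h : IsPotential s P n N ρ) {x : ℕ → ℝ} {i : ℕ} {y : ℝ}
    (hN : N (Function.update x i y) < N x) : i < n := by
  by_contra hi
  exact hN.ne (h.depends _ _ fun j hj => Function.update_of_ne (by omega) _ _)

theorem levelCutoff_sub_le (h : IsPotential s P n N ρ) (hM : 0 < M) {x : ℕ → ℝ} {i : ℕ} {y : ℝ}
    (hN : N (Function.update x i y) < N x) (hx : M < N x) :
    levelCutoff M (N x) - levelCutoff M (N (Function.update x i y)) ≤
      2 * (ρ i x * (P * min 1 (|x i - y| / |x i|))) := by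
  refine (_root_.levelCutoff_sub_le hM hN.le hx).trans ?_
  have hpos := hM.trans hx
  refine mul_le_mul_of_nonneg_left ?_ zero_le_two
  rw [div_le_iff₀ hpos, mul_comm]
  exact (h.decrease x i y hN).2

/-- A decrease forces `s i < |x i|`, so a relative change of `x i` is at most `(s i)⁻¹` times the
absolute one. The constant grows with `n`, but it only serves to place the cutoff in the domain. -/
theorem isLipCylinder (h : IsPotential s P n N ρ) (hs : ∀ i, 0 < s i) (hP : 0 ≤ P) (hM : 0 < M) :
    IsLipCylinder n (2 * P * ∑ j ∈ Finset.range n, (s j)⁻¹) 1 fun x => levelCutoff M (N x) := by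
  have key : ∀ x i y, N (Function.update x i y) < N x →
      levelCutoff M (N x) - levelCutoff M (N (Function.update x i y)) ≤
        (2 * P * ∑ j ∈ Finset.range n, (s j)⁻¹) * |y - x i| := by
    intro x i y hN
    have hi := h.lt_of_update_lt hN
    have hsum : (s i)⁻¹ ≤ ∑ j ∈ Finset.range n, (s j)⁻¹ :=
      Finset.single_le_sum (f := fun j => (s j)⁻¹) (fun j _ => (inv_pos.2 (hs j)).le)
        (Finset.mem_range.2 hi)
    have hsum0 : 0 ≤ ∑ j ∈ Finset.range n, (s j)⁻¹ := (inv_pos.2 (hs i)).le.trans hsum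
    rcases le_or_gt (N x) M with hx | hx
    · rw [levelCutoff_eq_zero hM hx, levelCutoff_eq_zero hM (hN.le.trans hx), sub_self]
      positivity
    · refine (h.levelCutoff_sub_le hM hN hx).trans ?_
      have hxi := (h.decrease x i y hN).1
      have h1 : min 1 (|x i - y| / |x i|) ≤ (s i)⁻¹ * |y - x i| := by
        refine (min_le_right _ _).trans ?_
        rw [abs_sub_comm, div_eq_inv_mul]
        exact mul_le_mul_of_nonneg_right (inv_anti₀ (hs i) hxi.le) (abs_nonneg _)
      have h0 : 0 ≤ min 1 (|x i - y| / |x i|) := le_min zero_le_one (by positivity)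
      have h2 : ρ i x * (P * min 1 (|x i - y| / |x i|)) ≤
          1 * (P * ((∑ j ∈ Finset.range n, (s j)⁻¹) * |y - x i|)) := by
        refine mul_le_mul (h.weight_le_one hi x) ?_ (mul_nonneg hP h0) zero_le_one
        exact mul_le_mul_of_nonneg_left
          (h1.trans (mul_le_mul_of_nonneg_right hsum (abs_nonneg _))) hP
      calc 2 * (ρ i x * (P * min 1 (|x i - y| / |x i|)))
          ≤ 2 * (1 * (P * ((∑ j ∈ Finset.range n, (s j)⁻¹) * |y - x i|))) := by gcongr
        _ = _ := by ring
  have hsum0 : 0 ≤ ∑ j ∈ Finset.range n, (s j)⁻¹ :=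
    Finset.sum_nonneg fun j _ => (inv_pos.2 (hs j)).le
  refine ⟨fun x x' hx => by rw [h.depends x x' hx], fun x => ?_, fun x i y => ?_⟩
  · rw [abs_of_nonneg (levelCutoff_nonneg hM)]
    exact levelCutoff_le_one
  · rcases lt_trichotomy (N (Function.update x i y)) (N x) with hN | hN | hN
    · rw [abs_sub_comm, abs_of_nonneg (sub_nonneg.2 (levelCutoff_mono hM hN.le))]
      exact key x i y hN
    · rw [hN, sub_self, abs_zero]
      positivity
    · rw [abs_of_nonneg (sub_nonneg.2 (levelCutoff_mono hM hN.le))]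
      -- An increase is a decrease along the reversed jump.
      have e : Function.update (Function.update x i y) i (x i) = x := by simp
      have := key (Function.update x i y) i (x i) (by rwa [e])
      rw [e, Function.update_self, abs_sub_comm] at this
      exact this

/-- For a number in `[0, 1]` the square is at most the power `α + 1`, as `α ≤ 1`. The condition `b ≤
1` then replaces `b ^ (α + 1)` by the smaller `b ^ 2`. -/
theorem min_one_sq_le {α d a b : ℝ} (hα₀ : 0 < α) (hα₁ : α ≤ 1) (hd : 0 ≤ d) (hb : 0 < b)
    (hb1 : b ≤ 1) (hab : b < a) : min 1 (d / a) ^ 2 ≤ (b ^ 2)⁻¹ * d ^ (α + 1) := by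
  have ha : 0 < a := hb.trans hab
  have h1 : min 1 (d / a) ≤ min 1 (d / b) :=
    min_le_min_left _ (div_le_div_of_nonneg_left hd hb hab.le)
  have h0 : 0 ≤ min 1 (d / a) := le_min zero_le_one (by positivity)
  have h0' : 0 ≤ min 1 (d / b) := h0.trans h1
  calc min 1 (d / a) ^ 2 ≤ min 1 (d / b) ^ 2 := by gcongr
    _ ≤ min 1 (d / b) ^ (α + 1) := by
      rcases h0'.eq_or_lt with h2 | h2
      · rw [← h2, Real.zero_rpow (by linarith)]; norm_num
      · rw [← Real.rpow_natCast]
        exact Real.rpow_le_rpow_of_exponent_ge h2 (min_le_left _ _) (by push_cast; linarith)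
    _ ≤ (d / b) ^ (α + 1) := Real.rpow_le_rpow h0' (min_le_right _ _) (by linarith)
    _ = (b ^ (α + 1))⁻¹ * d ^ (α + 1) := by
      rw [Real.div_rpow hd hb.le, div_eq_inv_mul]
    _ ≤ (b ^ 2)⁻¹ * d ^ (α + 1) := by
      refine mul_le_mul_of_nonneg_right (inv_anti₀ (by positivity) ?_) (Real.rpow_nonneg hd _)
      rw [← Real.rpow_natCast]
      exact Real.rpow_le_rpow_of_exponent_ge hb hb1 (by push_cast; linarith)

/-- The bound for the energy of a cutoff function. -/
noncomputable def energyBound (s : ℕ → ℝ) (P M : ℝ) (n : ℕ) (N : (ℕ → ℝ) → ℝ)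
    (ρ : ℕ → (ℕ → ℝ) → ℝ) (i : ℕ) : (ℕ → ℝ) → ℝ≥0∞ :=
  {x | i < n ∧ s i < |x i| ∧ M < N x}.indicator fun x =>
    ENNReal.ofReal (4 * P ^ 2 * (s i ^ 2)⁻¹ * ρ i x)

theorem measurable_energyBound (h : IsPotential s P n N ρ) (i : ℕ) :
    Measurable (energyBound s P M n N ρ i) := by
  refine Measurable.indicator ?_ ?_
  · exact ENNReal.measurable_ofReal.comp ((h.measurable_weight i).const_mul _)
  · refine (MeasurableSet.const _).inter (MeasurableSet.inter ?_ ?_)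
    · exact measurableSet_lt measurable_const
        (continuous_abs.measurable.comp (measurable_pi_apply i))
    · exact measurableSet_lt measurable_const h.measurable

/-- The point `x` is the end of the jump with the larger potential; leaving the orientation of `q`
open covers increases as well. Of the two factors `ρ i x` from squaring, one is bounded by one and
the other is kept for the sum over `i`. -/
theorem jumpWeight_mul_le_energyBound (h : IsPotential s P n N ρ) {α : ℝ} (hα₀ : 0 < α)
    (hα₁ : α ≤ 1) (hs : ∀ i, 0 < s i) (hs1 : ∀ i, s i ≤ 1) (hM : 0 < M) (i : ℕ)
    (x : ℕ → ℝ) (y : ℝ) (hN : N (Function.update x i y) < N x) {q : (ℕ → ℝ) × (ℕ → ℝ)}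
    (hq : |increment (fun t => levelCutoff M (N t)) q| =
      levelCutoff M (N x) - levelCutoff M (N (Function.update x i y)))
    (hq' : |q.2 i - q.1 i| = |x i - y|) :
    jumpWeight α i q * ‖increment (fun t => levelCutoff M (N t)) q‖ₑ ^ 2 ≤
      energyBound s P M n N ρ i x := by
  have hi := h.lt_of_update_lt hN
  rcases le_or_gt (N x) M with hx | hx
  · rw [levelCutoff_eq_zero hM hx, levelCutoff_eq_zero hM (hN.le.trans hx), sub_self,
      abs_eq_zero] at hq
    simp [hq]
  · have hxi := (h.decrease x i y hN).1
    have hmem : x ∈ {x : ℕ → ℝ | i < n ∧ s i < |x i| ∧ M < N x} := ⟨hi, hxi, hx⟩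
    rw [energyBound, Set.indicator_of_mem hmem]
    refine jumpWeight_mul_le ?_
    rw [← sq_abs, hq, hq']
    have hle := h.levelCutoff_sub_le hM hN hx
    have h0 : 0 ≤ levelCutoff M (N x) - levelCutoff M (N (Function.update x i y)) :=
      sub_nonneg.2 (levelCutoff_mono hM hN.le)
    have hρ0 := h.weight_nonneg i x
    have hρ1 := h.weight_le_one hi x
    have hm := min_one_sq_le hα₀ hα₁ (abs_nonneg (x i - y)) (hs i) (hs1 i) hxi
    calc _ ≤ (2 * (ρ i x * (P * min 1 (|x i - y| / |x i|)))) ^ 2 := by gcongr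
      _ = 4 * P ^ 2 * (ρ i x * ρ i x) * min 1 (|x i - y| / |x i|) ^ 2 := by ring
      _ ≤ 4 * P ^ 2 * (ρ i x * 1) * ((s i ^ 2)⁻¹ * |x i - y| ^ (α + 1)) := by gcongr
      _ = _ := by ring

end IsPotential

/-! ### Energies of the cutoffs and the measure that controls them -/

section CutoffEnergy

variable {S : Type*} [MeasurableSpace S] (μ : Measure S) {X : S → ℕ → ℝ}
  (hX : Measurable X) {α : ℝ} {s : ℕ → ℝ} {P : ℝ} {n : ℕ} {N : (ℕ → ℝ) → ℝ}
  {ρ : ℕ → (ℕ → ℝ) → ℝ} {M : ℝ}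

theorem IsPotential.lintegral_sq_increment_le [IsProbabilityMeasure μ]
    (h : IsPotential s P n N ρ) (hα₀ : 0 < α)
    (hα₁ : α ≤ 1) (hs : ∀ i, 0 < s i) (hs1 : ∀ i, s i ≤ 1) (hP : 0 ≤ P) (hM : 0 < M) :
    ∫⁻ q, ‖increment (fun t => levelCutoff M (N t)) q‖ₑ ^ 2 ∂(jumpMeasure μ hX α) ≤
      2 * ∑' i, ∫⁻ x, IsPotential.energyBound s P M n N ρ i (X x) ∂μ := by
  refine _root_.lintegral_sq_increment_le μ hX (h.isLipCylinder hs hP hM).measurable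
    (fun i => h.measurable_energyBound i) fun i x y => ?_
  rcases lt_trichotomy (N (Function.update x i y)) (N x) with hN | hN | hN
  · refine le_trans (h.jumpWeight_mul_le_energyBound hα₀ hα₁ hs hs1 hM i x y hN ?_ ?_)
      le_self_add
    · simp only [increment]
      rw [abs_sub_comm, abs_of_nonneg (sub_nonneg.2 (levelCutoff_mono hM hN.le))]
    · simp only [Function.update_self]
      rw [abs_sub_comm]
  · simp [increment, hN]
  · have e : Function.update (Function.update x i y) i (x i) = x := by simp
    refine le_trans (h.jumpWeight_mul_le_energyBound hα₀ hα₁ hs hs1 hM i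
      (Function.update x i y) (x i) (by rwa [e]) ?_ ?_) le_add_self
    · simp only [increment, e]
      rw [abs_of_nonneg (sub_nonneg.2 (levelCutoff_mono hM hN.le))]
    · simp only [Function.update_self]

/-- The measure that controls the energies of the cutoff functions. -/
noncomputable def controlMeasure (X : S → ℕ → ℝ) (s : ℕ → ℝ) : Measure S :=
  μ + Measure.sum fun i => ENNReal.ofReal (if s i < 1 then (s i ^ 2)⁻¹ else 0) •
    μ.restrict {x | s i < |X x i|}

include hX in
-- Coordinates with `s i = 1` are paid for by `∑ ρ i ≤ 1`, which gives `μ A` in total. Where `s i <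
-- 1` the factor `(s i ^ 2)⁻¹` is large; there `ρ i ≤ 1` is used, and the cost is the `i`-th summand
-- of `controlMeasure`.
theorem IsPotential.tsum_energyBound_le (h : IsPotential s P n N ρ)
    (hs1 : ∀ i, s i ≤ 1) {A : Set S} (hA : MeasurableSet A)
    (hNA : ∀ x, M < N (X x) → x ∈ A) :
    ∑' i, ∫⁻ x, IsPotential.energyBound s P M n N ρ i (X x) ∂μ ≤
      ENNReal.ofReal (4 * P ^ 2) * controlMeasure μ X s A := by
  have hpt : ∀ i x, IsPotential.energyBound s P M n N ρ i (X x) ≤ ENNReal.ofReal (4 * P ^ 2) *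
      (A.indicator (fun x => if i < n then ENNReal.ofReal (ρ i (X x)) else 0) x +
        ENNReal.ofReal (if s i < 1 then (s i ^ 2)⁻¹ else 0) *
          (A ∩ {x | s i < |X x i|}).indicator 1 x) := by
    intro i x
    by_cases hmem : X x ∈ {x : ℕ → ℝ | i < n ∧ s i < |x i| ∧ M < N x}
    · obtain ⟨hi, hxi, hx⟩ := hmem
      have hmem' : X x ∈ {x : ℕ → ℝ | i < n ∧ s i < |x i| ∧ M < N x} := ⟨hi, hxi, hx⟩
      rw [IsPotential.energyBound, Set.indicator_of_mem hmem',
        Set.indicator_of_mem (hNA x hx), if_pos hi, mul_assoc,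
        ENNReal.ofReal_mul (by positivity)]
      gcongr
      have hxA : x ∈ A ∩ {x | s i < |X x i|} := ⟨hNA x hx, hxi⟩
      rw [Set.indicator_of_mem hxA, Pi.one_apply, mul_one]
      by_cases hsi : s i < 1
      · rw [if_pos hsi]
        refine le_trans (ENNReal.ofReal_le_ofReal ?_) le_add_self
        exact mul_le_of_le_one_right (by positivity) (h.weight_le_one hi _)
      · have : s i = 1 := le_antisymm (hs1 i) (not_lt.1 hsi)
        rw [this]
        simp
    · rw [IsPotential.energyBound, Set.indicator_of_notMem hmem]
      exact zero_le
  have hmeasρ : ∀ i, Measurable (A.indicator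
      (fun x => if i < n then ENNReal.ofReal (ρ i (X x)) else 0)) := by
    intro i
    refine Measurable.indicator ?_ hA
    split_ifs
    · exact ENNReal.measurable_ofReal.comp ((h.measurable_weight i).comp hX)
    · exact measurable_const
  have hset : ∀ i, MeasurableSet {x | s i < |X x i|} := fun i =>
    measurableSet_lt measurable_const
      (continuous_abs.measurable.comp ((measurable_pi_apply i).comp hX))
  calc ∑' i, ∫⁻ x, IsPotential.energyBound s P M n N ρ i (X x) ∂μ
      ≤ ∑' i, ENNReal.ofReal (4 * P ^ 2) *
        (∫⁻ x, A.indicator (fun x => if i < n then ENNReal.ofReal (ρ i (X x)) else 0) x ∂μ +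
          ENNReal.ofReal (if s i < 1 then (s i ^ 2)⁻¹ else 0) *
            μ (A ∩ {x | s i < |X x i|})) := by
        refine ENNReal.tsum_le_tsum fun i => ?_
        refine (lintegral_mono (hpt i)).trans (le_of_eq ?_)
        have hind : Measurable ((A ∩ {x | s i < |X x i|}).indicator (1 : S → ℝ≥0∞)) :=
          measurable_one.indicator (hA.inter (hset i))
        rw [lintegral_const_mul' _ _ ENNReal.ofReal_ne_top, lintegral_add_left (hmeasρ i),
          lintegral_const_mul _ hind,
          lintegral_indicator_one (hA.inter (hset i))]
    _ = ENNReal.ofReal (4 * P ^ 2) *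
        (∑' i, ∫⁻ x, A.indicator (fun x => if i < n then ENNReal.ofReal (ρ i (X x)) else 0) x ∂μ +
          ∑' i, ENNReal.ofReal (if s i < 1 then (s i ^ 2)⁻¹ else 0) *
            μ (A ∩ {x | s i < |X x i|})) := by
        rw [ENNReal.tsum_mul_left, ENNReal.tsum_add]
    _ ≤ _ := by
        gcongr
        rw [controlMeasure, Measure.add_apply, Measure.sum_apply _ hA]
        simp only [Measure.smul_apply, Measure.restrict_apply hA, smul_eq_mul]
        gcongr
        rw [← lintegral_tsum fun i => (hmeasρ i).aemeasurable, ← lintegral_indicator_one hA]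
        refine lintegral_mono fun x => ?_
        by_cases hx : x ∈ A
        · simp only [Set.indicator_of_mem hx, Pi.one_apply]
          rw [tsum_eq_sum (s := Finset.range n) fun i hi => if_neg (by simpa using hi),
            Finset.sum_congr rfl fun i hi => if_pos (Finset.mem_range.1 hi),
            ← ENNReal.ofReal_sum_of_nonneg fun i _ => h.weight_nonneg i _]
          exact ENNReal.ofReal_le_one.2 (h.sum_weight_le _)
        · simp [Set.indicator_of_notMem hx]

end CutoffEnergy

/-! ### Limits of the cutoffs along a sequence of potentials -/

section Main

variable {S : Type*} [MeasurableSpace S] (μ : Measure S) {X : S → ℕ → ℝ} {s : ℕ → ℝ}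

theorem controlMeasure_absolutelyContinuous : controlMeasure μ X s ≪ μ := by
  refine Measure.AbsolutelyContinuous.add_left Measure.AbsolutelyContinuous.rfl ?_
  refine Measure.AbsolutelyContinuous.mk fun A hA h0 => ?_
  rw [Measure.sum_apply _ hA]
  simp only [ENNReal.tsum_eq_zero, Measure.smul_apply, smul_eq_mul]
  intro i
  rw [Measure.absolutelyContinuous_of_le Measure.restrict_le_self h0, mul_zero]

theorem controlMeasure_univ_ne_top [IsProbabilityMeasure μ]
    (hsum : Summable fun i => (if s i < 1 then (s i ^ 2)⁻¹ else 0) * μ.real {x | s i < |X x i|}) :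
    controlMeasure μ X s Set.univ ≠ ⊤ := by
  rw [controlMeasure, Measure.add_apply, Measure.sum_apply _ MeasurableSet.univ, measure_univ]
  refine ENNReal.add_ne_top.2 ⟨ENNReal.one_ne_top, ?_⟩
  refine ne_of_eq_of_ne (tsum_congr fun i => ?_) hsum.tsum_ofReal_ne_top
  rw [Measure.smul_apply, Measure.restrict_apply_univ, smul_eq_mul,
    ENNReal.ofReal_mul (by split_ifs <;> positivity), measureReal_def,
    ENNReal.ofReal_toReal (measure_ne_top _ _)]

variable [IsProbabilityMeasure μ] (hX : Measurable X) {α : ℝ} {P : ℝ}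
  {N : ℕ → (ℕ → ℝ) → ℝ} {ρ : ℕ → ℕ → (ℕ → ℝ) → ℝ}

/-- The set on which one of the potentials exceeds `M + 1`. -/
def largeSet (X : S → ℕ → ℝ) (N : ℕ → (ℕ → ℝ) → ℝ) (M : ℕ) : Set S :=
  ⋃ k, {x | (M : ℝ) + 1 < N k (X x)}

/-- The limit of the cutoff functions of a sequence of potentials. -/
noncomputable def limitCutoff (N : ℕ → (ℕ → ℝ) → ℝ) (M : ℕ) (t : ℕ → ℝ) : ℝ :=
  ⨆ k, levelCutoff (M + 1) (N k t)

theorem bddAbove_levelCutoff (M : ℕ) (t : ℕ → ℝ) :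
    BddAbove (Set.range fun k => levelCutoff (M + 1) (N k t)) :=
  ⟨1, by rintro _ ⟨k, rfl⟩; exact levelCutoff_le_one⟩

theorem tendsto_limitCutoff (hmono : ∀ x, Monotone fun k => N k x) (M : ℕ) (t : ℕ → ℝ) :
    Tendsto (fun k => levelCutoff (M + 1) (N k t)) atTop (𝓝 (limitCutoff N M t)) :=
  tendsto_atTop_ciSup (fun _ _ h => levelCutoff_mono (by positivity) (hmono t h))
    (bddAbove_levelCutoff M t)

theorem limitCutoff_nonneg (M : ℕ) (t : ℕ → ℝ) : 0 ≤ limitCutoff N M t :=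
  Real.iSup_nonneg fun _ => levelCutoff_nonneg (by positivity)

theorem limitCutoff_le_one (M : ℕ) (t : ℕ → ℝ) : limitCutoff N M t ≤ 1 :=
  ciSup_le fun _ => levelCutoff_le_one

theorem limitCutoff_eq_one {M : ℕ} {t : ℕ → ℝ} {k : ℕ} (hk : 2 * ((M : ℝ) + 1) ≤ N k t) :
    limitCutoff N M t = 1 := by
  refine le_antisymm (limitCutoff_le_one M t) ?_
  have h : levelCutoff (M + 1) (N k t) ≤ limitCutoff N M t :=
    le_ciSup (bddAbove_levelCutoff (N := N) M t) k
  rwa [levelCutoff_eq_one (by positivity) hk] at h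

theorem limitCutoff_eq_zero {M : ℕ} {t : ℕ → ℝ} (h : ∀ k, N k t ≤ (M : ℝ) + 1) :
    limitCutoff N M t = 0 := by
  unfold limitCutoff
  simp only [levelCutoff_eq_zero (by positivity : (0 : ℝ) < M + 1) (h _), ciSup_const]

include hX in
theorem measurableSet_largeSet (hN : ∀ k, Measurable (N k)) (M : ℕ) :
    MeasurableSet (largeSet X N M) :=
  MeasurableSet.iUnion fun k => measurableSet_lt measurable_const ((hN k).comp hX)

omit [MeasurableSpace S] in
theorem largeSet_antitone : Antitone (largeSet X N) := by
  intro M M' h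
  refine Set.iUnion_mono fun k x hx => ?_
  have : (M : ℝ) ≤ M' := by exact_mod_cast h
  have hx' : (M' : ℝ) + 1 < N k (X x) := hx
  exact lt_of_le_of_lt (by linarith) hx'

include hX in
-- At a point of all the large sets the potentials are unbounded, so the intersection is null for
-- `μ` and hence for `controlMeasure`, whose finiteness gives continuity from above.
theorem tendsto_controlMeasure_largeSet (hN : ∀ k, Measurable (N k))
    (hsum : Summable fun i => (if s i < 1 then (s i ^ 2)⁻¹ else 0) * μ.real {x | s i < |X x i|})
    (hbdd : ∀ᵐ x ∂μ, ∃ M : ℝ, ∀ k, N k (X x) ≤ M) :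
    Tendsto (fun M => controlMeasure μ X s (largeSet X N M)) atTop (𝓝 0) := by
  have h0 : controlMeasure μ X s (⋂ M, largeSet X N M) = 0 := by
    refine controlMeasure_absolutelyContinuous μ ?_
    refine measure_mono_null (t := {x | ¬ ∃ M : ℝ, ∀ k, N k (X x) ≤ M}) ?_ (ae_iff.1 hbdd)
    rintro x hx ⟨M, hM⟩
    obtain ⟨m, hm⟩ := exists_nat_ge M
    obtain ⟨k, hk⟩ := Set.mem_iUnion.1 (Set.mem_iInter.1 hx m)
    have hk' : (m : ℝ) + 1 < N k (X x) := hk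
    linarith [hM k]
  rw [← h0]
  exact tendsto_measure_iInter_atTop
    (fun M => (measurableSet_largeSet hX hN M).nullMeasurableSet) largeSet_antitone
    ⟨0, ((measure_mono (Set.subset_univ _)).trans_lt
      (controlMeasure_univ_ne_top μ hsum).lt_top).ne⟩

/-- The bound for the energies of the cutoff functions at level `M`. -/
noncomputable def cutoffEnergy (X : S → ℕ → ℝ) (s : ℕ → ℝ) (P : ℝ) (N : ℕ → (ℕ → ℝ) → ℝ) (M : ℕ) :
    ℝ := 2 * (4 * P ^ 2 * (controlMeasure μ X s).real (largeSet X N M))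

omit [IsProbabilityMeasure μ] in
theorem cutoffEnergy_nonneg (M : ℕ) : 0 ≤ cutoffEnergy μ X s P N M := by
  unfold cutoffEnergy; positivity

/-- Since `largeSet` is a union over all potentials, the bound is uniform in `k`. -/
theorem eLpNorm_increment_levelCutoff_le (hpot : ∀ k, IsPotential s P (k + 1) (N k) (ρ k))
    (hα₀ : 0 < α) (hα₁ : α ≤ 1) (hs : ∀ i, 0 < s i) (hs1 : ∀ i, s i ≤ 1) (hP : 0 ≤ P)
    (hsum : Summable fun i => (if s i < 1 then (s i ^ 2)⁻¹ else 0) * μ.real {x | s i < |X x i|})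
    (M k : ℕ) :
    eLpNorm (increment fun t => levelCutoff (M + 1) (N k t)) 2 (jumpMeasure μ hX α) ≤
      ENNReal.ofReal (Real.sqrt (cutoffEnergy μ X s P N M)) := by
  have hM : (0 : ℝ) < M + 1 := by positivity
  refine eLpNorm_two_le_of_lintegral_le (cutoffEnergy_nonneg μ M) ?_
  refine ((hpot k).lintegral_sq_increment_le μ hX hα₀ hα₁ hs hs1 hP hM).trans ?_
  unfold cutoffEnergy
  rw [ENNReal.ofReal_mul zero_le_two, ENNReal.ofReal_ofNat, ENNReal.ofReal_mul (by positivity),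
    measureReal_def, ENNReal.ofReal_toReal ((measure_mono (Set.subset_univ _)).trans_lt
      (controlMeasure_univ_ne_top μ hsum).lt_top).ne]
  gcongr
  exact (hpot k).tsum_energyBound_le μ hX hs1
    (measurableSet_largeSet hX (fun k => (hpot k).measurable) M)
    fun x hx => Set.mem_iUnion.2 ⟨k, hx⟩

theorem measurable_limitCutoff (hpot : ∀ k, IsPotential s P (k + 1) (N k) (ρ k))
    (hmono : ∀ x, Monotone fun k => N k x) (hs : ∀ i, 0 < s i) (hP : 0 ≤ P) (M : ℕ) :
    Measurable (limitCutoff N M) :=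
  measurable_of_tendsto_metrizable
    (fun k => ((hpot k).isLipCylinder hs hP (by positivity : (0 : ℝ) < M + 1)).measurable)
    (tendsto_pi_nhds.2 fun t => tendsto_limitCutoff hmono M t)

/-- For finite `k` the product is a Lipschitz cylinder function and so in the domain. The product
rule for increments bounds its energy uniformly in `k`, and `k → ∞` is a bounded limit. -/
theorem inClosure_mul_limitCutoff (hpot : ∀ k, IsPotential s P (k + 1) (N k) (ρ k))
    (hmono : ∀ x, Monotone fun k => N k x) (hα₀ : 0 < α) (hα₁ : α ≤ 1) (hs : ∀ i, 0 < s i)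
    (hs1 : ∀ i, s i ≤ 1) (hP : 0 ≤ P)
    (hsum : Summable fun i => (if s i < 1 then (s i ^ 2)⁻¹ else 0) * μ.real {x | s i < |X x i|})
    {n : ℕ} {L C : ℝ} {F : (ℕ → ℝ) → ℝ} (hF : IsLipCylinder n L C F) (M : ℕ) :
    (isJumpCore_cylinderCore μ hX hα₀ hα₁).InClosure (fun t => F t * limitCutoff N M t) ∧
      eLpNorm (increment fun t => F t * limitCutoff N M t) 2 (jumpMeasure μ hX α) ≤
        ENNReal.ofReal (C * Real.sqrt (cutoffEnergy μ X s P N M) +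
          (eLpNorm (increment F) 2 (jumpMeasure μ hX α)).toReal) := by
  have hM : (0 : ℝ) < M + 1 := by positivity
  have hlip : ∀ k, IsLipCylinder _ _ _ fun t => F t * levelCutoff (M + 1) (N k t) := fun k =>
    hF.mul ((hpot k).isLipCylinder hs hP hM)
  have hWm := measurable_limitCutoff hpot hmono hs hP M
  have hbound : ∀ t, |F t * limitCutoff N M t| ≤ C := fun t => by
    rw [abs_mul, abs_of_nonneg (limitCutoff_nonneg M t)]
    exact (mul_le_of_le_one_right (abs_nonneg _) (limitCutoff_le_one M t)).trans (hF.bounded t)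
  have hbound' : ∀ k t, |F t * levelCutoff (M + 1) (N k t)| ≤ C := fun k t => by
    rw [abs_mul, abs_of_nonneg (levelCutoff_nonneg hM)]
    exact (mul_le_of_le_one_right (abs_nonneg _) levelCutoff_le_one).trans (hF.bounded t)
  have hmeas : Measurable fun t => F t * limitCutoff N M t := hF.measurable.mul hWm
  refine (isJumpCore_cylinderCore μ hX hα₀ hα₁).inClosure_of_tendsto
    (fun k => (hlip k).inClosure hα₀ hα₁) hmeas
    (MemLp.of_bound (hmeas.comp hX).aestronglyMeasurable C
      (Eventually.of_forall fun x => hbound (X x))) ?_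
    (add_nonneg (mul_nonneg hF.bound_nonneg (Real.sqrt_nonneg _)) ENNReal.toReal_nonneg)
    fun k => ?_
  · refine tendsto_eLpNorm_two_of_bounded (C := C + C) (fun k => ?_) (fun k => ?_) ?_
    · exact (((hlip k).measurable.comp hX).sub (hmeas.comp hX)).aestronglyMeasurable
    · exact Eventually.of_forall fun x =>
        (abs_sub _ _).trans (add_le_add (hbound' k _) (hbound _))
    · refine Eventually.of_forall fun x => ?_
      have := (((tendsto_limitCutoff hmono M (X x)).const_mul (F (X x))).sub_const
        (F (X x) * limitCutoff N M (X x)))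
      rwa [sub_self] at this
  · set w : (ℕ → ℝ) → ℝ := fun t => levelCutoff (M + 1) (N k t) with hw
    have hwlip : IsLipCylinder _ _ _ w := (hpot k).isLipCylinder hs hP hM
    have h1 : eLpNorm (increment fun t => F t * w t) 2 (jumpMeasure μ hX α) ≤
        eLpNorm (C • (fun q => |increment w q|) + fun q => |increment F q|) 2
          (jumpMeasure μ hX α) := by
      refine eLpNorm_mono_real fun q => ?_
      have e : increment (fun t => F t * w t) q =
          F q.2 * increment w q + w q.1 * increment F q := by
        simp only [increment]; ring
      rw [e, Pi.add_apply, Pi.smul_apply, smul_eq_mul, Real.norm_eq_abs]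
      refine (abs_add_le _ _).trans (add_le_add ?_ ?_)
      · rw [abs_mul]
        exact mul_le_mul_of_nonneg_right (hF.bounded _) (abs_nonneg _)
      · rw [abs_mul, hw, abs_of_nonneg (levelCutoff_nonneg hM)]
        exact mul_le_of_le_one_left (abs_nonneg _) levelCutoff_le_one
    refine h1.trans ((eLpNorm_add_le ?_ ?_ one_le_two).trans ?_)
    · exact (hwlip.measurable.increment.norm.const_smul C).aestronglyMeasurable
    · exact hF.measurable.increment.norm.aestronglyMeasurable
    · rw [eLpNorm_const_smul, ENNReal.ofReal_add (mul_nonneg hF.bound_nonneg (Real.sqrt_nonneg _))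
        ENNReal.toReal_nonneg, ENNReal.ofReal_mul hF.bound_nonneg,
        ENNReal.ofReal_toReal (hF.memLp_increment μ hX hα₀ hα₁).eLpNorm_lt_top.ne,
        Real.enorm_of_nonneg hF.bound_nonneg]
      have e1 : eLpNorm (fun q => |increment w q|) 2 (jumpMeasure μ hX α) =
          eLpNorm (increment w) 2 (jumpMeasure μ hX α) := eLpNorm_norm (increment w)
      have e2 : eLpNorm (fun q => |increment F q|) 2 (jumpMeasure μ hX α) =
          eLpNorm (increment F) 2 (jumpMeasure μ hX α) := eLpNorm_norm (increment F)
      rw [e1, e2]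
      gcongr
      exact eLpNorm_increment_levelCutoff_le μ hX hpot hα₀ hα₁ hs hs1 hP hsum M k

theorem hasCutoffs_limitCutoff (hpot : ∀ k, IsPotential s P (k + 1) (N k) (ρ k))
    (hmono : ∀ x, Monotone fun k => N k x) (hα₀ : 0 < α) (hα₁ : α ≤ 1) (hs : ∀ i, 0 < s i)
    (hs1 : ∀ i, s i ≤ 1) (hP : 0 ≤ P)
    (hsum : Summable fun i => (if s i < 1 then (s i ^ 2)⁻¹ else 0) * μ.real {x | s i < |X x i|})
    (hbdd : ∀ᵐ x ∂μ, ∃ M : ℝ, ∀ k, N k (X x) ≤ M) :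
    (isJumpCore_cylinderCore μ hX hα₀ hα₁).HasCutoffs
      (fun M => {x | ∀ k, N k (X x) ≤ 2 * ((M : ℝ) + 1)}) (limitCutoff N) := by
  -- The constant one has no energy, so the product lemma also covers `limitCutoff` itself.
  have hone : IsLipCylinder 0 0 1 fun _ => (1 : ℝ) :=
    ⟨fun _ _ _ => rfl, fun _ => by simp, fun _ _ _ => by simp⟩
  have hcl := fun M => inClosure_mul_limitCutoff μ hX hpot hmono hα₀ hα₁ hs hs1 hP hsum hone M
  have hzero : increment (fun _ : ℕ → ℝ => (1 : ℝ)) = fun _ => 0 := by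
    funext q; simp [increment]
  simp only [one_mul, hzero, eLpNorm_zero', ENNReal.toReal_zero, add_zero] at hcl
  have hNm : ∀ k, Measurable (N k) := fun k => (hpot k).measurable
  have hθ := tendsto_controlMeasure_largeSet μ hX hNm hsum hbdd
  have hθr : Tendsto (fun M => (controlMeasure μ X s).real (largeSet X N M)) atTop (𝓝 0) :=
    (ENNReal.tendsto_toReal ENNReal.zero_ne_top).comp hθ
  refine ⟨fun M => (hcl M).1, fun M x hx => ?_, ?_, ?_, fun F hF => ?_⟩
  · have hx' : ¬ ∀ k, N k (X x) ≤ 2 * ((M : ℝ) + 1) := hx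
    push Not at hx'
    obtain ⟨k, hk⟩ := hx'
    exact limitCutoff_eq_one hk.le
  · refine tendsto_of_tendsto_of_tendsto_of_le_of_le tendsto_const_nhds ?_ (fun _ => zero_le)
      fun M => (hcl M).2
    have h1 : Tendsto (cutoffEnergy μ X s P N) atTop (𝓝 0) := by
      have := (hθr.const_mul (4 * P ^ 2)).const_mul 2
      simpa [cutoffEnergy] using! this
    have h2 := ENNReal.tendsto_ofReal ((Real.continuous_sqrt.tendsto 0).comp h1)
    simpa using h2
  · refine tendsto_eLpNorm_two_of_bounded (C := 1) (fun M => ?_) (fun M => ?_) ?_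
    · exact ((measurable_limitCutoff hpot hmono hs hP M).comp hX).aestronglyMeasurable
    · refine Eventually.of_forall fun x => ?_
      rw [abs_of_nonneg (limitCutoff_nonneg M _)]
      exact limitCutoff_le_one M _
    · filter_upwards [hbdd] with x ⟨B, hB⟩
      obtain ⟨m, hm⟩ := exists_nat_ge B
      refine tendsto_const_nhds.congr' ?_
      filter_upwards [eventually_ge_atTop m] with M hM
      have : (m : ℝ) ≤ M := by exact_mod_cast hM
      exact (limitCutoff_eq_zero fun k => by linarith [hB k]).symm
  · obtain ⟨n, L, C, -, hLip⟩ := IsLipCylinder.exists_of_mem_cylinderCore hF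
    refine ⟨C * Real.sqrt (cutoffEnergy μ X s P N 0) +
      (eLpNorm (increment F) 2 (jumpMeasure μ hX α)).toReal,
      add_nonneg (mul_nonneg hLip.bound_nonneg (Real.sqrt_nonneg _)) ENNReal.toReal_nonneg,
      fun M => ?_⟩
    have hmul := inClosure_mul_limitCutoff μ hX hpot hmono hα₀ hα₁ hs hs1 hP hsum hLip M
    refine ⟨hmul.1, hmul.2.trans (ENNReal.ofReal_le_ofReal ?_)⟩
    have hC := hLip.bound_nonneg
    -- The large sets shrink as `M` grows, so the value at `M = 0` is a bound for all `M`.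
    have hle : cutoffEnergy μ X s P N M ≤ cutoffEnergy μ X s P N 0 := by
      unfold cutoffEnergy
      gcongr
      · exact ((measure_mono (Set.subset_univ _)).trans_lt
          (controlMeasure_univ_ne_top μ hsum).lt_top).ne
      · exact largeSet_antitone M.zero_le
    gcongr

end Main

/-- Strict quasi-regularity from a sequence of potentials with compact level sets. -/
theorem exists_quasiRegular_of_isPotential {S : Type*} [TopologicalSpace S] [MeasurableSpace S]
    [BorelSpace S] (μ : Measure S) [IsProbabilityMeasure μ] {X : S → ℕ → ℝ} (hXc : Continuous X)
    (hXi : Function.Injective X) {α : ℝ} (hα₀ : 0 < α) (hα₁ : α ≤ 1) {s : ℕ → ℝ} {P : ℝ}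
    {N : ℕ → (ℕ → ℝ) → ℝ} {ρ : ℕ → ℕ → (ℕ → ℝ) → ℝ}
    (hpot : ∀ k, IsPotential s P (k + 1) (N k) (ρ k)) (hmono : ∀ x, Monotone fun k => N k x)
    (hs : ∀ i, 0 < s i) (hs1 : ∀ i, s i ≤ 1) (hP : 0 ≤ P)
    (hsum : Summable fun i => (if s i < 1 then (s i ^ 2)⁻¹ else 0) * μ.real {x | s i < |X x i|})
    (hbdd : ∀ᵐ x ∂μ, ∃ M : ℝ, ∀ k, N k (X x) ≤ M)
    (hcomp : ∀ M : ℝ, IsCompact {x | ∀ k, N k (X x) ≤ M}) :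
    ∃ E : DirichletForm μ, E.IsClosureOf X α ∧ E.IsQuasiRegular ∧ E.IsStrictlyQuasiRegular := by
  have : T2Space S := T2Space.of_injective_continuous hXi hXc
  have hX : Measurable X := hXc.measurable
  have hdense := dense_domain (hX := hX) hα₀ hα₁ (exists_preimage_ae_eq hXc hXi
    (K := fun m : ℕ => {x | ∀ k, N k (X x) ≤ m}) (fun m => hcomp m) (by
      filter_upwards [hbdd] with x ⟨M, hM⟩
      obtain ⟨m, hm⟩ := exists_nat_ge M
      exact ⟨m, fun k => (hM k).trans hm⟩))
  have hmarkov := fun F hF => inClosure_unitContraction (μ := μ) (hX := hX) (F := F) hα₀ hα₁ hF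
  set h := isJumpCore_cylinderCore μ hX hα₀ hα₁ with hh
  refine ⟨h.dirichletForm hdense hmarkov, ?_, ?_⟩
  · exact h.isClosureOf_dirichletForm hdense hmarkov fun F hF G hG =>
      preForm_eq_integral μ hX α (h.measurable F hF) (h.measurable G hG)
        (h.memLp_increment F hF) (h.memLp_increment G hG)
  · have hW := hasCutoffs_limitCutoff μ hX hpot hmono hα₀ hα₁ hs hs1 hP hsum hbdd
    refine hW.isQuasiRegular hXc hXi (fun M => hcomp _) (fun M => (hcomp _).isClosed) ?_
    intro M M' hMM x hx k
    have h1 : (M : ℝ) ≤ M' := by exact_mod_cast hMM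
    exact (hx k).trans (by linarith)

/-! ### Weighted suprema as potentials -/

section SupPotential

variable {a s : ℕ → ℝ}

/-- The largest of the first `k + 1` truncated coordinates, on the scale `a`. -/
noncomputable def supPotential (a s : ℕ → ℝ) (k : ℕ) (x : ℕ → ℝ) : ℝ :=
  (Finset.range (k + 1)).sup' Finset.nonempty_range_add_one fun j => max |x j| (s j) / a j

open Classical in
/-- The indicator function of the points at which the `i`-th coordinate is the only maximizer. -/
noncomputable def supWeight (a s : ℕ → ℝ) (k i : ℕ) (x : ℕ → ℝ) : ℝ :=
  if ∀ j < k + 1, j ≠ i → max |x j| (s j) / a j < max |x i| (s i) / a i then 1 else 0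

theorem le_supPotential {k j : ℕ} (hj : j < k + 1) (x : ℕ → ℝ) :
    max |x j| (s j) / a j ≤ supPotential a s k x :=
  Finset.le_sup' (fun j => max |x j| (s j) / a j) (Finset.mem_range.2 hj)

theorem supPotential_mono (x : ℕ → ℝ) : Monotone fun k => supPotential a s k x := by
  intro k l hkl
  refine Finset.sup'_le _ _ fun j hj => le_supPotential ?_ x
  have := Finset.mem_range.1 hj
  omega

theorem supPotential_le {k : ℕ} {x : ℕ → ℝ} {M : ℝ}
    (h : ∀ j < k + 1, max |x j| (s j) / a j ≤ M) : supPotential a s k x ≤ M :=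
  Finset.sup'_le _ _ fun j hj => h j (Finset.mem_range.1 hj)

theorem exists_supPotential_eq (k : ℕ) (x : ℕ → ℝ) :
    ∃ j < k + 1, supPotential a s k x = max |x j| (s j) / a j := by
  obtain ⟨j, hj, h⟩ := Finset.exists_mem_eq_sup' (Finset.nonempty_range_add_one (n := k))
    fun j => max |x j| (s j) / a j
  exact ⟨j, Finset.mem_range.1 hj, h⟩

theorem continuous_supPotential (k : ℕ) : Continuous (supPotential a s k) := by
  unfold supPotential
  refine Continuous.finset_sup'_apply _ fun j _ => ?_
  fun_prop

/-- Changing one coordinate lowers a maximum only if this coordinate was the sole maximizer and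
exceeded its truncation `s i`. The weights are indicators of disjoint sets, so they add up to at
most one. -/
theorem isPotential_supPotential (ha : ∀ i, 0 < a i) (hs : ∀ i, 0 < s i) (k : ℕ) :
    IsPotential s 1 (k + 1) (supPotential a s k) (supWeight a s k) where
  depends x x' h := by
    unfold supPotential
    refine Finset.sup'_congr _ rfl fun j hj => ?_
    rw [h j (Finset.mem_range.1 hj)]
  measurable := (continuous_supPotential k).measurable
  measurable_weight i := by
    classical
    unfold supWeight
    refine Measurable.ite ?_ measurable_const measurable_const
    simp only [Set.ofPred_forall]
    refine MeasurableSet.iInter fun j => MeasurableSet.iInter fun _ => MeasurableSet.iInter fun _ =>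
      measurableSet_lt (by fun_prop) (by fun_prop)
  weight_nonneg i x := by unfold supWeight; split_ifs <;> norm_num
  sum_weight_le x := by
    classical
    by_cases h : ∃ i ∈ Finset.range (k + 1), supWeight a s k i x ≠ 0
    · obtain ⟨i, hi, hne⟩ := h
      have hmax : ∀ j < k + 1, j ≠ i → max |x j| (s j) / a j < max |x i| (s i) / a i := by
        by_contra hcon
        exact hne (by unfold supWeight; rw [if_neg hcon])
      rw [Finset.sum_eq_single_of_mem i hi fun j hj hji => ?_]
      · unfold supWeight; rw [if_pos hmax]
      · unfold supWeight
        rw [if_neg fun hcon => ?_]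
        exact lt_asymm (hmax j (Finset.mem_range.1 hj) hji)
          (hcon i (Finset.mem_range.1 hi) hji.symm)
    · push Not at h
      rw [Finset.sum_eq_zero h]
      norm_num
  decrease x i y hlt := by
    classical
    have hother : ∀ j < k + 1, j ≠ i → max |x j| (s j) / a j < supPotential a s k x := by
      intro j hj hji
      refine lt_of_le_of_lt ?_ hlt
      have h := le_supPotential (a := a) (s := s) hj (Function.update x i y)
      rwa [Function.update_of_ne hji] at h
    obtain ⟨j, hj, hjmax⟩ := exists_supPotential_eq (a := a) (s := s) k x
    have hji : j = i := by
      by_contra hne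
      exact (hother j hj hne).ne' hjmax
    subst hji
    have hy : max |y| (s j) / a j ≤ supPotential a s k (Function.update x j y) := by
      have h := le_supPotential (a := a) (s := s) hj (Function.update x j y)
      rwa [Function.update_self] at h
    have hyx : max |y| (s j) < max |x j| (s j) := by
      have := hy.trans_lt (hlt.trans_eq hjmax)
      rwa [div_lt_div_iff_of_pos_right (ha j)] at this
    have hsx : s j < |x j| := by
      by_contra! hcon
      rw [max_eq_right hcon] at hyx
      exact (le_max_right _ _).not_gt hyx
    have hx0 : 0 < |x j| := (hs j).trans hsx
    refine ⟨hsx, ?_⟩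
    have hw : supWeight a s k j x = 1 := by
      unfold supWeight
      rw [if_pos]
      intro l hl hlj
      rw [← hjmax]
      exact hother l hl hlj
    rw [max_eq_left hsx.le] at hjmax
    have hN : 0 ≤ supPotential a s k x := by rw [hjmax]; exact (div_pos hx0 (ha j)).le
    have hy0 : 0 ≤ max |y| (s j) / a j := div_nonneg (le_max_of_le_left (abs_nonneg _)) (ha j).le
    rw [hw, one_mul, one_mul, mul_min_of_nonneg _ _ hN, mul_one, le_min_iff]
    refine ⟨by linarith, ?_⟩
    have hstep : |y| / a j ≤ supPotential a s k (Function.update x j y) :=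
      (div_le_div_of_nonneg_right (le_max_left _ _) (ha j).le).trans hy
    have heq : supPotential a s k x * (|x j - y| / |x j|) = |x j - y| / a j := by
      rw [hjmax]; field_simp
    rw [heq]
    calc supPotential a s k x - supPotential a s k (Function.update x j y)
        ≤ |x j| / a j - |y| / a j := by rw [hjmax]; linarith
      _ = (|x j| - |y|) / a j := by ring
      _ ≤ |x j - y| / a j := div_le_div_of_nonneg_right (abs_sub_abs_le_abs_sub _ _) (ha j).le

theorem abs_le_of_supPotential_le (ha : ∀ i, 0 < a i) {x : ℕ → ℝ} {M : ℝ}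
    (h : ∀ k, supPotential a s k x ≤ M) (j : ℕ) : |x j| ≤ M * a j := by
  have := (le_supPotential (Nat.lt_succ_self j) x).trans (h j)
  rw [div_le_iff₀ (ha j)] at this
  exact (le_max_left _ _).trans this

theorem isCompact_supPotential_le (ha : ∀ i, 0 < a i) (M : ℝ) :
    IsCompact {x : ℕ → ℝ | ∀ k, supPotential a s k x ≤ M} := by
  refine (isCompact_univ_pi fun j => isCompact_Icc (a := -(M * a j)) (b := M * a j)).of_isClosed_subset
    ?_ fun x hx j _ => abs_le.1 (abs_le_of_supPotential_le ha hx j)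
  simp only [Set.ofPred_forall]
  exact isClosed_iInter fun k => isClosed_le (continuous_supPotential k) continuous_const

end SupPotential

/-- With `s = 1` the summability condition is void. Scales `a j` with tail probabilities at most
`2⁻ʲ` make the potential almost surely bounded by Borel–Cantelli, and its level sets lie in compact
boxes. -/
theorem exists_quasiRegular_real_sequences {α : ℝ} (hα₀ : 0 < α) (hα₁ : α ≤ 1)
    (μ : Measure (ℕ → ℝ)) [IsProbabilityMeasure μ] :
    ∃ E : DirichletForm μ, E.IsClosureOf (fun x => x) α ∧
      E.IsQuasiRegular ∧ E.IsStrictlyQuasiRegular := by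
  have hscale : ∀ j : ℕ, ∃ a : ℝ, 1 ≤ a ∧ μ {x | a < |x j|} ≤ (2⁻¹ : ℝ≥0∞) ^ j := by
    intro j
    have hlim : Tendsto (fun n : ℕ => μ {x | (n : ℝ) < |x j|}) atTop (𝓝 0) := by
      have h : ⋂ n : ℕ, {x : ℕ → ℝ | (n : ℝ) < |x j|} = ∅ := by
        ext x
        simp only [Set.mem_iInter, Set.mem_empty_iff_false, iff_false, not_forall]
        obtain ⟨n, hn⟩ := exists_nat_ge |x j|
        exact ⟨n, not_lt.2 hn⟩
      rw [← measure_empty (μ := μ), ← h]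
      refine tendsto_measure_iInter_atTop (fun n => ?_) (fun m n hmn x hx => ?_)
        ⟨0, measure_ne_top _ _⟩
      · exact (measurableSet_lt measurable_const (by fun_prop)).nullMeasurableSet
      · have hx : (n : ℝ) < |x j| := hx
        exact lt_of_le_of_lt (Nat.cast_le.2 hmn) hx
    obtain ⟨n, hn, hn1⟩ := ((hlim.eventually (gt_mem_nhds
      (ENNReal.pow_pos (ENNReal.inv_pos.2 (ENNReal.ofNat_ne_top (n := 2))) j))).and
        (eventually_ge_atTop 1)).exists
    exact ⟨n, by exact_mod_cast hn1, hn.le⟩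
  choose a ha1 ha using hscale
  have ha0 : ∀ j, 0 < a j := fun j => zero_lt_one.trans_le (ha1 j)
  refine exists_quasiRegular_of_isPotential μ (X := fun x => x) continuous_id
    Function.injective_id hα₀ hα₁ (s := fun _ => 1) (P := 1)
    (fun k => isPotential_supPotential ha0 (fun _ => one_pos) k) supPotential_mono
    (fun _ => one_pos) (fun _ => le_rfl) zero_le_one (by simp) ?_
    (fun M => isCompact_supPotential_le ha0 M)
  have hBC : ∀ᵐ x ∂μ, ∀ᶠ j in atTop, ¬ a j < |x j| := by
    refine ae_eventually_notMem (ne_top_of_le_ne_top ?_ (ENNReal.tsum_le_tsum ha))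
    rw [ENNReal.tsum_geometric]
    norm_num
  filter_upwards [hBC] with x hx
  obtain ⟨n, hn⟩ := eventually_atTop.1 hx
  refine ⟨max 1 (∑ j ∈ Finset.range n, max |x j| 1 / a j), fun k => supPotential_le fun j _ => ?_⟩
  rcases lt_or_ge j n with h | h
  · refine le_max_of_le_right ?_
    exact Finset.single_le_sum (f := fun j => max |x j| 1 / a j)
      (fun i _ => div_nonneg (le_max_of_le_right zero_le_one) (ha0 i).le) (Finset.mem_range.2 h)
  · refine le_max_of_le_left ?_
    rw [div_le_one (ha0 j)]
    exact max_le (not_lt.1 (hn j h)) (ha1 j)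

/-! ### Topology of the weighted spaces and the case `l^∞` -/

namespace WeightedLp

variable {w : ℕ → ℝ} {p : ℝ≥0∞}

theorem coord_injective : Function.Injective (coord : WeightedLp w p → ℕ → ℝ) :=
  Subtype.val_injective

theorem continuous_coord [Fact (1 ≤ p)] (hw : ∀ i, w i ≠ 0) :
    Continuous (coord : WeightedLp w p → ℕ → ℝ) := by
  refine continuous_pi fun i => ?_
  have htoLp : Continuous (toLp : WeightedLp w p → _) := continuous_induced_dom
  have heval : Continuous fun f : lp (fun _ : ℕ => ℝ) p => f i :=
    (lp.lipschitzWith_one_eval p i).continuous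
  have h : (fun x : WeightedLp w p => x.coord i) = fun x => (w i)⁻¹ * x.toLp i := by
    ext x
    change x.1 i = (w i)⁻¹ * (w i * x.1 i)
    rw [inv_mul_cancel_left₀ (hw i)]
  rw [h]
  exact continuous_const.mul (heval.comp htoLp)

/-- A compact set of sequences is compact in the weighted space if coordinatewise convergence
within it implies convergence in the weighted space. -/
theorem isCompact_coord_preimage [Fact (1 ≤ p)] {C : Set (ℕ → ℝ)} (hC : IsCompact C)
    (hmem : ∀ t ∈ C, Memℓp (fun i => w i * t i) p)
    (hdist : ∀ x : WeightedLp w p, x.coord ∈ C → ∀ ε > 0, ∀ᶠ t in 𝓝 x.coord,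
      ∀ y : WeightedLp w p, y.coord = t → t ∈ C → dist y x < ε) :
    IsCompact {x : WeightedLp w p | x.coord ∈ C} := by
  let g : C → WeightedLp w p := fun t => ⟨t, hmem t t.2⟩
  have hg : Continuous g := by
    refine continuous_iff_continuousAt.2 fun t => Metric.tendsto_nhds.2 fun ε hε => ?_
    have h := hdist (g t) t.2 ε hε
    refine (continuous_subtype_val.tendsto t).eventually h |>.mono fun u hu => ?_
    exact hu (g u) rfl u.2
  have := isCompact_iff_compactSpace.1 hC
  convert isCompact_range hg
  ext x
  exact ⟨fun hx => ⟨⟨x.coord, hx⟩, rfl⟩, by rintro ⟨t, rfl⟩; exact t.2⟩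

end WeightedLp

/-- The scale is truncated at one because the energy bound needs `s i ≤ 1`. Where it is smaller than
one it equals `max M₀ 1 * a i`, which exceeds neither too little for the weight (`a i`) nor for the
event (`M₀ * a i`). -/
theorem summable_truncation {S : Type*} [MeasurableSpace S] (μ : Measure S) [IsProbabilityMeasure μ]
    {X : S → ℕ → ℝ} {a : ℕ → ℝ} (ha : ∀ i, 0 < a i) {M₀ : ℝ}
    (h : Summable fun i => (a i ^ 2)⁻¹ * μ.real {x | M₀ * a i < |X x i|}) :
    Summable fun i => (if min 1 (max M₀ 1 * a i) < 1 then (min 1 (max M₀ 1 * a i) ^ 2)⁻¹ else 0) *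
      μ.real {x | min 1 (max M₀ 1 * a i) < |X x i|} := by
  refine Summable.of_nonneg_of_le (fun i => ?_) (fun i => ?_) h
  · refine mul_nonneg ?_ measureReal_nonneg
    split_ifs <;> positivity
  · split_ifs with hlt
    · have hmin : min 1 (max M₀ 1 * a i) = max M₀ 1 * a i := by
        refine min_eq_right (le_of_lt ?_)
        by_contra! hcon
        exact absurd hlt (by rw [min_eq_left hcon]; exact lt_irrefl _)
      rw [hmin]
      have h1 : a i ≤ max M₀ 1 * a i := le_mul_of_one_le_left (ha i).le (le_max_right _ _)
      refine mul_le_mul ?_ (measureReal_mono fun x hx => ?_) measureReal_nonneg (by positivity)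
      · exact inv_anti₀ (pow_pos (ha i) 2) (pow_le_pow_left₀ (ha i).le h1 2)
      · have hx : max M₀ 1 * a i < |X x i| := hx
        exact lt_of_le_of_lt (mul_le_mul_of_nonneg_right (le_max_left _ _) (ha i).le) hx
    · rw [zero_mul]
      exact mul_nonneg (by positivity) measureReal_nonneg

/-- The sup potential on the scale `a i = (β i)⁻¹ * (γ i)⁻¹` has level sets with `β j * |x j| ≤ M *
(γ j)⁻¹`. As `γ j → ∞` these tails are uniformly small, so coordinatewise convergence there is
convergence in norm. -/
theorem exists_quasiRegular_weightedLpTop {α : ℝ} (hα₀ : 0 < α) (hα₁ : α ≤ 1)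
    {β : ℕ → ℝ} (hβ : ∀ i, 0 < β i) (μ : Measure (WeightedLpTop β)) [IsProbabilityMeasure μ]
    {γ : ℕ → ℝ} {M₀ : ℝ} (hγ : ∀ i, 0 < γ i) (hmono : Monotone γ) (htop : Tendsto γ atTop atTop)
    (hsum : Summable fun i => β i ^ 2 * γ i ^ 2 *
      μ.real {x | M₀ * (β i)⁻¹ * (γ i)⁻¹ < |x.coord i|})
    (hbdd : μ (⋃ M : ℕ, {x | ∀ i, |x.coord i| ≤ M * (β i)⁻¹ * (γ i)⁻¹}) = 1) :
    ∃ E : DirichletForm μ, E.IsClosureOf WeightedLp.coord α ∧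
      E.IsQuasiRegular ∧ E.IsStrictlyQuasiRegular := by
  set a : ℕ → ℝ := fun i => (β i)⁻¹ * (γ i)⁻¹ with ha_def
  have ha : ∀ i, 0 < a i := fun i => mul_pos (inv_pos.2 (hβ i)) (inv_pos.2 (hγ i))
  have hs : ∀ i, 0 < min 1 (max M₀ 1 * a i) := fun i =>
    lt_min one_pos (mul_pos (zero_lt_one.trans_le (le_max_right _ _)) (ha i))
  have hcont : Continuous (WeightedLp.coord : WeightedLpTop β → ℕ → ℝ) :=
    WeightedLp.continuous_coord fun i => (hβ i).ne'
  have hβa : ∀ i, β i * a i = (γ i)⁻¹ := fun i => by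
    rw [ha_def]
    exact mul_inv_cancel_left₀ (hβ i).ne' _
  refine exists_quasiRegular_of_isPotential μ hcont WeightedLp.coord_injective hα₀ hα₁ (P := 1)
    (fun k => isPotential_supPotential ha hs k) supPotential_mono hs (fun _ => min_le_left _ _)
    zero_le_one ?_ ?_ fun M => ?_
  · refine summable_truncation μ ha (M₀ := M₀) (hsum.congr fun i => ?_)
    simp only [ha_def, mul_pow, inv_pow, mul_inv, inv_inv, mul_assoc]
  · have hmeas : MeasurableSet (⋃ M : ℕ, {x : WeightedLpTop β |
        ∀ i, |x.coord i| ≤ M * (β i)⁻¹ * (γ i)⁻¹}) := by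
      refine MeasurableSet.iUnion fun M => ?_
      simp only [Set.ofPred_forall]
      exact MeasurableSet.iInter fun i => (isClosed_le
        (continuous_abs.comp ((continuous_apply i).comp hcont)) continuous_const).measurableSet
    filter_upwards [(mem_ae_iff_prob_eq_one hmeas).2 hbdd] with x hx
    obtain ⟨M, hM⟩ := Set.mem_iUnion.1 hx
    have hM : ∀ i, |x.coord i| ≤ M * (β i)⁻¹ * (γ i)⁻¹ := hM
    -- The truncation itself contributes at most `max M₀ 1` to the potential.
    refine ⟨max M (max M₀ 1), fun k => supPotential_le fun j _ => ?_⟩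
    rw [div_le_iff₀ (ha j)]
    refine max_le ((hM j).trans ?_) ((min_le_right _ _).trans ?_)
    · rw [mul_assoc]
      exact mul_le_mul_of_nonneg_right (le_max_left _ _) (ha j).le
    · exact mul_le_mul_of_nonneg_right (le_max_right _ _) (ha j).le
  · have hbound : ∀ t : ℕ → ℝ, (∀ k, supPotential a (fun i => min 1 (max M₀ 1 * a i)) k t ≤ M) →
        ∀ j, β j * |t j| ≤ M * (γ j)⁻¹ := fun t ht j => by
      have h := mul_le_mul_of_nonneg_left (abs_le_of_supPotential_le ha ht j) (hβ j).le
      rwa [mul_left_comm, hβa] at h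
    refine WeightedLp.isCompact_coord_preimage (isCompact_supPotential_le ha M) (fun t ht => ?_)
      fun x hx ε hε => ?_
    · have hM : 0 ≤ M := by
        have h := (mul_nonneg (hβ 0).le (abs_nonneg (t 0))).trans (hbound t ht 0)
        exact nonneg_of_mul_nonneg_left h (inv_pos.2 (hγ 0))
      refine memℓp_infty ⟨M * (γ 0)⁻¹, ?_⟩
      rintro _ ⟨j, rfl⟩
      simp only [norm_mul, Real.norm_eq_abs, abs_of_pos (hβ j)]
      exact (hbound t ht j).trans (mul_le_mul_of_nonneg_left
        (inv_anti₀ (hγ 0) (hmono (Nat.zero_le j))) hM)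
    · have hlim : Tendsto (fun j => 2 * M * (γ j)⁻¹) atTop (𝓝 0) := by
        simpa using (tendsto_inv_atTop_zero.comp htop).const_mul (2 * M)
      obtain ⟨n, hn⟩ := eventually_atTop.1 (hlim.eventually (gt_mem_nhds (half_pos hε)))
      have hfin : ∀ᶠ t in 𝓝 x.coord, ∀ j ∈ Finset.range n, β j * |t j - x.coord j| < ε / 2 := by
        refine (Finset.eventually_all _).2 fun j _ => ?_
        have hc : Continuous fun t : ℕ → ℝ => β j * |t j - x.coord j| := by fun_prop
        refine (hc.tendsto x.coord).eventually (gt_mem_nhds ?_)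
        simpa using half_pos hε
      filter_upwards [hfin] with t ht y hyt htC
      subst hyt
      rw [dist_weightedLpTop fun i => (hβ i).le]
      refine lt_of_le_of_lt (ciSup_le fun j => ?_) (half_lt_self hε)
      rcases lt_or_ge j n with hj | hj
      · exact (ht j (Finset.mem_range.2 hj)).le
      · refine le_trans ?_ (hn j hj).le
        calc β j * |y.coord j - x.coord j| ≤ β j * (|y.coord j| + |x.coord j|) :=
              mul_le_mul_of_nonneg_left (abs_sub _ _) (hβ j).le
          _ ≤ 2 * M * (γ j)⁻¹ := by
              have h1 := hbound _ htC j
              have h2 := hbound _ hx j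
              rw [mul_add]
              linarith

/-! ### Weighted sums of powers as potentials -/

section SumPotential

variable {b s : ℕ → ℝ} {q : ℝ}

/-- The `k`-th partial sum of the weighted powers of the truncated coordinates. -/
noncomputable def sumPotential (b s : ℕ → ℝ) (q : ℝ) (k : ℕ) (x : ℕ → ℝ) : ℝ :=
  ∑ j ∈ Finset.range (k + 1), b j * max |x j| (s j) ^ q

/-- The share of the `i`-th coordinate in the potential. -/
noncomputable def sumWeight (b s : ℕ → ℝ) (q : ℝ) (k i : ℕ) (x : ℕ → ℝ) : ℝ :=
  b i * max |x i| (s i) ^ q / sumPotential b s q k x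

theorem truncatedPower_pos (hb : ∀ i, 0 < b i) (hs : ∀ i, 0 < s i) (i : ℕ) (t : ℝ) :
    0 < b i * max |t| (s i) ^ q :=
  mul_pos (hb i) (Real.rpow_pos_of_pos (lt_max_of_lt_right (hs i)) q)

theorem sumPotential_pos (hb : ∀ i, 0 < b i) (hs : ∀ i, 0 < s i) (k : ℕ) (x : ℕ → ℝ) :
    0 < sumPotential b s q k x :=
  Finset.sum_pos (fun i _ => truncatedPower_pos hb hs i (x i)) Finset.nonempty_range_add_one

theorem sumPotential_mono (hb : ∀ i, 0 < b i) (hs : ∀ i, 0 < s i) (x : ℕ → ℝ) :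
    Monotone fun k => sumPotential b s q k x := fun k l hkl =>
  Finset.sum_le_sum_of_subset_of_nonneg (Finset.range_mono (by omega))
    fun i _ _ => (truncatedPower_pos hb hs i (x i)).le

theorem continuous_sumPotential (hs : ∀ i, 0 < s i) (k : ℕ) :
    Continuous (sumPotential b s q k) := by
  unfold sumPotential
  refine continuous_finsetSum _ fun j _ => continuous_const.mul ?_
  exact Continuous.rpow_const (by fun_prop) fun x => Or.inl (lt_max_of_lt_right (hs j)).ne'

/-- The decrease of a power function, relative to its value. -/
theorem abs_rpow_sub_le {x y : ℝ} (hq : 1 ≤ q) (hx : 0 < |x|) :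
    |x| ^ q - |y| ^ q ≤ |x| ^ q * (q * (|x - y| / |x|)) := by
  have hu : -1 ≤ |y| / |x| - 1 := by have := div_nonneg (abs_nonneg y) hx.le; linarith
  -- Bernoulli's inequality for `(|y| / |x|) ^ q`; this is the source of the factor `P = q`.
  have hbern := one_add_mul_self_le_rpow_one_add hu hq
  rw [add_sub_cancel, Real.div_rpow (abs_nonneg y) hx.le] at hbern
  have hxq : 0 < |x| ^ q := Real.rpow_pos_of_pos hx q
  have h1 : |x| ^ q - |y| ^ q = |x| ^ q * (1 - |y| ^ q / |x| ^ q) := by field_simp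
  rw [h1]
  refine mul_le_mul_of_nonneg_left ?_ hxq.le
  have h2 : 1 - |y| / |x| ≤ |x - y| / |x| := by
    have h3 : 1 - |y| / |x| = (|x| - |y|) / |x| := by field_simp
    rw [h3]
    exact div_le_div_of_nonneg_right (abs_sub_abs_le_abs_sub _ _) hx.le
  have := mul_le_mul_of_nonneg_left h2 (zero_le_one.trans hq)
  linarith

/-- Only the `i`-th term changes, so the relative decrease of the sum is the share of that term
times its own relative decrease. The shares add up to one. -/
theorem isPotential_sumPotential (hb : ∀ i, 0 < b i) (hs : ∀ i, 0 < s i) (hq : 1 ≤ q) (k : ℕ) :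
    IsPotential s q (k + 1) (sumPotential b s q k) (sumWeight b s q k) where
  depends x x' h := Finset.sum_congr rfl fun j hj => by rw [h j (Finset.mem_range.1 hj)]
  measurable := (continuous_sumPotential hs k).measurable
  measurable_weight i := by
    unfold sumWeight
    exact Measurable.div (by fun_prop) (continuous_sumPotential hs k).measurable
  weight_nonneg i x :=
    div_nonneg (truncatedPower_pos hb hs i _).le (sumPotential_pos hb hs k x).le
  sum_weight_le x := by
    unfold sumWeight
    rw [← Finset.sum_div]
    exact div_self_le_one _
  decrease x i y hlt := by
    have hi : i ∈ Finset.range (k + 1) := by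
      by_contra hi
      refine hlt.ne (Finset.sum_congr rfl fun j hj => ?_)
      rw [Function.update_of_ne (by rintro rfl; exact hi hj)]
    have hdiff : sumPotential b s q k x - sumPotential b s q k (Function.update x i y) =
        b i * (max |x i| (s i) ^ q - max |y| (s i) ^ q) := by
      unfold sumPotential
      rw [← Finset.sum_sub_distrib, Finset.sum_eq_single_of_mem i hi fun j _ hji => ?_]
      · rw [Function.update_self, mul_sub]
      · rw [Function.update_of_ne hji, sub_self]
    have hyx : max |y| (s i) < max |x i| (s i) := by
      by_contra! hcon
      have hpow := Real.rpow_le_rpow (le_max_of_le_left (abs_nonneg _)) hcon (zero_le_one.trans hq)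
      have := mul_nonpos_of_nonneg_of_nonpos (hb i).le (sub_nonpos.2 hpow)
      linarith
    have hsx : s i < |x i| := by
      by_contra! hcon
      rw [max_eq_right hcon] at hyx
      exact (le_max_right _ _).not_gt hyx
    have hx0 : 0 < |x i| := (hs i).trans hsx
    refine ⟨hsx, ?_⟩
    have hN := sumPotential_pos (q := q) hb hs k x
    have hxq : 0 < |x i| ^ q := Real.rpow_pos_of_pos hx0 q
    have hweight : ∀ r : ℝ, sumPotential b s q k x * (sumWeight b s q k i x * r) =
        b i * (|x i| ^ q * r) := fun r => by
      unfold sumWeight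
      rw [max_eq_left hsx.le]
      field_simp
    rw [hweight, hdiff, max_eq_left hsx.le]
    refine mul_le_mul_of_nonneg_left ?_ (hb i).le
    have hyq : 0 ≤ max |y| (s i) ^ q := Real.rpow_nonneg (le_max_of_le_left (abs_nonneg _)) q
    rcases min_choice 1 (|x i - y| / |x i|) with h | h <;> rw [h]
    · rw [mul_one]
      nlinarith
    · refine le_trans ?_ (abs_rpow_sub_le hq hx0)
      have := Real.rpow_le_rpow (abs_nonneg y) (le_max_left |y| (s i)) (zero_le_one.trans hq)
      linarith

theorem sum_abs_rpow_le_sumPotential (hb : ∀ i, 0 < b i) (hq : 0 ≤ q) (k : ℕ) (x : ℕ → ℝ) :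
    ∑ j ∈ Finset.range (k + 1), b j * |x j| ^ q ≤ sumPotential b s q k x :=
  Finset.sum_le_sum fun j _ => mul_le_mul_of_nonneg_left
    (Real.rpow_le_rpow (abs_nonneg _) (le_max_left _ _) hq) (hb j).le

theorem sum_abs_rpow_le_of_sumPotential_le (hb : ∀ i, 0 < b i) (hq : 0 ≤ q) {x : ℕ → ℝ} {M : ℝ}
    (h : ∀ k, sumPotential b s q k x ≤ M) (n : ℕ) :
    ∑ j ∈ Finset.range n, b j * |x j| ^ q ≤ M := by
  refine le_trans (Finset.sum_le_sum_of_subset_of_nonneg (Finset.range_mono n.le_succ)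
    fun i _ _ => ?_) ((sum_abs_rpow_le_sumPotential hb hq n x).trans (h n))
  exact mul_nonneg (hb i).le (Real.rpow_nonneg (abs_nonneg _) q)

theorem isCompact_sumPotential_le (hb : ∀ i, 0 < b i) (hs : ∀ i, 0 < s i) (hq : 1 ≤ q) (M : ℝ) :
    IsCompact {x : ℕ → ℝ | ∀ k, sumPotential b s q k x ≤ M} := by
  have hq0 : 0 < q := zero_lt_one.trans_le hq
  refine (isCompact_univ_pi fun j => isCompact_Icc (a := -((M / b j) ^ q⁻¹))
    (b := (M / b j) ^ q⁻¹)).of_isClosed_subset ?_ fun x hx j _ => abs_le.1 ?_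
  · simp only [Set.ofPred_forall]
    exact isClosed_iInter fun k => isClosed_le (continuous_sumPotential hs k) continuous_const
  · have h1 : b j * |x j| ^ q ≤ M :=
      (Finset.single_le_sum (f := fun j => b j * |x j| ^ q)
        (fun i _ => mul_nonneg (hb i).le (Real.rpow_nonneg (abs_nonneg _) q))
        (Finset.self_mem_range_succ j)).trans
          (sum_abs_rpow_le_of_sumPotential_le hb hq0.le hx (j + 1))
    have h2 : |x j| ^ q ≤ M / b j := by rwa [le_div_iff₀' (hb j)]
    calc |x j| = (|x j| ^ q) ^ q⁻¹ := (Real.rpow_rpow_inv (abs_nonneg _) hq0.ne').symm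
      _ ≤ (M / b j) ^ q⁻¹ := Real.rpow_le_rpow (Real.rpow_nonneg (abs_nonneg _) q) h2
          (inv_nonneg.2 hq0.le)

end SumPotential

/-! ### Weights tending to infinity, and the case `l^p` -/

/-- A convergent series of non-negative terms remains convergent when multiplied by a suitable
sequence tending to infinity. -/
theorem exists_tendsto_atTop_summable_mul {e : ℕ → ℝ} (he : ∀ j, 0 ≤ e j) (hsum : Summable e) :
    ∃ c : ℕ → ℝ, (∀ j, 1 ≤ c j) ∧ Tendsto c atTop atTop ∧ Summable fun j => c j * e j := by
  -- The geometric term keeps all the remainders `r n` positive, so their square roots can be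
  -- inverted.
  set d : ℕ → ℝ := fun j => e j + (1 / 2) ^ j with hd
  have hd0 : ∀ j, 0 < d j := fun j => add_pos_of_nonneg_of_pos (he j) (by positivity)
  have hdsum : Summable d := hsum.add summable_geometric_two
  set r : ℕ → ℝ := fun n => ∑' j, d (j + n) with hr
  have hshift : ∀ n, Summable fun j => d (j + n) := fun n => (summable_nat_add_iff n).2 hdsum
  have hr0 : ∀ n, 0 < r n := fun n => (hshift n).tsum_pos (fun j => (hd0 _).le) 0 (hd0 _)
  have hstep : ∀ n, r n = d n + r (n + 1) := fun n => by
    have h := (hshift n).tsum_eq_zero_add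
    rw [zero_add] at h
    rw [hr]
    simp only
    rw [h]
    congr 1
    exact tsum_congr fun j => by rw [add_right_comm, add_assoc]
  have hrlim : Tendsto r atTop (𝓝 0) := tendsto_sum_nat_add d
  have hmain : Summable fun j => (√(r j))⁻¹ * d j := by
    refine summable_of_sum_range_le (c := 2 * √(r 0)) (fun j => by have := hd0 j; positivity)
      fun n => ?_
    -- With `d j = r j - r (j + 1)`, dividing by `√(r j)` leaves a bound that telescopes.
    have hterm : ∀ j, (√(r j))⁻¹ * d j ≤ 2 * √(r j) - 2 * √(r (j + 1)) := fun j => by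
      have hj := Real.sqrt_pos.2 (hr0 j)
      rw [inv_mul_le_iff₀ hj]
      have h1 := Real.sq_sqrt (hr0 j).le
      have h2 := Real.sq_sqrt (hr0 (j + 1)).le
      have h3 := hstep j
      nlinarith [sq_nonneg (√(r j) - √(r (j + 1)))]
    refine (Finset.sum_le_sum fun j _ => hterm j).trans ?_
    rw [Finset.sum_range_sub' fun j => 2 * √(r j)]
    have := Real.sqrt_nonneg (r n)
    linarith
  refine ⟨fun j => 1 + (√(r j))⁻¹, fun j => ?_, ?_, ?_⟩
  · have : 0 ≤ (√(r j))⁻¹ := by positivity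
    linarith
  · refine tendsto_atTop_add_const_left _ _ (Tendsto.inv_tendsto_nhdsGT_zero ?_)
    refine tendsto_nhdsWithin_iff.2 ⟨?_, Eventually.of_forall fun j => Real.sqrt_pos.2 (hr0 j)⟩
    simpa [Function.comp_def] using (Real.continuous_sqrt.tendsto 0).comp hrlim
  · simp only [add_mul, one_mul]
    refine hsum.add (Summable.of_nonneg_of_le (fun j => ?_) (fun j => ?_) hmain)
    · exact mul_nonneg (by positivity) (he j)
    · refine mul_le_mul_of_nonneg_left ?_ (by positivity)
      exact le_add_of_nonneg_right (by positivity)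

/-- The sum is finite but need not be integrable. The positive density `g = (1 + ∑ Z)⁻¹` makes it
so, the scalar statement then yields weights `c` for the integrals, and positivity of `g` turns a
finite integral back into almost sure finiteness. -/
theorem exists_tendsto_atTop_ae_tsum_mul_ne_top {S : Type*} [MeasurableSpace S] (μ : Measure S)
    [IsProbabilityMeasure μ] {Z : ℕ → S → ℝ≥0∞} (hZ : ∀ j, Measurable (Z j))
    (hsum : ∀ x, ∑' j, Z j x ≠ ⊤) :
    ∃ c : ℕ → ℝ, (∀ j, 1 ≤ c j) ∧ Tendsto c atTop atTop ∧
      ∀ᵐ x ∂μ, ∑' j, ENNReal.ofReal (c j) * Z j x ≠ ⊤ := by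
  set g : S → ℝ≥0∞ := fun x => (1 + ∑' j, Z j x)⁻¹ with hg
  have hgm : Measurable g := (measurable_const.add (Measurable.tsum hZ)).inv
  have hg0 : ∀ x, g x ≠ 0 := fun x =>
    ENNReal.inv_ne_zero.2 (ENNReal.add_ne_top.2 ⟨ENNReal.one_ne_top, hsum x⟩)
  have htsum : ∀ c : ℕ → ℝ≥0∞, ∑' j, c j * ∫⁻ x, g x * Z j x ∂μ =
      ∫⁻ x, g x * ∑' j, c j * Z j x ∂μ := fun c => by
    simp_rw [← ENNReal.tsum_mul_left]
    rw [lintegral_tsum (f := fun j x => g x * (c j * Z j x))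
      fun j => (hgm.mul ((hZ j).const_mul (c j))).aemeasurable]
    refine tsum_congr fun j => ?_
    rw [← lintegral_const_mul (c j) (f := fun x => g x * Z j x) (hgm.mul (hZ j))]
    exact lintegral_congr fun x => mul_left_comm _ _ _
  have hone : ∑' j, ∫⁻ x, g x * Z j x ∂μ ≤ 1 := by
    have h := htsum fun _ => 1
    simp only [one_mul] at h
    rw [h]
    calc ∫⁻ x, g x * ∑' j, Z j x ∂μ ≤ ∫⁻ _, 1 ∂μ := lintegral_mono fun x => by
          rw [hg, mul_comm, ← div_eq_mul_inv]
          exact ENNReal.div_le_of_le_mul (by rw [one_mul]; exact le_add_self)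
      _ = 1 := by simp
  have hfin : ∑' j, ∫⁻ x, g x * Z j x ∂μ ≠ ⊤ := ne_top_of_le_ne_top ENNReal.one_ne_top hone
  obtain ⟨c, hc1, hctop, hc⟩ := exists_tendsto_atTop_summable_mul
    (fun j => ENNReal.toReal_nonneg) (ENNReal.summable_toReal hfin)
  refine ⟨c, hc1, hctop, ?_⟩
  have hint : ∫⁻ x, g x * ∑' j, ENNReal.ofReal (c j) * Z j x ∂μ ≠ ⊤ := by
    rw [← htsum]
    convert hc.tsum_ofReal_ne_top using 3 with j
    rw [ENNReal.ofReal_mul (zero_le_one.trans (hc1 j)),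
      ENNReal.ofReal_toReal (ENNReal.ne_top_of_tsum_ne_top hfin j)]
  have hmeas : Measurable fun x => g x * ∑' j, ENNReal.ofReal (c j) * Z j x :=
    hgm.mul (Measurable.tsum fun j => (hZ j).const_mul _)
  filter_upwards [ae_lt_top hmeas hint] with x hx htop
  rw [htop, ENNReal.mul_top (hg0 x)] at hx
  exact lt_irrefl _ hx

theorem max_rpow_le_add {u v q : ℝ} (hu : 0 ≤ u) (hv : 0 ≤ v) :
    max u v ^ q ≤ u ^ q + v ^ q := by
  rcases max_choice u v with h | h <;> rw [h]
  · exact le_add_of_nonneg_right (Real.rpow_nonneg hv q)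
  · exact le_add_of_nonneg_left (Real.rpow_nonneg hu q)

theorem abs_sub_rpow_le {u v q : ℝ} (hq : 0 ≤ q) :
    |u - v| ^ q ≤ 2 ^ q * (|u| ^ q + |v| ^ q) := by
  calc |u - v| ^ q ≤ (2 * max |u| |v|) ^ q := by
        refine Real.rpow_le_rpow (abs_nonneg _) ((abs_sub _ _).trans ?_) hq
        rw [two_mul]
        exact add_le_add (le_max_left _ _) (le_max_right _ _)
    _ = 2 ^ q * max |u| |v| ^ q :=
        Real.mul_rpow zero_le_two (le_max_of_le_left (abs_nonneg _))
    _ ≤ _ := mul_le_mul_of_nonneg_left (max_rpow_le_add (abs_nonneg _) (abs_nonneg _))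
        (Real.rpow_nonneg zero_le_two q)

/-- On a level set `∑ c j * β j * |x j| ^ p ≤ M`, and `c j → ∞` makes the tails of `∑ β j * |x j| ^
p` uniformly small. -/
theorem isCompact_weightedLpFinite_sumPotential_le {β : ℕ → ℝ} {p : ℝ≥0∞} [Fact (1 ≤ p)]
    (hp : p ≠ ⊤) (hβ : ∀ i, 0 < β i) {c s : ℕ → ℝ} (hc : ∀ j, 1 ≤ c j)
    (hctop : Tendsto c atTop atTop) (hs : ∀ i, 0 < s i) (M : ℝ) :
    IsCompact {x : WeightedLpFinite β p |
      ∀ k, sumPotential (fun j => c j * β j) s p.toReal k x.coord ≤ M} := by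
  have hq : 1 ≤ p.toReal := by
    simpa using ENNReal.toReal_mono hp (Fact.out : 1 ≤ p)
  set q := p.toReal with hqdef
  have hq0 : 0 < q := zero_lt_one.trans_le hq
  have hc0 : ∀ j, 0 < c j := fun j => zero_lt_one.trans_le (hc j)
  have hb : ∀ i, 0 < c i * β i := fun i => mul_pos (hc0 i) (hβ i)
  have hpow : ∀ (j : ℕ) (t : ℝ), 0 ≤ β j * |t| ^ q := fun j t =>
    mul_nonneg (hβ j).le (Real.rpow_nonneg (abs_nonneg _) q)
  refine WeightedLp.isCompact_coord_preimage (isCompact_sumPotential_le hb hs hq M)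
    (fun t ht => ?_) fun x hx ε hε => ?_
  · refine (memWeightedLpFinite_iff (fun i => (hβ i).le) hq0 t).2 ?_
    refine summable_of_sum_range_le (fun j => hpow j _) fun n =>
      le_trans (Finset.sum_le_sum fun j _ => ?_)
        (sum_abs_rpow_le_of_sumPotential_le hb hq0.le ht n)
    rw [mul_assoc]
    exact le_mul_of_one_le_left (hpow j _) (hc j)
  · have hM : 0 ≤ M := (sumPotential_pos hb hs 0 _).le.trans (hx 0)
    set η := ε ^ q with hη
    have hη0 : 0 < η := Real.rpow_pos_of_pos hε q
    -- Chosen so that the tail bound `2 ^ q / K * (M + M)` is at most `η / 3`.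
    set K := 6 * 2 ^ q * (M + 1) / η with hK
    have h2q : (0 : ℝ) < 2 ^ q := Real.rpow_pos_of_pos two_pos q
    have hK0 : 0 < K := by positivity
    obtain ⟨n, hn⟩ := eventually_atTop.1 (hctop.eventually_ge_atTop K)
    have hfin : ∀ᶠ t in 𝓝 x.coord,
        ∑ j ∈ Finset.range n, β j * |t j - x.coord j| ^ q < η / 3 := by
      have hcont : Continuous fun t : ℕ → ℝ =>
          ∑ j ∈ Finset.range n, β j * |t j - x.coord j| ^ q := by
        refine continuous_finsetSum _ fun j _ => continuous_const.mul ?_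
        exact Continuous.rpow_const (by fun_prop) fun _ => Or.inr hq0.le
      refine (hcont.tendsto x.coord).eventually (gt_mem_nhds ?_)
      simpa [Real.zero_rpow hq0.ne'] using hη0
    filter_upwards [hfin] with t ht y hyt htC
    subst hyt
    have hterm : ∀ j, β j * |y.coord j - x.coord j| ^ q ≤
        (if j < n then β j * |y.coord j - x.coord j| ^ q else 0) +
          2 ^ q / K * (c j * β j * |y.coord j| ^ q + c j * β j * |x.coord j| ^ q) := fun j => by
      have hnn : 0 ≤ 2 ^ q / K *
          (c j * β j * |y.coord j| ^ q + c j * β j * |x.coord j| ^ q) := by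
        have h1 := hpow j (y.coord j)
        have h2 := hpow j (x.coord j)
        have h3 := hc0 j
        simp only [mul_assoc]
        positivity
      split_ifs with hj
      · exact le_add_of_nonneg_right hnn
      · rw [zero_add]
        have hcK : 1 ≤ c j / K := (one_le_div hK0).2 (hn j (not_lt.1 hj))
        calc β j * |y.coord j - x.coord j| ^ q
            ≤ β j * (2 ^ q * (|y.coord j| ^ q + |x.coord j| ^ q)) :=
              mul_le_mul_of_nonneg_left (abs_sub_rpow_le hq0.le) (hβ j).le
          _ ≤ c j / K * (β j * (2 ^ q * (|y.coord j| ^ q + |x.coord j| ^ q))) := by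
              refine le_mul_of_one_le_left (mul_nonneg (hβ j).le (mul_nonneg h2q.le
                (add_nonneg ?_ ?_))) hcK <;> exact Real.rpow_nonneg (abs_nonneg _) q
          _ = _ := by ring
    have hsum : ∑' j, β j * |y.coord j - x.coord j| ^ q ≤ η / 3 + 2 ^ q / K * (M + M) := by
      refine Real.tsum_le_of_sum_range_le (fun j => hpow j _) fun m =>
        (Finset.sum_le_sum fun j _ => hterm j).trans ?_
      rw [Finset.sum_add_distrib, ← Finset.mul_sum, Finset.sum_add_distrib]
      refine add_le_add (le_trans ?_ ht.le) (mul_le_mul_of_nonneg_left (add_le_add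
        (sum_abs_rpow_le_of_sumPotential_le hb hq0.le htC m)
        (sum_abs_rpow_le_of_sumPotential_le hb hq0.le hx m)) (by positivity))
      rw [← Finset.sum_filter]
      refine Finset.sum_le_sum_of_subset_of_nonneg (fun j hj => ?_) fun j _ _ => hpow j _
      exact Finset.mem_range.2 (Finset.mem_filter.1 hj).2
    have hsmall : 2 ^ q / K * (M + M) ≤ η / 3 := by
      have : 2 ^ q / K * (M + M) = η / 3 * (M / (M + 1)) := by
        rw [hK]; field_simp; ring
      rw [this]
      refine mul_le_of_le_one_right (by positivity) ((div_le_one (by positivity)).2 (by linarith))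
    have hroot : ∀ T : ℝ, 0 ≤ T → T < η → T ^ (1 / q) < ε := fun T h0 h1 => by
      rwa [one_div, Real.rpow_inv_lt_iff_of_pos h0 hε.le hq0]
    rw [dist_weightedLpFinite (fun i => (hβ i).le) hq0]
    exact hroot _ (tsum_nonneg fun j => hpow j _) (by linarith)

/-- Since `β i * s i ^ p` is at most a constant times `(γ i)⁻¹ ^ p`, truncation keeps every point of
the space `p`-summable. This leaves room for weights `c j → ∞` under which the sum is still almost
surely finite, and these give the potential. -/
theorem exists_quasiRegular_weightedLpFinite {α : ℝ} (hα₀ : 0 < α) (hα₁ : α ≤ 1)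
    {p : ℝ≥0∞} [Fact (1 ≤ p)] (hp : p ≠ ⊤)
    {β : ℕ → ℝ} (hβ : ∀ i, 0 < β i) (μ : Measure (WeightedLpFinite β p)) [IsProbabilityMeasure μ]
    {γ : ℕ → ℝ} {M₀ : ℝ} (hγ : ∀ i, 0 < γ i) (hγp : Memℓp (fun i => (γ i)⁻¹) p)
    (hsum : Summable fun i => β i ^ (2 / p.toReal) * γ i ^ 2 *
      μ.real {x | M₀ * β i ^ (-(1 / p.toReal)) * (γ i)⁻¹ < |x.coord i|}) :
    ∃ E : DirichletForm μ, E.IsClosureOf WeightedLp.coord α ∧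
      E.IsQuasiRegular ∧ E.IsStrictlyQuasiRegular := by
  have hq : 1 ≤ p.toReal := by
    simpa using ENNReal.toReal_mono hp (Fact.out : 1 ≤ p)
  have hq0 : 0 < p.toReal := zero_lt_one.trans_le hq
  set a : ℕ → ℝ := fun i => β i ^ (-(1 / p.toReal)) * (γ i)⁻¹ with ha_def
  have ha : ∀ i, 0 < a i := fun i =>
    mul_pos (Real.rpow_pos_of_pos (hβ i) _) (inv_pos.2 (hγ i))
  have hM0 : 0 < max M₀ 1 := zero_lt_one.trans_le (le_max_right _ _)
  set s : ℕ → ℝ := fun i => min 1 (max M₀ 1 * a i) with hs_def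
  have hs : ∀ i, 0 < s i := fun i => lt_min one_pos (mul_pos hM0 (ha i))
  have hcont : Continuous (WeightedLp.coord : WeightedLpFinite β p → ℕ → ℝ) :=
    WeightedLp.continuous_coord fun i => (Real.rpow_pos_of_pos (hβ i) _).ne'
  have hβa : ∀ i, β i * a i ^ p.toReal = ‖(γ i)⁻¹‖ ^ p.toReal := fun i => by
    rw [ha_def, Real.mul_rpow (Real.rpow_nonneg (hβ i).le _) (inv_nonneg.2 (hγ i).le),
      ← Real.rpow_mul (hβ i).le, neg_mul, one_div_mul_cancel hq0.ne', Real.rpow_neg_one,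
      mul_inv_cancel_left₀ (hβ i).ne', Real.norm_of_nonneg (inv_nonneg.2 (hγ i).le)]
  have hβs : Summable fun i => β i * s i ^ p.toReal := by
    refine Summable.of_nonneg_of_le
      (fun i => mul_nonneg (hβ i).le (Real.rpow_nonneg (hs i).le _)) (fun i => ?_)
      (((memℓp_gen_iff hq0).1 hγp).mul_left (max M₀ 1 ^ p.toReal))
    rw [← hβa, mul_left_comm, ← Real.mul_rpow hM0.le (ha i).le]
    exact mul_le_mul_of_nonneg_left
      (Real.rpow_le_rpow (hs i).le (min_le_right _ _) hq0.le) (hβ i).le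
  have hZ : ∀ x : WeightedLpFinite β p,
      Summable fun j => β j * max |x.coord j| (s j) ^ p.toReal := fun x => by
    refine Summable.of_nonneg_of_le (fun j => (truncatedPower_pos hβ hs j _).le) (fun j => ?_)
      (((memWeightedLpFinite_iff (fun i => (hβ i).le) hq0 x.coord).1 x.2).add hβs)
    rw [← mul_add]
    exact mul_le_mul_of_nonneg_left (max_rpow_le_add (abs_nonneg _) (hs j).le) (hβ j).le
  obtain ⟨c, hc, hctop, hcae⟩ := exists_tendsto_atTop_ae_tsum_mul_ne_top μ
    (Z := fun j x => ENNReal.ofReal (β j * max |x.coord j| (s j) ^ p.toReal))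
    (fun j => by
      have hj : Measurable fun x : WeightedLpFinite β p => x.coord j :=
        ((continuous_apply j).comp hcont).measurable
      fun_prop) fun x => (hZ x).tsum_ofReal_ne_top
  have hc0 : ∀ j, 0 < c j := fun j => zero_lt_one.trans_le (hc j)
  have hb : ∀ i, 0 < c i * β i := fun i => mul_pos (hc0 i) (hβ i)
  refine exists_quasiRegular_of_isPotential μ hcont WeightedLp.coord_injective hα₀ hα₁
    (fun k => isPotential_sumPotential hb hs hq k) (sumPotential_mono hb hs) hs
    (fun _ => min_le_left _ _) hq0.le ?_ ?_
    fun M => isCompact_weightedLpFinite_sumPotential_le hp hβ hc hctop hs M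
  · refine summable_truncation μ ha (M₀ := M₀) (hsum.congr fun i => ?_)
    have h1 : (a i ^ 2)⁻¹ = β i ^ (2 / p.toReal) * γ i ^ 2 := by
      rw [ha_def, mul_pow, mul_inv, inv_pow, inv_inv, ← Real.rpow_natCast (β i ^ _),
        ← Real.rpow_mul (hβ i).le, ← Real.rpow_neg (hβ i).le]
      congr 2
      push_cast
      ring
    rw [h1]
    simp only [ha_def, mul_assoc]
  · filter_upwards [hcae] with x hx
    refine ⟨(∑' j, ENNReal.ofReal (c j) *
      ENNReal.ofReal (β j * max |x.coord j| (s j) ^ p.toReal)).toReal, fun k => ?_⟩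
    refine (ENNReal.ofReal_le_iff_le_toReal hx).1 ?_
    unfold sumPotential
    rw [ENNReal.ofReal_sum_of_nonneg fun j _ => (truncatedPower_pos hb hs j _).le]
    refine le_trans (le_of_eq (Finset.sum_congr rfl fun j _ => ?_)) (ENNReal.sum_le_tsum _)
    rw [mul_assoc, ENNReal.ofReal_mul (hc0 j).le]

theorem theorem2 (α : ℝ) (hα₀ : 0 < α) (hα₁ : α ≤ 1) :
    -- (i) weighted `l^p`, `1 ≤ p < ∞`
    (∀ (p : ℝ≥0∞) [Fact (1 ≤ p)] (_ : p ≠ ⊤) (β : ℕ → ℝ) (_ : ∀ i, 0 < β i)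
        (μ : Measure (WeightedLpFinite β p)) [IsProbabilityMeasure μ] (γ : ℕ → ℝ) (M₀ : ℝ),
      (∀ i, 0 < γ i) → Memℓp (fun i => (γ i)⁻¹) p →
      Summable (fun i => β i ^ (2 / p.toReal) * γ i ^ 2 *
        μ.real {x | M₀ * β i ^ (-(1 / p.toReal)) * (γ i)⁻¹ < |x.coord i|}) →
      μ (⋃ M : ℕ, {x | ∀ i,
        |x.coord i| ≤ M * β i ^ (-(1 / p.toReal)) * γ i ^ (-(1 / p.toReal))}) = 1 →
      ∃ E : DirichletForm μ, E.IsClosureOf WeightedLp.coord α ∧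
        E.IsQuasiRegular ∧ E.IsStrictlyQuasiRegular) ∧
    -- (ii) weighted `l^∞`
    (∀ (β : ℕ → ℝ) (_ : ∀ i, 0 < β i)
        (μ : Measure (WeightedLpTop β)) [IsProbabilityMeasure μ] (γ : ℕ → ℝ) (M₀ : ℝ),
      (∀ i, 0 < γ i) → Monotone γ → Tendsto γ atTop atTop →
      Summable (fun i => β i ^ 2 * γ i ^ 2 *
        μ.real {x | M₀ * (β i)⁻¹ * (γ i)⁻¹ < |x.coord i|}) →
      μ (⋃ M : ℕ, {x | ∀ i, |x.coord i| ≤ M * (β i)⁻¹ * (γ i)⁻¹}) = 1 →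
      ∃ E : DirichletForm μ, E.IsClosureOf WeightedLp.coord α ∧
        E.IsQuasiRegular ∧ E.IsStrictlyQuasiRegular) ∧
    -- (iii) the space of all real sequences
    (∀ (μ : Measure (ℕ → ℝ)) [IsProbabilityMeasure μ],
      ∃ E : DirichletForm μ, E.IsClosureOf (fun x => x) α ∧
        E.IsQuasiRegular ∧ E.IsStrictlyQuasiRegular) := by
  refine ⟨?_, ?_, ?_⟩
  · intro p _ hp β hβ μ _ γ M₀ hγ hγp hsum _
    exact exists_quasiRegular_weightedLpFinite hα₀ hα₁ hp hβ μ hγ hγp hsum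
  · intro β hβ μ _ γ M₀ hγ hmono htop hsum hbdd
    exact exists_quasiRegular_weightedLpTop hα₀ hα₁ hβ μ hγ hmono htop hsum hbdd
  · intro μ _
    exact exists_quasiRegular_real_sequences hα₀ hα₁ μ
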